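/- Let $L>0$, $\mathbb T^3=[-L,L)^3$ with periodic boundary conditions, and $s>\frac52$; write $\|f\|_{H^\sigma}=\|(I-\Delta)^{\sigma/2}f\|_{L^2(\mathbb T^3)}$. There is a constant $C>0$, depending only on $L$ and $s$, with the following property. Let $0<T\le \bar T$ and $\varepsilon>0$, let $\bar u_0\in H^{s+2}(\mathbb T^3)$ and $\tilde u_0\in H^{s+1}(\mathbb T^3)$ be vector fields, and let * $\bar u\in L^\infty([0,\bar T];H^{s+2}(\mathbb T^3))$ solve the Euler equations $\partial_t\bar u+\bar u\cdot\nabla\bar u+\nabla\bar p=0$, $\nabla\cdot\bar u=0$, $\bar u(0)=\bar u_0$ on $[0,\bar T]$; * $u\in L^\infty([0,T];H^{s+1}(\mathbb T^3))$ solve the Euler equations $\partial_t u+u\cdot\nabla u+\nabla p=0$, $\nabla\cdot u=0$, $u(0)=\bar u_0+\varepsilon\tilde u_0$ on $[0,T]$; * $\bar u^*\in L^\infty([0,T];H^{s}(\mathbb T^3))$ solve $$\partial_t\bar u^*+u\cdot\nabla\bar u^*+\nabla\bar p^*-\nabla\bar u^*\cdot(u-\bar u^*)=0,\qquad \nabla\cdot\bar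 u^*=0,\qquad \bar u^*(0)=\bar u_0$$ on $[0,T]$, where $(\nabla\bar u^*\cdot(u-\bar u^*))_i=\sum_{j=1}^3\partial_i\bar u^*_j\,(u-\bar u^*)_j$. (Solutions are understood weakly: for every smooth divergence-free periodic field $\varphi$ and every time $t$, the equation tested with $\varphi$ holds integrated over $[0,t]$; the representatives continuous in $(t,x)$ are taken.) If $$\varepsilon\, C\,\bar T\,\|\tilde u_0\|_{H^{s+1}}\le\exp\Big(-C\int_0^{\bar T}\|\bar u(\tau)\|_{H^{s+2}}\,d\tau\Big),$$ then for every $t\in[0,T]$ $$\|\bar u^*(t)-\bar u(t)\|_{H^s}\le \varepsilon\,\|\tilde u_0\|_{H^{s+1}}\,C\,\bar T\,\Big(\sup_{\tau\in[0,\bar T]}\|\bar u(\tau)\|_{H^{s+1}}\Big)\exp\Big(C\int_0^{\bar T}\big(1+\|\bar u(\tau)\|_{H^{s+2}}\big)\,d\tau\Big).$$ In particular (take $T=\bar T$) the bound holds on all of $[0,\bar T]$ when $u$ and $\bar u^*$ are solutions there. -/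

import Mathlib

/-!
Incompressible flows on the three-dimensional torus of side `2L`.

A function on the torus is a function on `Fin 3 → ℝ` that is `2L`-periodic in each coordinate;
the fundamental cell is the cube `[-L, L)³`.
-/

namespace EulerTorus

noncomputable section

/-- The space `ℝ³` (coordinates; all norms that matter below are built explicitly). -/
abbrev Vec : Type := Fin 3 → ℝ

/-- The fundamental cell `[-L, L)³`. -/
def cube (L : ℝ) : Set Vec := Set.pi Set.univ fun _ => Set.Ico (-L) L

/-- `f` is `2L`-periodic in each of the three coordinates. -/
def IsPeriodic {α : Type*} (L : ℝ) (f : Vec → α) : Prop :=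
  ∀ (x : Vec) (i : Fin 3), f (x + Pi.single i (2 * L)) = f x

/-- The Fourier coefficient
`(2L)⁻³ ∫_{[-L,L)³} f(x) exp(-i (π/L) k·x) dx`, for `k ∈ ℤ³`. -/
def coeff (L : ℝ) (f : Vec → ℝ) (k : Fin 3 → ℤ) : ℂ :=
  ((2 * L) ^ 3 : ℝ)⁻¹ *
    ∫ x in cube L, (f x : ℂ) *
      Complex.exp (-(Complex.I * ((Real.pi / L * ∑ i, (k i : ℝ) * x i : ℝ) : ℂ)))

/-- The `k`-th term of `‖(I - Δ)^{σ/2} f‖²_{L²}`, where `f` is a vector field on the torus: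
`(2L)³ (1 + |πk/L|²)^σ ∑ⱼ |f̂ⱼ(k)|²`. -/
def sobolevTerm (L σ : ℝ) (f : Vec → Vec) (k : Fin 3 → ℤ) : ℝ :=
  (2 * L) ^ 3 * (1 + ∑ i, (Real.pi / L * (k i : ℝ)) ^ 2) ^ σ *
    ∑ j, ‖coeff L (fun x => f x j) k‖ ^ 2

/-- The vector field `f` belongs to `H^σ` of the torus (`σ ≥ 0`): it is periodic, square
integrable on the fundamental cell, and its weighted Fourier series converges. -/
structure MemSobolev (L σ : ℝ) (f : Vec → Vec) : Prop where
  periodic : IsPeriodic L f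
  memLp : MeasureTheory.MemLp f 2 (MeasureTheory.volume.restrict (cube L))
  summable : Summable (sobolevTerm L σ f)

/-- The norm `‖f‖_{H^σ} = ‖(I - Δ)^{σ/2} f‖_{L²}` of a vector field in `H^σ` of the torus. -/
def sobolevNorm (L σ : ℝ) (f : Vec → Vec) : ℝ :=
  Real.sqrt (∑' k, sobolevTerm L σ f k)

/-- The partial derivative `∂ⱼ wᵢ` at `x`. -/
def pderiv (j : Fin 3) (w : Vec → Vec) (i : Fin 3) (x : Vec) : ℝ :=
  fderiv ℝ w x (Pi.single j 1) i

/-- The divergence `∇ · w`. -/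
def divergence (w : Vec → Vec) (x : Vec) : ℝ := ∑ i, pderiv i w i x

/-- The vector field `v · ∇w`, with components `∑ⱼ vⱼ ∂ⱼ wᵢ`. -/
def advect (v w : Vec → Vec) (x : Vec) : Vec := fun i => ∑ j, v x j * pderiv j w i x

/-- The vector field `∇w · v`, with components `∑ⱼ (∂ᵢ wⱼ) vⱼ`. -/
def gradDot (w v : Vec → Vec) (x : Vec) : Vec := fun i => ∑ j, pderiv i w j x * v x j

/-- The integral `∫_{[-L,L)³} f · g dx`. -/
def pairing (L : ℝ) (f g : Vec → Vec) : ℝ := ∫ x in cube L, ∑ i, f x i * g x i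

/-- Test fields: smooth, periodic and divergence free. -/
structure IsTestField (L : ℝ) (φ : Vec → Vec) : Prop where
  smooth : ContDiff ℝ (⊤ : ℕ∞) φ
  periodic : IsPeriodic L φ
  div_free : ∀ x, divergence φ x = 0

/-- `v ∈ L^∞([0,T]; H^σ)` is a solution on `[0,T] × 𝕋³` of
`∂ₜ v + N + ∇p = 0`, `∇ · v = 0`, `v(0) = a`, for some pressure `p`.

The equation is tested against divergence free fields, which eliminates the pressure, and is
integrated in time. The definition is used for `σ > 5/2` only, where (by Sobolev embedding) every
continuous field in `H^σ` is continuously differentiable, so the spatial derivatives in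
`div_free` and in `N` are classical ones. A solution in `L^∞([0,T]; H^σ)` has, after
redefinition on a null set, a representative that is continuous on `[0,T] × 𝕋³`; `v` is that
representative. -/
structure IsSolution (L σ T : ℝ) (N : ℝ → Vec → Vec) (a : Vec → Vec) (v : ℝ → Vec → Vec) :
    Prop where
  continuousOn : ContinuousOn (Function.uncurry v) (Set.Icc 0 T ×ˢ Set.univ)
  memSobolev : ∀ t ∈ Set.Icc 0 T, MemSobolev L σ (v t)
  bounded : ∃ M : ℝ, ∀ t ∈ Set.Icc 0 T, sobolevNorm L σ (v t) ≤ M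
  div_free : ∀ t ∈ Set.Icc 0 T, ∀ x, divergence (v t) x = 0
  initial : v 0 = a
  equation : ∀ φ : Vec → Vec, IsTestField L φ → ∀ t ∈ Set.Icc 0 T,
    pairing L (v t) φ = pairing L a φ - ∫ τ in (0 : ℝ)..t, pairing L (N τ) φ

/-- `v ∈ L^∞([0,T]; H^σ)` solves the incompressible Euler equations
`∂ₜ v + v · ∇v + ∇p = 0`, `∇ · v = 0`, `v(0) = a`. -/
def IsEulerSolution (L σ T : ℝ) (a : Vec → Vec) (v : ℝ → Vec → Vec) : Prop :=
  IsSolution L σ T (fun t => advect (v t) (v t)) a v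

/-- `w ∈ L^∞([0,T]; H^σ)` solves, for the given velocity `u`, the modified equation
`∂ₜ w + u · ∇w + ∇q - ∇w · (u - w) = 0`, `∇ · w = 0`, `w(0) = a`. -/
def IsModifiedSolution (L σ T : ℝ) (u : ℝ → Vec → Vec) (a : Vec → Vec) (w : ℝ → Vec → Vec) :
    Prop :=
  IsSolution L σ T (fun t => advect (u t) (w t) - gradDot (w t) (u t - w t)) a w

end

end EulerTorus

open EulerTorus

/-!
Everything is done on the sequences of Fourier coefficients. Tested against divergence-free plane
waves, a weak solution becomes, for each frequency `k`, an integral equation in time in which the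
Leray projection has removed the pressure (`IsSolution.fieldCoeff_eq`). These equations are compared
for the three solutions.

The difference `e = u - ū` satisfies `∂ₜe + u · ∇e + e · ∇ū + ∇p = 0`. The transport term costs no
derivative of `e` in an `H^{s+1}` energy estimate, and the other term costs one derivative of `ū`,
so that `‖e‖_{s+1} ≤ ε ‖ũ₀‖_{s+1} + κ ∫ (‖e‖_{s+1} + ‖ū‖_{s+2}) ‖e‖_{s+1}`
(`exists_euler_stability`).

The equation for the difference `d = ū* - ū` contains `∇ū* · (u - ū*) = ∇(ū + d) · (e - d)`, where
`∇d · e` and `∇d · d` seem to lose a derivative of `d`. But `∇d · d` is a gradient and `∇d · e` equals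
`-∇e · d` up to a gradient (`exists_gradDotCoeff_add`), so that
`∂ₜd + u · ∇d + e · ∇ū - ∇ū · e + ∇ū · d + ∇e · d + ∇p = 0`. The derivative now falls on `e`, which is
controlled in `H^{s+1}`, and an `H^s` energy estimate closes (`exists_modified_stability`); this is why
`u` is taken one derivative smoother than `ū*`, and `ū` two.

Both rest on one energy inequality, `exists_energy_estimate`, for `∂ₜc + V · ∇c + F + ∇p = 0`. The
solutions are not smooth enough to pair the equation with `(I - Δ)^σ c`, so the symbol `⟨k⟩^σ` is
replaced by the finitely supported `cutoff σ N ⟨k⟩`. This has the Lipschitz bound of `⟨k⟩^σ` with a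
constant independent of `N` (`abs_cutoff_weight_sub_le`); hence the commutator with `V · ∇` is bounded
uniformly in `N` (`exists_sum_mul_commutator_le`), the rest of the transport term is skew-adjoint
(`exists_abs_transport_flux_le`), and `N → ∞` is harmless.

Finally, Grönwall's inequality and a bootstrap turn the two integral inequalities into the bound
(`le_of_integral_inequalities`): under the smallness condition `∫ ‖e‖_{s+1}` stays so small that the
quadratic term contributes at most a factor `2`.
-/

namespace EulerTorus

noncomputable section

/-! ### The Fourier weights and their cutoffs -/

/-- Frequencies: the dual lattice `ℤ³` of the torus. -/
abbrev Freq : Type := Fin 3 → ℤ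

/-- The Japanese bracket `(1 + |πk/L|²)^{1/2}`, the symbol of `(I - Δ)^{1/2}` on the torus. -/
def weight (L : ℝ) (k : Freq) : ℝ := Real.sqrt (1 + ∑ i, (Real.pi / L * (k i : ℝ)) ^ 2)

lemma weight_sq (L : ℝ) (k : Freq) :
    weight L k ^ 2 = 1 + ∑ i, (Real.pi / L * (k i : ℝ)) ^ 2 :=
  Real.sq_sqrt (by positivity)

lemma one_le_weight (L : ℝ) (k : Freq) : 1 ≤ weight L k := by
  rw [weight, Real.one_le_sqrt]
  have : 0 ≤ ∑ i, (Real.pi / L * (k i : ℝ)) ^ 2 := by positivity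
  linarith

lemma weight_pos (L : ℝ) (k : Freq) : 0 < weight L k := one_pos.trans_le (one_le_weight L k)

lemma weight_nonneg (L : ℝ) (k : Freq) : 0 ≤ weight L k := (weight_pos L k).le

lemma weight_neg (L : ℝ) (k : Freq) : weight L (-k) = weight L k := by
  unfold weight
  congr 2
  exact Finset.sum_congr rfl fun i _ => by push_cast [Pi.neg_apply]; ring

lemma abs_freq_le_weight (L : ℝ) (k : Freq) (i : Fin 3) :
    |Real.pi / L * (k i : ℝ)| ≤ weight L k := by
  apply Real.abs_le_sqrt
  have := Finset.single_le_sum (f := fun i => (Real.pi / L * (k i : ℝ)) ^ 2)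
    (fun i _ => sq_nonneg _) (Finset.mem_univ i)
  linarith

lemma weight_add_le (L : ℝ) (k l : Freq) : weight L (k + l) ≤ weight L k + weight L l := by
  rw [weight, Real.sqrt_le_left (add_nonneg (weight_nonneg L k) (weight_nonneg L l)), add_sq,
    weight_sq, weight_sq]
  have h : ∑ i, (Real.pi / L * (k i : ℝ)) * (Real.pi / L * (l i : ℝ)) ≤
      weight L k * weight L l := by
    refine (Real.sum_mul_le_sqrt_mul_sqrt _ _ _).trans ?_
    refine mul_le_mul (Real.sqrt_le_sqrt (by linarith)) (Real.sqrt_le_sqrt (by linarith))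
      (Real.sqrt_nonneg _) (weight_nonneg L k)
  have e : ∑ i, (Real.pi / L * ((k + l) i : ℝ)) ^ 2 = ∑ i, (Real.pi / L * (k i : ℝ)) ^ 2
      + 2 * ∑ i, (Real.pi / L * (k i : ℝ)) * (Real.pi / L * (l i : ℝ))
      + ∑ i, (Real.pi / L * (l i : ℝ)) ^ 2 := by
    rw [Finset.mul_sum, ← Finset.sum_add_distrib, ← Finset.sum_add_distrib]
    refine Finset.sum_congr rfl fun i _ => ?_
    push_cast [Pi.add_apply]
    ring
  rw [e]
  linarith

lemma weight_le_sub_add (L : ℝ) (k l : Freq) : weight L k ≤ weight L (k - l) + weight L l := by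
  simpa using weight_add_le L (k - l) l

lemma abs_weight_sub_le (L : ℝ) (k l : Freq) :
    |weight L k - weight L l| ≤ weight L (k - l) := by
  have h1 := weight_le_sub_add L k l
  have h2 := weight_le_sub_add L l k
  rw [← weight_neg L (l - k), neg_sub] at h2
  rw [abs_le]
  constructor <;> linarith

lemma weight_rpow_sq (L σ : ℝ) (k : Freq) :
    (weight L k ^ σ) ^ 2 = (1 + ∑ i, (Real.pi / L * (k i : ℝ)) ^ 2) ^ σ := by
  rw [← weight_sq, ← Real.rpow_natCast, ← Real.rpow_natCast, ← Real.rpow_mul (weight_nonneg L k),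
    ← Real.rpow_mul (weight_nonneg L k), mul_comm]

/-- The Sobolev embedding `H^σ ⊂ L^∞`, `σ > 3/2`, rests on this lattice sum. -/
lemma summable_weight_rpow {L σ : ℝ} (hL : 0 < L) (hσ : 3 / 2 < σ) :
    Summable fun k : Freq => (weight L k ^ (-σ)) ^ 2 := by
  let b := Pi.basisFun ℝ (Fin 3)
  let Λ := Submodule.span ℤ (Set.range b)
  have hmem : ∀ k : Freq, (fun i => (k i : ℝ)) ∈ Λ := fun k => by
    rw [b.mem_span_iff_repr_mem ℤ]
    intro i
    exact ⟨k i, by simp [b]⟩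
  have hrank : Module.finrank ℤ Λ = 3 := by
    rw [ZLattice.rank ℝ Λ]; simp
  have h0 := ZLattice.summable_norm_rpow Λ (-(2 * σ)) (by rw [hrank]; push_cast; linarith)
  have hinj : Function.Injective fun k : Freq => (⟨fun i => (k i : ℝ), hmem k⟩ : Λ) := by
    intro k l h
    funext i
    have := congrFun (congrArg Subtype.val h) i
    simpa using this
  have h1 := (h0.comp_injective hinj).mul_left ((Real.pi / L) ^ (-(2 * σ)))
  have hκ : 0 < Real.pi / L := by positivity
  refine Summable.of_norm_bounded_eventually h1 ?_
  refine (Set.finite_singleton (0 : Freq)).subset fun k hk => ?_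
  by_contra hk0
  apply hk
  have hk1 : 0 < ‖fun i => (k i : ℝ)‖ := by
    rw [norm_pos_iff]
    intro h
    apply hk0
    funext i
    simpa using congrFun h i
  have h2 : Real.pi / L * ‖fun i => (k i : ℝ)‖ ≤ weight L k := by
    rw [← le_div_iff₀' hκ]
    refine (pi_norm_le_iff_of_nonneg (div_nonneg (weight_nonneg L k) hκ.le)).2 fun i => ?_
    have := abs_freq_le_weight L k i
    rwa [abs_mul, abs_of_pos hκ, ← le_div_iff₀' hκ] at this
  have e : (weight L k ^ (-σ)) ^ 2 = weight L k ^ (-(2 * σ)) := by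
    rw [← Real.rpow_natCast, ← Real.rpow_mul (weight_nonneg L k)]
    congr 1
    push_cast
    ring
  change ‖(weight L k ^ (-σ)) ^ 2‖ ≤ _
  rw [e, Real.norm_of_nonneg (Real.rpow_nonneg (weight_nonneg L k) _)]
  simp only [Function.comp_apply]
  calc weight L k ^ (-(2 * σ)) ≤ (Real.pi / L * ‖fun i => (k i : ℝ)‖) ^ (-(2 * σ)) :=
        Real.rpow_le_rpow_of_nonpos (by positivity) h2 (by linarith)
    _ = _ := Real.mul_rpow hκ.le hk1.le

/-! ### Scalar sequences -/

lemma add_rpow_le {x y p : ℝ} (hx : 0 ≤ x) (hy : 0 ≤ y) (hp : 0 ≤ p) :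
    (x + y) ^ p ≤ 2 ^ p * (x ^ p + y ^ p) := by
  have h : (x + y) ^ p ≤ (2 * max x y) ^ p :=
    Real.rpow_le_rpow (by positivity) (by linarith [le_max_left x y, le_max_right x y]) hp
  refine h.trans ?_
  rw [Real.mul_rpow (by norm_num) (le_max_of_le_left hx)]
  gcongr
  rcases max_choice x y with h | h <;> rw [h]
  · linarith [Real.rpow_nonneg hy p]
  · linarith [Real.rpow_nonneg hx p]

lemma rpow_sub_rpow_le {a b p : ℝ} (ha : 0 < a) (hab : a ≤ b) (hp : 1 ≤ p) :
    b ^ p - a ^ p ≤ p * (b - a) * b ^ (p - 1) := by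
  have hb : 0 < b := ha.trans_le hab
  have h := one_add_mul_self_le_rpow_one_add (s := a / b - 1) (by
    have : 0 ≤ a / b := by positivity
    linarith) hp
  rw [add_sub_cancel, Real.div_rpow ha.le hb.le, le_div_iff₀ (by positivity)] at h
  have e : b ^ p = b * b ^ (p - 1) := by
    rw [Real.rpow_sub_one hb.ne']; field_simp
  have e2 : (1 + p * (a / b - 1)) * b ^ p = b ^ p - p * (b - a) * b ^ (p - 1) := by
    rw [e]; field_simp; ring
  linarith

/-- A compactly supported truncation of `r ↦ r ^ σ`, equal to it for `r ≤ N`, and Lipschitz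
with a constant that does not depend on `N`. -/
def cutoff (σ N r : ℝ) : ℝ := min (r ^ σ) (N ^ σ * max 0 (2 - r / N))

lemma cutoff_nonneg {σ N r : ℝ} (hN : 0 < N) (hr : 0 < r) : 0 ≤ cutoff σ N r :=
  le_min (by positivity) (by positivity)

lemma cutoff_le (σ N r : ℝ) : cutoff σ N r ≤ r ^ σ := min_le_left _ _

lemma cutoff_eq {σ N r : ℝ} (hσ : 0 ≤ σ) (hN : 0 < N) (hr : 0 < r) (hrN : r ≤ N) :
    cutoff σ N r = r ^ σ := by
  apply min_eq_left
  have h1 : r ^ σ ≤ N ^ σ := Real.rpow_le_rpow hr.le hrN hσ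
  have h2 : 1 ≤ max 0 (2 - r / N) := le_max_of_le_right (by
    have : r / N ≤ 1 := (div_le_one hN).2 hrN
    linarith)
  have h3 : 0 ≤ N ^ σ := by positivity
  nlinarith

lemma cutoff_eq_zero {σ N r : ℝ} (hN : 0 < N) (hr : 2 * N ≤ r) : cutoff σ N r = 0 := by
  have h : max 0 (2 - r / N) = 0 := max_eq_left (by
    have : 2 ≤ r / N := (le_div_iff₀ hN).2 hr
    linarith)
  rw [cutoff, h, mul_zero]
  exact min_eq_right (Real.rpow_nonneg (by linarith) _)

lemma abs_cutoff_sub_le_of_le {σ N a b : ℝ} (hσ : 1 ≤ σ) (hN : 0 < N) (ha : 0 < a) (hab : a ≤ b) :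
    |cutoff σ N a - cutoff σ N b| ≤ σ * (b - a) * b ^ (σ - 1) := by
  have hb : 0 < b := ha.trans_le hab
  have hpow : |a ^ σ - b ^ σ| ≤ σ * (b - a) * b ^ (σ - 1) := by
    rw [abs_sub_comm, abs_of_nonneg (by
      linarith [Real.rpow_le_rpow ha.le hab (by linarith : (0 : ℝ) ≤ σ)])]
    exact rpow_sub_rpow_le ha hab hσ
  rcases le_or_gt b N with h | h
  · rwa [cutoff_eq (by linarith) hN ha (hab.trans h), cutoff_eq (by linarith) hN hb h]
  · refine (abs_min_sub_min_le_max _ _ _ _).trans (max_le hpow ?_)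
    rw [← mul_sub, abs_mul, abs_of_nonneg (by positivity : (0 : ℝ) ≤ N ^ σ)]
    have h1 : |max 0 (2 - a / N) - max 0 (2 - b / N)| ≤ (b - a) / N := by
      refine (abs_max_sub_max_le_max _ _ _ _).trans ?_
      have h0 : 0 ≤ (b - a) / N := div_nonneg (by linarith) hN.le
      have : (2 - a / N) - (2 - b / N) = (b - a) / N := by ring
      rw [this, abs_of_nonneg h0, sub_self, abs_zero, max_eq_right h0]
    have h2 : N ^ (σ - 1) ≤ b ^ (σ - 1) := Real.rpow_le_rpow hN.le h.le (by linarith)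
    have h3 : N ^ σ = N ^ (σ - 1) * N := by
      rw [Real.rpow_sub_one hN.ne']; field_simp
    calc N ^ σ * |max 0 (2 - a / N) - max 0 (2 - b / N)| ≤ N ^ σ * ((b - a) / N) := by gcongr
      _ = (b - a) * N ^ (σ - 1) := by rw [h3]; field_simp
      _ ≤ (b - a) * b ^ (σ - 1) := by
          have : 0 ≤ b - a := by linarith
          gcongr
      _ ≤ σ * (b - a) * b ^ (σ - 1) := by
          have : 0 ≤ (b - a) * b ^ (σ - 1) := mul_nonneg (by linarith) (by positivity)
          nlinarith

/-- The commutator estimate for the truncated symbol, uniform in the truncation. -/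
lemma abs_cutoff_weight_sub_le {L σ N : ℝ} (hσ : 1 ≤ σ) (hN : 0 < N) (k l : Freq) :
    |cutoff σ N (weight L k) - cutoff σ N (weight L l)| * weight L l ≤
      σ * 2 ^ (σ - 1) * (weight L (k - l) ^ σ * weight L l
        + weight L (k - l) * weight L l ^ σ) := by
  have key : |cutoff σ N (weight L k) - cutoff σ N (weight L l)| ≤
      σ * weight L (k - l) * (weight L (k - l) + weight L l) ^ (σ - 1) := by
    have hk := weight_pos L k
    have hl := weight_pos L l
    have hkl := weight_pos L (k - l)
    have h1 := abs_weight_sub_le L k l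
    rcases le_total (weight L k) (weight L l) with h | h
    · refine (abs_cutoff_sub_le_of_le hσ hN hk h).trans ?_
      rw [abs_sub_comm, abs_of_nonneg (by linarith)] at h1
      gcongr
      linarith
    · rw [abs_sub_comm]
      refine (abs_cutoff_sub_le_of_le hσ hN hl h).trans ?_
      rw [abs_of_nonneg (by linarith)] at h1
      gcongr
      exact weight_le_sub_add L k l
  have h2 := add_rpow_le (weight_nonneg L (k - l)) (weight_nonneg L l)
    (by linarith : 0 ≤ σ - 1)
  have hl := weight_pos L l
  have hkl := weight_pos L (k - l)
  calc _ ≤ σ * weight L (k - l) *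
        (2 ^ (σ - 1) * (weight L (k - l) ^ (σ - 1) + weight L l ^ (σ - 1))) * weight L l := by
        gcongr
        exact key.trans (by gcongr)
    _ = _ := by
        rw [Real.rpow_sub_one hl.ne', Real.rpow_sub_one hkl.ne']
        field_simp

lemma finite_weight_le {L : ℝ} (hL : 0 < L) (R : ℝ) : {k : Freq | weight L k ≤ R}.Finite := by
  have hκ : 0 < Real.pi / L := by positivity
  refine (Set.Finite.pi' (t := fun _ : Fin 3 => {n : ℤ | |(n : ℝ)| ≤ R / (Real.pi / L)})
    fun _ => ?_).subset fun k hk i => ?_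
  · refine (Set.finite_Icc (-⌈R / (Real.pi / L)⌉) ⌈R / (Real.pi / L)⌉).subset fun n hn => ?_
    rw [Set.mem_ofPred_eq, abs_le] at hn
    have := Int.le_ceil (R / (Real.pi / L))
    constructor
    · have : (-(⌈R / (Real.pi / L)⌉ : ℤ) : ℝ) ≤ n := by linarith
      exact_mod_cast this
    · have : (n : ℝ) ≤ ⌈R / (Real.pi / L)⌉ := by linarith
      exact_mod_cast this
  · have := (abs_freq_le_weight L k i).trans hk
    rw [abs_mul, abs_of_pos hκ] at this
    exact (le_div_iff₀' hκ).2 this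

lemma summable_mul_of_sq {ι : Type*} {f g : ι → ℝ} (hf : Summable fun k => f k ^ 2)
    (hg : Summable fun k => g k ^ 2) : Summable fun k => f k * g k := by
  refine Summable.of_norm_bounded (hf.add hg) fun k => ?_
  rw [Real.norm_eq_abs, abs_le]
  constructor <;> nlinarith [sq_nonneg (f k + g k), sq_nonneg (f k - g k)]

lemma tsum_mul_le_sqrt {ι : Type*} {f g : ι → ℝ} (hf : Summable fun k => f k ^ 2)
    (hg : Summable fun k => g k ^ 2) :
    ∑' k, f k * g k ≤ √(∑' k, f k ^ 2) * √(∑' k, g k ^ 2) := by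
  refine (summable_mul_of_sq hf hg).tsum_le_of_sum_le fun S => ?_
  refine (Real.sum_mul_le_sqrt_mul_sqrt _ _ _).trans ?_
  gcongr
  · exact hf.sum_le_tsum _ fun k _ => sq_nonneg _
  · exact hg.sum_le_tsum _ fun k _ => sq_nonneg _

/-- Young's inequality `‖f * g‖_{ℓ²} ≤ ‖f‖_{ℓ²} ‖g‖_{ℓ¹}`, tested against `z ∈ ℓ²`. -/
lemma sum_mul_conv_le {z f g : Freq → ℝ} {S : Finset Freq} {Z F : ℝ}
    (hz : ∀ k, 0 ≤ z k) (hf : ∀ k, 0 ≤ f k) (hg : ∀ k, 0 ≤ g k) (hZ : 0 ≤ Z) (hF : 0 ≤ F)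
    (hzZ : ∑ k ∈ S, z k ^ 2 ≤ Z ^ 2) (hfs : Summable fun k => f k ^ 2)
    (hfF : ∑' k, f k ^ 2 ≤ F ^ 2) (hgs : Summable g) :
    ∑ k ∈ S, z k * ∑' l, f (k - l) * g l ≤ Z * F * ∑' l, g l := by
  have hfF1 : ∀ k, f k ≤ F := fun k => by
    have := (hfs.le_tsum k fun _ _ => sq_nonneg _).trans hfF
    exact (sq_le_sq₀ (hf k) hF).1 this
  have hs : ∀ k, Summable fun l => f (k - l) * g l := fun k =>
    Summable.of_nonneg_of_le (fun l => mul_nonneg (hf _) (hg _))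
      (fun l => mul_le_mul_of_nonneg_right (hfF1 _) (hg l)) (hgs.mul_left F)
  have e : ∑ k ∈ S, z k * ∑' l, f (k - l) * g l =
      ∑' l, (∑ k ∈ S, z k * f (k - l)) * g l := by
    simp_rw [← tsum_mul_left]
    rw [← Summable.tsum_finsetSum fun k _ => (hs k).mul_left (z k)]
    refine tsum_congr fun l => ?_
    rw [Finset.sum_mul]
    exact Finset.sum_congr rfl fun k _ => by ring
  rw [e, ← tsum_mul_left]
  have hle : ∀ l, (∑ k ∈ S, z k * f (k - l)) * g l ≤ Z * F * g l := fun l => by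
    refine mul_le_mul_of_nonneg_right ?_ (hg l)
    refine (Real.sum_mul_le_sqrt_mul_sqrt _ _ _).trans ?_
    have h2 : ∑ k ∈ S, f (k - l) ^ 2 ≤ F ^ 2 := by
      refine le_trans ?_ hfF
      rw [← (Equiv.subRight l).tsum_eq fun k => f k ^ 2]
      exact ((Equiv.subRight l).summable_iff.2 hfs).sum_le_tsum S fun k _ => sq_nonneg _
    exact mul_le_mul (Real.sqrt_le_iff.2 ⟨hZ, hzZ⟩) (Real.sqrt_le_iff.2 ⟨hF, h2⟩)
      (Real.sqrt_nonneg _) hZ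
  refine Summable.tsum_le_tsum hle ?_ (hgs.mul_left _)
  exact Summable.of_nonneg_of_le (fun l => mul_nonneg (Finset.sum_nonneg fun k _ =>
    mul_nonneg (hz _) (hf _)) (hg l)) hle (hgs.mul_left _)

/-! ### Sobolev norms of sequences of Fourier coefficients -/

/-- The sequence of Fourier coefficients of a vector field. -/
abbrev Coeffs : Type := Freq → Fin 3 → ℂ

/-- The `k`-th term of the square of the `H^σ` norm, for a sequence of Fourier coefficients. -/
def hterm (L σ : ℝ) (a : Coeffs) (k : Freq) : ℝ :=
  (2 * L) ^ 3 * (1 + ∑ i, (Real.pi / L * (k i : ℝ)) ^ 2) ^ σ * ∑ j, ‖a k j‖ ^ 2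

/-- The sequence `a` consists of the Fourier coefficients of a field in `H^σ`. -/
def InSobolev (L σ : ℝ) (a : Coeffs) : Prop := Summable (hterm L σ a)

/-- The `H^σ` norm of a sequence of Fourier coefficients. -/
def hnorm (L σ : ℝ) (a : Coeffs) : ℝ := √(∑' k, hterm L σ a k)

/-- The factor `(2L)^{-3/2}` relating the `L²` norm of a field to the `ℓ²` norm of its
coefficients. -/
def volFactor (L : ℝ) : ℝ := √((2 * L) ^ 3)⁻¹

/-- The norm of `(I - Δ)^{-p/2} : L² → L^∞`, up to the volume of the torus. -/
def embedConst (L p : ℝ) : ℝ := √(∑' k : Freq, (weight L k ^ (-p)) ^ 2)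

lemma volFactor_nonneg (L : ℝ) : 0 ≤ volFactor L := Real.sqrt_nonneg _

lemma embedConst_nonneg (L p : ℝ) : 0 ≤ embedConst L p := Real.sqrt_nonneg _

lemma hnorm_nonneg (L σ : ℝ) (a : Coeffs) : 0 ≤ hnorm L σ a := Real.sqrt_nonneg _

lemma hterm_eq (L σ : ℝ) (a : Coeffs) (k : Freq) :
    hterm L σ a k = (2 * L) ^ 3 * (weight L k ^ σ) ^ 2 * ∑ j, ‖a k j‖ ^ 2 := by
  rw [hterm, weight_rpow_sq]

lemma hterm_nonneg {L : ℝ} (hL : 0 < L) (σ : ℝ) (a : Coeffs) (k : Freq) : 0 ≤ hterm L σ a k := by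
  rw [hterm_eq]; positivity

lemma hnorm_sq {L : ℝ} (hL : 0 < L) (σ : ℝ) (a : Coeffs) :
    hnorm L σ a ^ 2 = ∑' k, hterm L σ a k :=
  Real.sq_sqrt (tsum_nonneg (hterm_nonneg hL σ a))

lemma norm_sq_le_sum (z : Fin 3 → ℂ) : ‖z‖ ^ 2 ≤ ∑ j, ‖z j‖ ^ 2 := by
  have h : ‖z‖ ≤ √(∑ j, ‖z j‖ ^ 2) :=
    (pi_norm_le_iff_of_nonneg (Real.sqrt_nonneg _)).2 fun i => Real.le_sqrt_of_sq_le
      (Finset.single_le_sum (f := fun j => ‖z j‖ ^ 2) (fun j _ => sq_nonneg _)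
        (Finset.mem_univ i))
  calc ‖z‖ ^ 2 ≤ √(∑ j, ‖z j‖ ^ 2) ^ 2 := by gcongr
    _ = _ := Real.sq_sqrt (by positivity)

lemma sq_weight_mul_norm_le {L : ℝ} (hL : 0 < L) (σ : ℝ) (a : Coeffs) (k : Freq) :
    (weight L k ^ σ * ‖a k‖) ^ 2 ≤ ((2 * L) ^ 3)⁻¹ * hterm L σ a k := by
  rw [hterm_eq, mul_pow, mul_assoc, inv_mul_cancel_left₀ (by positivity)]
  gcongr
  exact norm_sq_le_sum _

lemma InSobolev.summable_sq {L σ : ℝ} (hL : 0 < L) {a : Coeffs} (ha : InSobolev L σ a) :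
    Summable fun k => (weight L k ^ σ * ‖a k‖) ^ 2 :=
  Summable.of_nonneg_of_le (fun _ => sq_nonneg _) (sq_weight_mul_norm_le hL σ a) (ha.mul_left _)

lemma InSobolev.tsum_sq_le {L σ : ℝ} (hL : 0 < L) {a : Coeffs} (ha : InSobolev L σ a) :
    ∑' k, (weight L k ^ σ * ‖a k‖) ^ 2 ≤ (volFactor L * hnorm L σ a) ^ 2 := by
  rw [mul_pow, hnorm_sq hL, volFactor, Real.sq_sqrt (by positivity), ← tsum_mul_left]
  exact (ha.summable_sq hL).tsum_le_tsum (sq_weight_mul_norm_le hL σ a) (ha.mul_left _)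

lemma InSobolev.weight_mul_norm_le {L σ : ℝ} (hL : 0 < L) {a : Coeffs} (ha : InSobolev L σ a)
    (k : Freq) : weight L k ^ σ * ‖a k‖ ≤ volFactor L * hnorm L σ a := by
  have h := ((ha.summable_sq hL).le_tsum k fun _ _ => sq_nonneg _).trans (ha.tsum_sq_le hL)
  have h1 : 0 ≤ weight L k ^ σ * ‖a k‖ :=
    mul_nonneg (Real.rpow_nonneg (weight_nonneg L k) _) (norm_nonneg _)
  exact (sq_le_sq₀ h1 (mul_nonneg (volFactor_nonneg L) (hnorm_nonneg _ _ _))).1 h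

lemma hterm_mono {L σ σ' : ℝ} (hL : 0 < L) (h : σ ≤ σ') (a : Coeffs) (k : Freq) :
    hterm L σ a k ≤ hterm L σ' a k := by
  rw [hterm_eq, hterm_eq]
  have := Real.rpow_le_rpow_of_exponent_le (one_le_weight L k) h
  have := Real.rpow_nonneg (weight_nonneg L k) σ
  gcongr

lemma InSobolev.mono {L σ σ' : ℝ} (hL : 0 < L) (h : σ ≤ σ') {a : Coeffs}
    (ha : InSobolev L σ' a) : InSobolev L σ a :=
  Summable.of_nonneg_of_le (hterm_nonneg hL σ a) (hterm_mono hL h a) ha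

lemma InSobolev.hnorm_mono {L σ σ' : ℝ} (hL : 0 < L) (h : σ ≤ σ') {a : Coeffs}
    (ha : InSobolev L σ' a) : hnorm L σ a ≤ hnorm L σ' a :=
  Real.sqrt_le_sqrt ((ha.mono hL h).tsum_le_tsum (hterm_mono hL h a) ha)

lemma hterm_sub_le {L : ℝ} (hL : 0 < L) (σ : ℝ) (a b : Coeffs) (k : Freq) :
    hterm L σ (a - b) k ≤ 2 * hterm L σ a k + 2 * hterm L σ b k := by
  have h : ∑ j, ‖(a - b) k j‖ ^ 2 ≤ 2 * ∑ j, ‖a k j‖ ^ 2 + 2 * ∑ j, ‖b k j‖ ^ 2 := by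
    rw [Finset.mul_sum, Finset.mul_sum, ← Finset.sum_add_distrib]
    refine Finset.sum_le_sum fun j _ => ?_
    have h1 : ‖(a - b) k j‖ ≤ ‖a k j‖ + ‖b k j‖ := norm_sub_le _ _
    nlinarith [sq_nonneg (‖a k j‖ - ‖b k j‖), norm_nonneg ((a - b) k j)]
  simp only [hterm_eq]
  calc _ ≤ (2 * L) ^ 3 * (weight L k ^ σ) ^ 2 *
        (2 * ∑ j, ‖a k j‖ ^ 2 + 2 * ∑ j, ‖b k j‖ ^ 2) := by gcongr
    _ = _ := by ring

lemma InSobolev.sub {L σ : ℝ} (hL : 0 < L) {a b : Coeffs} (ha : InSobolev L σ a)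
    (hb : InSobolev L σ b) : InSobolev L σ (a - b) :=
  Summable.of_nonneg_of_le (hterm_nonneg hL σ _) (hterm_sub_le hL σ a b)
    ((ha.mul_left 2).add (hb.mul_left 2))

lemma InSobolev.hnorm_sub_le {L σ : ℝ} (hL : 0 < L) {a b : Coeffs} (ha : InSobolev L σ a)
    (hb : InSobolev L σ b) : hnorm L σ (a - b) ≤ 2 * (hnorm L σ a + hnorm L σ b) := by
  have h0 := hnorm_nonneg L σ a
  have h1 := hnorm_nonneg L σ b
  refine Real.sqrt_le_iff.2 ⟨by positivity, ?_⟩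
  have h2 : ∑' k, hterm L σ (a - b) k ≤ 2 * hnorm L σ a ^ 2 + 2 * hnorm L σ b ^ 2 := by
    rw [hnorm_sq hL, hnorm_sq hL, ← tsum_mul_left, ← tsum_mul_left,
      ← (ha.mul_left 2).tsum_add (hb.mul_left 2)]
    exact (ha.sub hL hb).tsum_le_tsum (hterm_sub_le hL σ a b) ((ha.mul_left 2).add (hb.mul_left 2))
  nlinarith

lemma hnorm_smul {L : ℝ} (σ : ℝ) {ε : ℝ} (hε : 0 ≤ ε) (a : Coeffs) :
    hnorm L σ (fun k j => (ε : ℂ) * a k j) = ε * hnorm L σ a := by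
  have h : ∀ k, hterm L σ (fun k j => (ε : ℂ) * a k j) k = ε ^ 2 * hterm L σ a k := fun k => by
    simp only [hterm, norm_mul, mul_pow, Complex.norm_real, Real.norm_eq_abs, sq_abs,
      ← Finset.mul_sum]
    ring
  simp only [hnorm]
  rw [tsum_congr h, tsum_mul_left, Real.sqrt_mul (sq_nonneg _), Real.sqrt_sq hε]

/-- The Sobolev embedding: `r + 3/2 < σ` derivatives in `L²` make `r` derivatives absolutely
convergent. -/
lemma InSobolev.summable_weight_mul {L σ r : ℝ} (hL : 0 < L) (h : r + 3 / 2 < σ) {a : Coeffs}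
    (ha : InSobolev L σ a) : Summable fun k => weight L k ^ r * ‖a k‖ := by
  refine (summable_mul_of_sq (summable_weight_rpow (σ := σ - r) hL (by linarith))
    (ha.summable_sq hL)).congr fun k => ?_
  rw [← mul_assoc, ← Real.rpow_add (weight_pos L k)]
  congr 2
  ring

lemma InSobolev.tsum_weight_mul_le {L σ r : ℝ} (hL : 0 < L) (h : r + 3 / 2 < σ) {a : Coeffs}
    (ha : InSobolev L σ a) :
    ∑' k, weight L k ^ r * ‖a k‖ ≤ embedConst L (σ - r) * (volFactor L * hnorm L σ a) := by
  have e : ∀ k, weight L k ^ r * ‖a k‖ =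
      weight L k ^ (-(σ - r)) * (weight L k ^ σ * ‖a k‖) := fun k => by
    rw [← mul_assoc, ← Real.rpow_add (weight_pos L k)]
    congr 2
    ring
  rw [tsum_congr e]
  refine (tsum_mul_le_sqrt (summable_weight_rpow (σ := σ - r) hL (by linarith))
    (ha.summable_sq hL)).trans ?_
  refine mul_le_mul_of_nonneg_left ?_ (Real.sqrt_nonneg _)
  exact Real.sqrt_le_iff.2 ⟨mul_nonneg (volFactor_nonneg L) (hnorm_nonneg _ _ _),
    ha.tsum_sq_le hL⟩

/-! ### Product and commutator estimates -/

/-- A kernel dominated by `F(k-l) g(l) + f(k-l) G(l)`, with `F, G ∈ ℓ²` and `f, g ∈ ℓ¹`, maps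
into `ℓ²`. -/
lemma sum_mul_tsum_le_of_le_conv {z f g F G : Freq → ℝ} {h : Freq → Freq → ℝ} {S : Finset Freq}
    {A Z NF NG : ℝ} (hz : ∀ k, 0 ≤ z k) (hf : ∀ k, 0 ≤ f k) (hg : ∀ k, 0 ≤ g k)
    (hF : ∀ k, 0 ≤ F k) (hG : ∀ k, 0 ≤ G k) (hh : ∀ k l, 0 ≤ h k l) (hA : 0 ≤ A) (hZ : 0 ≤ Z)
    (hNF : 0 ≤ NF) (hNG : 0 ≤ NG) (hzZ : ∑ k ∈ S, z k ^ 2 ≤ Z ^ 2)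
    (hfs : Summable f) (hgs : Summable g) (hFs : Summable fun k => F k ^ 2)
    (hGs : Summable fun k => G k ^ 2) (hFN : ∑' k, F k ^ 2 ≤ NF ^ 2)
    (hGN : ∑' k, G k ^ 2 ≤ NG ^ 2)
    (hle : ∀ k l, h k l ≤ A * (F (k - l) * g l + f (k - l) * G l)) :
    ∑ k ∈ S, z k * ∑' l, h k l ≤ A * Z * (NF * ∑' l, g l + (∑' l, f l) * NG) := by
  have hFb : ∀ k, F k ≤ NF := fun k =>
    (sq_le_sq₀ (hF k) hNF).1 ((hFs.le_tsum k fun _ _ => sq_nonneg _).trans hFN)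
  have hGb : ∀ k, G k ≤ NG := fun k =>
    (sq_le_sq₀ (hG k) hNG).1 ((hGs.le_tsum k fun _ _ => sq_nonneg _).trans hGN)
  have s1 : ∀ k, Summable fun l => F (k - l) * g l := fun k =>
    Summable.of_nonneg_of_le (fun l => mul_nonneg (hF _) (hg _))
      (fun l => mul_le_mul_of_nonneg_right (hFb _) (hg l)) (hgs.mul_left NF)
  have s2 : ∀ k, Summable fun l => G (k - l) * f l := fun k =>
    Summable.of_nonneg_of_le (fun l => mul_nonneg (hG _) (hf _))
      (fun l => mul_le_mul_of_nonneg_right (hGb _) (hf l)) (hfs.mul_left NG)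
  have e3 : ∀ k l, f (k - l) * G l = G (k - (Equiv.subLeft k) l) * f ((Equiv.subLeft k) l) :=
    fun k l => by simp [mul_comm]
  have s3 : ∀ k, Summable fun l => f (k - l) * G l := fun k =>
    ((Equiv.subLeft k).summable_iff.2 (s2 k)).congr fun l => (e3 k l).symm
  have t3 : ∀ k, ∑' l, f (k - l) * G l = ∑' l, G (k - l) * f l := fun k => by
    rw [← (Equiv.subLeft k).tsum_eq fun l => G (k - l) * f l]
    exact tsum_congr fun l => e3 k l
  have hs : ∀ k, Summable fun l => h k l := fun k =>
    Summable.of_nonneg_of_le (hh k) (hle k) (((s1 k).add (s3 k)).mul_left A)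
  have hb : ∀ k, ∑' l, h k l ≤ A * (∑' l, F (k - l) * g l + ∑' l, G (k - l) * f l) := fun k => by
    rw [← t3, ← (s1 k).tsum_add (s3 k), ← tsum_mul_left]
    exact (hs k).tsum_le_tsum (hle k) (((s1 k).add (s3 k)).mul_left A)
  calc ∑ k ∈ S, z k * ∑' l, h k l
      ≤ ∑ k ∈ S, z k * (A * (∑' l, F (k - l) * g l + ∑' l, G (k - l) * f l)) :=
        Finset.sum_le_sum fun k _ => mul_le_mul_of_nonneg_left (hb k) (hz k)
    _ = A * (∑ k ∈ S, z k * ∑' l, F (k - l) * g l + ∑ k ∈ S, z k * ∑' l, G (k - l) * f l) := by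
        rw [← Finset.sum_add_distrib, Finset.mul_sum]
        exact Finset.sum_congr rfl fun k _ => by ring
    _ ≤ A * (Z * NF * ∑' l, g l + Z * NG * ∑' l, f l) := by
        gcongr
        · exact sum_mul_conv_le hz hF hg hZ hNF hzZ hFs hFN hgs
        · exact sum_mul_conv_le hz hG hf hZ hNG hzZ hGs hGN hfs
    _ = _ := by ring

/-- The convolution `∑ₗ |v(k-l)| ⟨l⟩ |w(l)|`, which majorizes the Fourier coefficients of both
`v · ∇w` and `∇w · v`. -/
def gradConv (L : ℝ) (v w : Coeffs) (k : Freq) : ℝ :=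
  ∑' l, ‖v (k - l)‖ * (weight L l * ‖w l‖)

/-- The product estimate `‖v ∂w‖_σ ≲ ‖v‖_σ ‖w‖_{σ+1}`, tested against `z ∈ ℓ²`. -/
lemma exists_sum_mul_gradConv_le {L σ : ℝ} (hL : 0 < L) (hσ : 3 / 2 < σ) :
    ∃ K : ℝ, 0 ≤ K ∧ ∀ (v w : Coeffs) (z : Freq → ℝ) (S : Finset Freq) (Z : ℝ),
      InSobolev L σ v → InSobolev L (σ + 1) w → (∀ k, 0 ≤ z k) → 0 ≤ Z →
      ∑ k ∈ S, z k ^ 2 ≤ Z ^ 2 →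
      ∑ k ∈ S, z k * (weight L k ^ σ * gradConv L v w k) ≤
        K * Z * hnorm L σ v * hnorm L (σ + 1) w := by
  refine ⟨2 ^ σ * (2 * (embedConst L σ * volFactor L * volFactor L)), ?_, ?_⟩
  · have := embedConst_nonneg L σ
    have := volFactor_nonneg L
    positivity
  intro v w z S Z hv hw hz hZ hzZ
  have hD := volFactor_nonneg L
  have hE := embedConst_nonneg L σ
  have hnv := hnorm_nonneg L σ v
  have hnw := hnorm_nonneg L (σ + 1) w
  have hsf : Summable fun k => ‖v k‖ := by
    simpa using hv.summable_weight_mul (r := 0) hL (by linarith)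
  have hsg : Summable fun k => weight L k * ‖w k‖ := by
    simpa using hw.summable_weight_mul (r := 1) hL (by linarith)
  have htf : ∑' k, ‖v k‖ ≤ embedConst L σ * (volFactor L * hnorm L σ v) := by
    simpa using hv.tsum_weight_mul_le (r := 0) hL (by linarith)
  have htg : ∑' k, weight L k * ‖w k‖ ≤ embedConst L σ * (volFactor L * hnorm L (σ + 1) w) := by
    simpa using hw.tsum_weight_mul_le (r := 1) hL (by linarith)
  have h := sum_mul_tsum_le_of_le_conv (z := z) (S := S) (A := 2 ^ σ) (Z := Z)
    (f := fun k => ‖v k‖) (g := fun k => weight L k * ‖w k‖)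
    (F := fun k => weight L k ^ σ * ‖v k‖) (G := fun k => weight L k ^ (σ + 1) * ‖w k‖)
    (h := fun k l => weight L k ^ σ * (‖v (k - l)‖ * (weight L l * ‖w l‖)))
    (NF := volFactor L * hnorm L σ v) (NG := volFactor L * hnorm L (σ + 1) w)
    hz (fun k => norm_nonneg _) (fun k => mul_nonneg (weight_nonneg _ _) (norm_nonneg _))
    (fun k => mul_nonneg (Real.rpow_nonneg (weight_nonneg _ _) _) (norm_nonneg _))
    (fun k => mul_nonneg (Real.rpow_nonneg (weight_nonneg _ _) _) (norm_nonneg _))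
    (fun k l => mul_nonneg (Real.rpow_nonneg (weight_nonneg _ _) _)
      (mul_nonneg (norm_nonneg _) (mul_nonneg (weight_nonneg _ _) (norm_nonneg _))))
    (by positivity) hZ (by positivity) (by positivity) hzZ hsf hsg (hv.summable_sq hL)
    (hw.summable_sq hL) (hv.tsum_sq_le hL) (hw.tsum_sq_le hL) (fun k l => by
      have h1 : weight L k ^ σ ≤ 2 ^ σ * (weight L (k - l) ^ σ + weight L l ^ σ) :=
        (Real.rpow_le_rpow (weight_nonneg L k) (weight_le_sub_add L k l) (by linarith)).trans
          (add_rpow_le (weight_nonneg _ _) (weight_nonneg _ _) (by linarith))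
      have h2 : 0 ≤ ‖v (k - l)‖ * (weight L l * ‖w l‖) :=
        mul_nonneg (norm_nonneg _) (mul_nonneg (weight_nonneg _ _) (norm_nonneg _))
      refine (mul_le_mul_of_nonneg_right h1 h2).trans (le_of_eq ?_)
      rw [Real.rpow_add_one (weight_pos L l).ne']
      ring)
  simp_rw [tsum_mul_left] at h
  refine h.trans ?_
  calc _ ≤ 2 ^ σ * Z * ((volFactor L * hnorm L σ v) *
          (embedConst L σ * (volFactor L * hnorm L (σ + 1) w)) +
        (embedConst L σ * (volFactor L * hnorm L σ v)) * (volFactor L * hnorm L (σ + 1) w)) := by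
        gcongr
    _ = _ := by ring

/-- The Kato–Ponce commutator estimate for the truncated symbol `m = cutoff σ N ⟨·⟩`. -/
lemma exists_sum_mul_commutator_le {L σ : ℝ} (hL : 0 < L) (hσ : 5 / 2 < σ) :
    ∃ K : ℝ, 0 ≤ K ∧ ∀ (N : ℝ) (v w : Coeffs) (z : Freq → ℝ) (S : Finset Freq) (Z : ℝ), 0 < N →
      InSobolev L σ v → InSobolev L σ w → (∀ k, 0 ≤ z k) → 0 ≤ Z →
      ∑ k ∈ S, z k ^ 2 ≤ Z ^ 2 →
      ∑ k ∈ S, z k * (∑' l, |cutoff σ N (weight L k) - cutoff σ N (weight L l)| *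
        (‖v (k - l)‖ * (weight L l * ‖w l‖))) ≤ K * Z * hnorm L σ v * hnorm L σ w := by
  refine ⟨σ * 2 ^ (σ - 1) * (2 * (embedConst L (σ - 1) * volFactor L * volFactor L)), ?_, ?_⟩
  · have := embedConst_nonneg L (σ - 1)
    have := volFactor_nonneg L
    have : 0 < σ := by linarith
    positivity
  intro N v w z S Z hN hv hw hz hZ hzZ
  have hσ0 : 0 < σ := by linarith
  have hD := volFactor_nonneg L
  have hE := embedConst_nonneg L (σ - 1)
  have hnv := hnorm_nonneg L σ v
  have hnw := hnorm_nonneg L σ w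
  have hs : ∀ a : Coeffs, InSobolev L σ a → Summable fun k => weight L k * ‖a k‖ := fun a ha => by
    simpa using ha.summable_weight_mul (r := 1) hL (by linarith)
  have ht : ∀ a : Coeffs, InSobolev L σ a →
      ∑' k, weight L k * ‖a k‖ ≤ embedConst L (σ - 1) * (volFactor L * hnorm L σ a) :=
    fun a ha => by
      simpa using ha.tsum_weight_mul_le (r := 1) hL (by linarith)
  have htv := ht v hv
  have htw := ht w hw
  have h := sum_mul_tsum_le_of_le_conv (z := z) (S := S) (A := σ * 2 ^ (σ - 1)) (Z := Z)
    (f := fun k => weight L k * ‖v k‖) (g := fun k => weight L k * ‖w k‖)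
    (F := fun k => weight L k ^ σ * ‖v k‖) (G := fun k => weight L k ^ σ * ‖w k‖)
    (h := fun k l => |cutoff σ N (weight L k) - cutoff σ N (weight L l)| *
        (‖v (k - l)‖ * (weight L l * ‖w l‖)))
    (NF := volFactor L * hnorm L σ v) (NG := volFactor L * hnorm L σ w)
    hz (fun k => mul_nonneg (weight_nonneg _ _) (norm_nonneg _))
    (fun k => mul_nonneg (weight_nonneg _ _) (norm_nonneg _))
    (fun k => mul_nonneg (Real.rpow_nonneg (weight_nonneg _ _) _) (norm_nonneg _))
    (fun k => mul_nonneg (Real.rpow_nonneg (weight_nonneg _ _) _) (norm_nonneg _))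
    (fun k l => mul_nonneg (abs_nonneg _)
      (mul_nonneg (norm_nonneg _) (mul_nonneg (weight_nonneg _ _) (norm_nonneg _))))
    (by positivity) hZ (by positivity) (by positivity) hzZ (hs v hv) (hs w hw)
    (hv.summable_sq hL) (hw.summable_sq hL) (hv.tsum_sq_le hL) (hw.tsum_sq_le hL) (fun k l => by
      have h1 := abs_cutoff_weight_sub_le (L := L) (σ := σ) (by linarith) hN k l
      have h2 : 0 ≤ ‖v (k - l)‖ * ‖w l‖ := by positivity
      refine le_trans (le_of_eq ?_) ((mul_le_mul_of_nonneg_right h1 h2).trans (le_of_eq ?_))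
      · ring
      · ring)
  refine h.trans ?_
  calc _ ≤ σ * 2 ^ (σ - 1) * Z * ((volFactor L * hnorm L σ v) *
          (embedConst L (σ - 1) * (volFactor L * hnorm L σ w)) +
        (embedConst L (σ - 1) * (volFactor L * hnorm L σ v)) * (volFactor L * hnorm L σ w)) := by
        gcongr
    _ = _ := by ring

/-! ### The nonlinear terms and the Leray projection in Fourier variables -/

/-- The symbol of `v · ∇`: the factor with which the mode `l` contributes to the mode `k`. -/
def transportSymbol (L : ℝ) (v : Coeffs) (k l : Freq) : ℂ :=
  Complex.I * ∑ j, ((Real.pi / L * (l j : ℝ) : ℝ) : ℂ) * v (k - l) j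

/-- The Fourier coefficients of `v · ∇w`. -/
def advCoeff (L : ℝ) (v w : Coeffs) : Coeffs := fun k i =>
  ∑' l, transportSymbol L v k l * w l i

/-- The Fourier coefficients of `∇w · v`. -/
def gradDotCoeff (L : ℝ) (w v : Coeffs) : Coeffs := fun k i =>
  ∑' l, Complex.I * ((Real.pi / L * (l i : ℝ) : ℝ) : ℂ) * ∑ j, w l j * v (k - l) j

lemma norm_freq_le_weight (L : ℝ) (l : Freq) (i : Fin 3) :
    ‖((Real.pi / L * (l i : ℝ) : ℝ) : ℂ)‖ ≤ weight L l := by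
  rw [Complex.norm_real, Real.norm_eq_abs]
  exact abs_freq_le_weight L l i

lemma norm_sum_three_le {f : Fin 3 → ℂ} {B : ℝ} (h : ∀ i, ‖f i‖ ≤ B) : ‖∑ i, f i‖ ≤ 3 * B :=
  (norm_sum_le_of_le _ fun i _ => h i).trans (by simp)

lemma norm_transportSymbol_le (L : ℝ) (v : Coeffs) (k l : Freq) :
    ‖transportSymbol L v k l‖ ≤ 3 * (weight L l * ‖v (k - l)‖) := by
  rw [transportSymbol, norm_mul, Complex.norm_I, one_mul]
  refine norm_sum_three_le fun j => ?_
  rw [norm_mul]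
  exact mul_le_mul (norm_freq_le_weight L l j) (norm_le_pi_norm _ _) (norm_nonneg _)
    (weight_nonneg L l)

lemma norm_advCoeff_term_le (L : ℝ) (v w : Coeffs) (k l : Freq) (i : Fin 3) :
    ‖transportSymbol L v k l * w l i‖ ≤ 3 * (‖v (k - l)‖ * (weight L l * ‖w l‖)) := by
  rw [norm_mul]
  refine (mul_le_mul (norm_transportSymbol_le L v k l) (norm_le_pi_norm _ _) (norm_nonneg _)
    (mul_nonneg (by norm_num) (mul_nonneg (weight_nonneg L l) (norm_nonneg _)))).trans
    (le_of_eq (by ring))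

lemma norm_gradDotCoeff_term_le (L : ℝ) (w v : Coeffs) (k l : Freq) (i : Fin 3) :
    ‖Complex.I * ((Real.pi / L * (l i : ℝ) : ℝ) : ℂ) * ∑ j, w l j * v (k - l) j‖ ≤
      3 * (‖v (k - l)‖ * (weight L l * ‖w l‖)) := by
  rw [norm_mul, norm_mul, Complex.norm_I, one_mul]
  have h : ‖∑ j, w l j * v (k - l) j‖ ≤ 3 * (‖w l‖ * ‖v (k - l)‖) := by
    refine norm_sum_three_le fun j => ?_
    rw [norm_mul]
    exact mul_le_mul (norm_le_pi_norm _ _) (norm_le_pi_norm _ _) (norm_nonneg _) (norm_nonneg _)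
  refine (mul_le_mul (norm_freq_le_weight L l i) h (norm_nonneg _) (weight_nonneg L l)).trans
    (le_of_eq (by ring))

lemma summable_gradConv {L σ : ℝ} (hL : 0 < L) (hσ : 5 / 2 < σ) {v w : Coeffs}
    (hv : InSobolev L σ v) (hw : InSobolev L σ w) (k : Freq) :
    Summable fun l => ‖v (k - l)‖ * (weight L l * ‖w l‖) := by
  have h1 : Summable fun l => weight L l * ‖w l‖ := by
    simpa using hw.summable_weight_mul (r := 1) hL (by linarith)
  have h2 : ∀ l, ‖v l‖ ≤ volFactor L * hnorm L 0 v := fun l => by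
    simpa using (hv.mono (σ := 0) hL (by linarith)).weight_mul_norm_le hL l
  exact Summable.of_nonneg_of_le
    (fun l => mul_nonneg (norm_nonneg _) (mul_nonneg (weight_nonneg _ _) (norm_nonneg _)))
    (fun l => mul_le_mul_of_nonneg_right (h2 _) (mul_nonneg (weight_nonneg _ _) (norm_nonneg _)))
    (h1.mul_left _)

lemma summable_advCoeff {L σ : ℝ} (hL : 0 < L) (hσ : 5 / 2 < σ) {v w : Coeffs}
    (hv : InSobolev L σ v) (hw : InSobolev L σ w) (k : Freq) (i : Fin 3) :
    Summable fun l => transportSymbol L v k l * w l i :=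
  Summable.of_norm_bounded ((summable_gradConv hL hσ hv hw k).mul_left 3)
    fun l => norm_advCoeff_term_le L v w k l i

lemma summable_gradDotCoeff {L σ : ℝ} (hL : 0 < L) (hσ : 5 / 2 < σ) {v w : Coeffs}
    (hw : InSobolev L σ w) (hv : InSobolev L σ v) (k : Freq) (i : Fin 3) :
    Summable fun l =>
      Complex.I * ((Real.pi / L * (l i : ℝ) : ℝ) : ℂ) * ∑ j, w l j * v (k - l) j :=
  Summable.of_norm_bounded ((summable_gradConv hL hσ hv hw k).mul_left 3)
    fun l => norm_gradDotCoeff_term_le L w v k l i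

lemma norm_advCoeff_le {L σ : ℝ} (hL : 0 < L) (hσ : 5 / 2 < σ) {v w : Coeffs}
    (hv : InSobolev L σ v) (hw : InSobolev L σ w) (k : Freq) (i : Fin 3) :
    ‖advCoeff L v w k i‖ ≤ 3 * gradConv L v w k := by
  rw [gradConv, ← tsum_mul_left]
  exact tsum_of_norm_bounded ((summable_gradConv hL hσ hv hw k).mul_left 3).hasSum
    fun l => norm_advCoeff_term_le L v w k l i

lemma norm_gradDotCoeff_le {L σ : ℝ} (hL : 0 < L) (hσ : 5 / 2 < σ) {v w : Coeffs}
    (hw : InSobolev L σ w) (hv : InSobolev L σ v) (k : Freq) (i : Fin 3) :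
    ‖gradDotCoeff L w v k i‖ ≤ 3 * gradConv L v w k := by
  rw [gradConv, ← tsum_mul_left]
  exact tsum_of_norm_bounded ((summable_gradConv hL hσ hv hw k).mul_left 3).hasSum
    fun l => norm_gradDotCoeff_term_le L w v k l i

section Bilinear

variable {L σ : ℝ} {v v' w w' : Coeffs}

lemma advCoeff_sub_left (hL : 0 < L) (hσ : 5 / 2 < σ) (hv : InSobolev L σ v)
    (hv' : InSobolev L σ v') (hw : InSobolev L σ w) :
    advCoeff L (v - v') w = advCoeff L v w - advCoeff L v' w := by
  funext k i
  simp only [advCoeff, Pi.sub_apply]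
  rw [← (summable_advCoeff hL hσ hv hw k i).tsum_sub (summable_advCoeff hL hσ hv' hw k i)]
  refine tsum_congr fun l => ?_
  simp only [transportSymbol, Pi.sub_apply, mul_sub, Finset.sum_sub_distrib]
  ring

lemma advCoeff_sub_right (hL : 0 < L) (hσ : 5 / 2 < σ) (hv : InSobolev L σ v)
    (hw : InSobolev L σ w) (hw' : InSobolev L σ w') :
    advCoeff L v (w - w') = advCoeff L v w - advCoeff L v w' := by
  funext k i
  simp only [advCoeff, Pi.sub_apply]
  rw [← (summable_advCoeff hL hσ hv hw k i).tsum_sub (summable_advCoeff hL hσ hv hw' k i)]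
  exact tsum_congr fun l => mul_sub _ _ _

lemma gradDotCoeff_sub_left (hL : 0 < L) (hσ : 5 / 2 < σ) (hw : InSobolev L σ w)
    (hw' : InSobolev L σ w') (hv : InSobolev L σ v) :
    gradDotCoeff L (w - w') v = gradDotCoeff L w v - gradDotCoeff L w' v := by
  funext k i
  simp only [gradDotCoeff, Pi.sub_apply]
  rw [← (summable_gradDotCoeff hL hσ hw hv k i).tsum_sub (summable_gradDotCoeff hL hσ hw' hv k i)]
  refine tsum_congr fun l => ?_
  simp only [sub_mul, Finset.sum_sub_distrib, mul_sub]

lemma gradDotCoeff_sub_right (hL : 0 < L) (hσ : 5 / 2 < σ) (hw : InSobolev L σ w)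
    (hv : InSobolev L σ v) (hv' : InSobolev L σ v') :
    gradDotCoeff L w (v - v') = gradDotCoeff L w v - gradDotCoeff L w v' := by
  funext k i
  simp only [gradDotCoeff, Pi.sub_apply]
  rw [← (summable_gradDotCoeff hL hσ hw hv k i).tsum_sub (summable_gradDotCoeff hL hσ hw hv' k i)]
  refine tsum_congr fun l => ?_
  simp only [Finset.sum_sub_distrib, mul_sub]

/-- `∇w · v + ∇v · w = ∇(v · w)`. -/
lemma exists_gradDotCoeff_add (hL : 0 < L) (hσ : 5 / 2 < σ) (hv : InSobolev L σ v)
    (hw : InSobolev L σ w) (k : Freq) :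
    ∃ q : ℂ, ∀ i, gradDotCoeff L w v k i + gradDotCoeff L v w k i = (k i : ℂ) * q := by
  refine ⟨Complex.I * ((Real.pi / L : ℝ) : ℂ) * ∑' l, ∑ j, w l j * v (k - l) j, fun i => ?_⟩
  have e : gradDotCoeff L v w k i = ∑' l, Complex.I * ((Real.pi / L * ((k - l) i : ℝ) : ℝ) : ℂ) *
      ∑ j, w l j * v (k - l) j := by
    rw [gradDotCoeff, ← (Equiv.subLeft k).tsum_eq]
    refine tsum_congr fun l => ?_
    simp only [Equiv.subLeft_apply, sub_sub_cancel]
    congr 1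
    exact Finset.sum_congr rfl fun j _ => mul_comm _ _
  have hs : Summable fun l => Complex.I * ((Real.pi / L * ((k - l) i : ℝ) : ℝ) : ℂ) *
      ∑ j, w l j * v (k - l) j := by
    refine ((Equiv.subLeft k).summable_iff.2 (summable_gradDotCoeff hL hσ hv hw k i)).congr
      fun l => ?_
    simp only [Function.comp_apply, Equiv.subLeft_apply, sub_sub_cancel]
    congr 1
    exact Finset.sum_congr rfl fun j _ => mul_comm _ _
  rw [e, gradDotCoeff, ← (summable_gradDotCoeff hL hσ hw hv k i).tsum_add hs, ← tsum_mul_left,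
    ← tsum_mul_left]
  refine tsum_congr fun l => ?_
  push_cast [Pi.sub_apply]
  ring

end Bilinear

/-- The matrix `δⱼᵢ - kⱼ kᵢ / |k|²` of the Leray projection onto divergence-free fields. At `k = 0`
the convention `0 / 0 = 0` makes it the identity, as it should be. -/
def leray (k : Freq) (j i : Fin 3) : ℝ :=
  (if i = j then 1 else 0) - (k j : ℝ) * (k i : ℝ) / ∑ m, (k m : ℝ) ^ 2

lemma sum_sq_eq_zero_iff (k : Freq) : ∑ m, (k m : ℝ) ^ 2 = 0 ↔ k = 0 := by
  rw [Finset.sum_eq_zero_iff_of_nonneg fun _ _ => sq_nonneg _]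
  constructor
  · intro h
    funext i
    simpa using h i (Finset.mem_univ i)
  · rintro rfl
    simp

/-- The rows of the projection are orthogonal to `k`. -/
lemma sum_freq_mul_leray (k : Freq) (j : Fin 3) : ∑ i, (k i : ℝ) * leray k j i = 0 := by
  by_cases h : ∑ m, (k m : ℝ) ^ 2 = 0
  · rw [(sum_sq_eq_zero_iff k).1 h]
    simp
  · have e : ∀ i, (k i : ℝ) * leray k j i = (if i = j then (k i : ℝ) else 0) -
        (k j : ℝ) / (∑ m, (k m : ℝ) ^ 2) * (k i : ℝ) ^ 2 := fun i => by
      rw [leray, mul_sub, mul_ite, mul_one, mul_zero]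
      ring
    rw [Finset.sum_congr rfl fun i _ => e i, Finset.sum_sub_distrib, ← Finset.mul_sum,
      div_mul_cancel₀ _ h]
    simp

lemma leray_comm (k : Freq) (j i : Fin 3) : leray k j i = leray k i j := by
  rw [leray, leray, mul_comm]
  congr 1
  simp only [eq_comm]

/-- The Leray projection fixes the coefficients of divergence-free fields. -/
lemma sum_leray_mul_of_div_free {k : Freq} {c : Fin 3 → ℂ} (hc : ∑ i, (k i : ℂ) * c i = 0)
    (j : Fin 3) : ∑ i, (leray k j i : ℂ) * c i = c j := by
  have e : ∀ i, (leray k j i : ℂ) * c i = (if i = j then c i else 0) -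
      (k j : ℂ) / (∑ m, (k m : ℂ) ^ 2) * ((k i : ℂ) * c i) := fun i => by
    rw [leray]
    split_ifs <;> push_cast <;> ring
  rw [Finset.sum_congr rfl fun i _ => e i, Finset.sum_sub_distrib, ← Finset.mul_sum, hc]
  simp

/-- The Leray projection annihilates gradients. -/
lemma sum_leray_mul_freq (k : Freq) (q : ℂ) (j : Fin 3) :
    ∑ i, (leray k j i : ℂ) * ((k i : ℂ) * q) = 0 := by
  have h := sum_freq_mul_leray k j
  have h' : ∑ i, (k i : ℂ) * (leray k j i : ℂ) = 0 := by exact_mod_cast h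
  calc _ = (∑ i, (k i : ℂ) * (leray k j i : ℂ)) * q := by
        rw [Finset.sum_mul]
        exact Finset.sum_congr rfl fun i _ => by ring
    _ = 0 := by rw [h', zero_mul]

/-- The pressure does no work: the projection can be dropped against a divergence-free field. -/
lemma sum_conj_mul_leray {k : Freq} {c : Fin 3 → ℂ} (hc : ∑ i, (k i : ℂ) * c i = 0)
    (z : Fin 3 → ℂ) :
    ∑ j, starRingEnd ℂ (c j) * ∑ i, (leray k j i : ℂ) * z i = ∑ i, starRingEnd ℂ (c i) * z i := by
  simp_rw [Finset.mul_sum]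
  rw [Finset.sum_comm]
  refine Finset.sum_congr rfl fun i _ => ?_
  have h := congrArg (starRingEnd ℂ) (sum_leray_mul_of_div_free hc i)
  rw [← h, map_sum, Finset.sum_mul]
  refine Finset.sum_congr rfl fun j _ => ?_
  rw [map_mul, Complex.conj_ofReal, leray_comm]
  ring

/-! ### The energy flux of a transport term -/

/-- Transport by a divergence-free real field is skew-adjoint. -/
lemma conj_transportSymbol {L : ℝ} {v : Coeffs} (hdiv : ∀ k, ∑ i, (k i : ℂ) * v k i = 0)
    (hreal : ∀ k i, v (-k) i = starRingEnd ℂ (v k i)) (k l : Freq) :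
    starRingEnd ℂ (transportSymbol L v k l) = -transportSymbol L v l k := by
  have h := hdiv (l - k)
  have h1 : ∀ j, starRingEnd ℂ (v (k - l) j) = v (l - k) j := fun j => by
    rw [← hreal, neg_sub]
  simp only [transportSymbol, map_mul, map_sum, Complex.conj_ofReal, h1, Complex.conj_I]
  have e : ∑ j, ((Real.pi / L * (k j : ℝ) : ℝ) : ℂ) * v (l - k) j =
      ∑ j, ((Real.pi / L * (l j : ℝ) : ℝ) : ℂ) * v (l - k) j := by
    rw [← sub_eq_zero, ← Finset.sum_sub_distrib]
    have : ∀ j, ((Real.pi / L * (k j : ℝ) : ℝ) : ℂ) * v (l - k) j -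
        ((Real.pi / L * (l j : ℝ) : ℝ) : ℂ) * v (l - k) j =
        -((Real.pi / L : ℝ) : ℂ) * ((((l - k) j : ℤ) : ℂ) * v (l - k) j) := fun j => by
      push_cast [Pi.sub_apply]
      ring
    rw [Finset.sum_congr rfl fun j _ => this j, ← Finset.mul_sum, h, mul_zero]
  rw [e]
  ring

lemma re_sum_transport_eq_zero {L : ℝ} {v : Coeffs} (hdiv : ∀ k, ∑ i, (k i : ℂ) * v k i = 0)
    (hreal : ∀ k i, v (-k) i = starRingEnd ℂ (v k i)) (y : Coeffs) (S : Finset Freq) :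
    (∑ k ∈ S, ∑ i, starRingEnd ℂ (y k i) * ∑ l ∈ S, transportSymbol L v k l * y l i).re = 0 := by
  set X := ∑ k ∈ S, ∑ i, starRingEnd ℂ (y k i) * ∑ l ∈ S, transportSymbol L v k l * y l i with hX
  have hX1 : X = ∑ k ∈ S, ∑ l ∈ S, ∑ i, starRingEnd ℂ (y k i) * transportSymbol L v k l * y l i := by
    rw [hX]
    refine Finset.sum_congr rfl fun k _ => ?_
    rw [Finset.sum_comm]
    refine Finset.sum_congr rfl fun i _ => ?_
    rw [Finset.mul_sum]
    exact Finset.sum_congr rfl fun l _ => by ring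
  have hconj : starRingEnd ℂ X = -X := by
    rw [hX1, map_sum, Finset.sum_comm, ← Finset.sum_neg_distrib]
    refine Finset.sum_congr rfl fun k _ => ?_
    rw [map_sum, ← Finset.sum_neg_distrib]
    refine Finset.sum_congr rfl fun l _ => ?_
    rw [map_sum, ← Finset.sum_neg_distrib]
    refine Finset.sum_congr rfl fun i _ => ?_
    rw [map_mul, map_mul, Complex.conj_conj, conj_transportSymbol hdiv hreal]
    ring
  have := congrArg Complex.re hconj
  rw [Complex.conj_re, Complex.neg_re] at this
  linarith

/-- The energy estimate for transport by a divergence-free field: the flux of the truncated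
`H^σ` energy of `c` loses no derivative. -/
lemma exists_abs_transport_flux_le {L σ : ℝ} (hL : 0 < L) (hσ : 5 / 2 < σ) :
    ∃ K : ℝ, 0 ≤ K ∧ ∀ (N : ℝ) (v c : Coeffs) (S : Finset Freq), 0 < N →
      InSobolev L σ v → InSobolev L σ c → (∀ k, ∑ i, (k i : ℂ) * v k i = 0) →
      (∀ k i, v (-k) i = starRingEnd ℂ (v k i)) → (∀ k, weight L k < 2 * N → k ∈ S) →
      |∑ k ∈ S, cutoff σ N (weight L k) ^ 2 *
          (∑ i, starRingEnd ℂ (c k i) * advCoeff L v c k i).re| ≤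
        K * hnorm L σ v * hnorm L σ c ^ 2 := by
  obtain ⟨K, hK, hcomm⟩ := exists_sum_mul_commutator_le hL hσ
  refine ⟨9 * K * volFactor L, by have := volFactor_nonneg L; positivity, ?_⟩
  intro N v c S hN hv hc hdiv hreal hS
  set m : Freq → ℝ := fun k => cutoff σ N (weight L k) with hm
  have hm0 : ∀ k, 0 ≤ m k := fun k => cutoff_nonneg hN (weight_pos L k)
  have hmS : ∀ k, k ∉ S → m k = 0 := fun k hk =>
    cutoff_eq_zero hN (not_lt.1 fun h => hk (hS k h))
  have hmle : ∀ k, m k ≤ weight L k ^ σ := fun k => cutoff_le _ _ _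
  set R : Coeffs := fun k i => ∑' l, ((m k - m l : ℝ) : ℂ) * (transportSymbol L v k l * c l i)
    with hR
  have hmb : ∃ B : ℝ, ∀ k, m k ≤ B := by
    refine ⟨∑ k ∈ S, m k, fun k => ?_⟩
    by_cases hk : k ∈ S
    · exact Finset.single_le_sum (fun k _ => hm0 k) hk
    · rw [hmS k hk]
      exact Finset.sum_nonneg fun k _ => hm0 k
  obtain ⟨B, hB⟩ := hmb
  have hmm : ∀ k l, |m k - m l| ≤ B := fun k l => by
    rw [abs_le]
    constructor <;> linarith [hm0 k, hm0 l, hB k, hB l]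
  have hsum := fun k i => summable_advCoeff hL hσ hv hc k i
  have hgc := fun k => summable_gradConv hL hσ hv hc k
  have hnn : ∀ k l, 0 ≤ ‖v (k - l)‖ * (weight L l * ‖c l‖) := fun k l =>
    mul_nonneg (norm_nonneg _) (mul_nonneg (weight_nonneg _ _) (norm_nonneg _))
  have hsR' : ∀ k, Summable fun l => |m k - m l| * (‖v (k - l)‖ * (weight L l * ‖c l‖)) :=
    fun k => Summable.of_nonneg_of_le (fun l => mul_nonneg (abs_nonneg _) (hnn k l))
      (fun l => mul_le_mul_of_nonneg_right (hmm k l) (hnn k l)) ((hgc k).mul_left B)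
  have hRterm : ∀ k l i, ‖((m k - m l : ℝ) : ℂ) * (transportSymbol L v k l * c l i)‖ ≤
      3 * (|m k - m l| * (‖v (k - l)‖ * (weight L l * ‖c l‖))) := fun k l i => by
    rw [norm_mul, Complex.norm_real, Real.norm_eq_abs]
    refine (mul_le_mul_of_nonneg_left (norm_advCoeff_term_le L v c k l i) (abs_nonneg _)).trans
      (le_of_eq (by ring))
  have hRs : ∀ k i, Summable fun l => ((m k - m l : ℝ) : ℂ) * (transportSymbol L v k l * c l i) :=
    fun k i => Summable.of_norm_bounded ((hsR' k).mul_left 3) fun l => hRterm k l i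
  have hRle : ∀ k i, ‖R k i‖ ≤ 3 * ∑' l, |m k - m l| * (‖v (k - l)‖ * (weight L l * ‖c l‖)) :=
    fun k i => by
      rw [← tsum_mul_left]
      exact tsum_of_norm_bounded ((hsR' k).mul_left 3).hasSum fun l => hRterm k l i
  -- the symbol is moved from the mode `k` to the mode `l`, at the price of the commutator `R`
  have hsplit : ∀ k i, (m k : ℂ) * advCoeff L v c k i =
      (∑ l ∈ S, transportSymbol L v k l * ((m l : ℂ) * c l i)) + R k i := fun k i => by
    have e1 : ∑ l ∈ S, transportSymbol L v k l * ((m l : ℂ) * c l i) =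
        ∑' l, transportSymbol L v k l * ((m l : ℂ) * c l i) :=
      (tsum_eq_sum fun l hl => by rw [hmS l hl]; simp).symm
    have s1 : Summable fun l => transportSymbol L v k l * ((m l : ℂ) * c l i) :=
      summable_of_ne_finset_zero (s := S) fun l hl => by rw [hmS l hl]; simp
    rw [e1, hR, ← s1.tsum_add (hRs k i), advCoeff, ← tsum_mul_left]
    refine tsum_congr fun l => ?_
    push_cast
    ring
  have hmain : ∑ k ∈ S, m k ^ 2 * (∑ i, starRingEnd ℂ (c k i) * advCoeff L v c k i).re =
      (∑ k ∈ S, ∑ i, starRingEnd ℂ ((m k : ℂ) * c k i) * R k i).re := by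
    have h0 := re_sum_transport_eq_zero hdiv hreal (fun k i => (m k : ℂ) * c k i) S (L := L)
    rw [← zero_add (Complex.re _), ← h0, ← Complex.add_re, ← Finset.sum_add_distrib,
      Complex.re_sum]
    refine Finset.sum_congr rfl fun k _ => ?_
    rw [← Finset.sum_add_distrib, ← Complex.re_ofReal_mul, Finset.mul_sum]
    congr 1
    refine Finset.sum_congr rfl fun i _ => ?_
    rw [← mul_add, ← hsplit, map_mul, Complex.conj_ofReal]
    push_cast
    ring
  rw [hmain]
  refine (Complex.abs_re_le_norm _).trans ?_
  have hz : ∑ k ∈ S, (m k * ‖c k‖) ^ 2 ≤ (volFactor L * hnorm L σ c) ^ 2 := by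
    refine le_trans (Finset.sum_le_sum fun k _ => ?_)
      (((hc.summable_sq hL).sum_le_tsum S fun _ _ => sq_nonneg _).trans (hc.tsum_sq_le hL))
    have := hm0 k
    have := hmle k
    gcongr
  have hfin := hcomm N v c (fun k => m k * ‖c k‖) S (volFactor L * hnorm L σ c) hN hv hc
    (fun k => mul_nonneg (hm0 k) (norm_nonneg _))
    (mul_nonneg (volFactor_nonneg L) (hnorm_nonneg _ _ _)) hz
  calc ‖∑ k ∈ S, ∑ i, starRingEnd ℂ ((m k : ℂ) * c k i) * R k i‖
      ≤ ∑ k ∈ S, 9 * ((m k * ‖c k‖) *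
          ∑' l, |m k - m l| * (‖v (k - l)‖ * (weight L l * ‖c l‖))) := by
        refine norm_sum_le_of_le _ fun k _ => ?_
        refine (norm_sum_three_le (B := (m k * ‖c k‖) *
          (3 * ∑' l, |m k - m l| * (‖v (k - l)‖ * (weight L l * ‖c l‖)))) fun i => ?_).trans
          (le_of_eq (by ring))
        rw [norm_mul, RCLike.norm_conj, norm_mul, Complex.norm_real,
          Real.norm_of_nonneg (hm0 k)]
        exact mul_le_mul (mul_le_mul_of_nonneg_left (norm_le_pi_norm _ _) (hm0 k)) (hRle k i)
          (norm_nonneg _) (mul_nonneg (hm0 k) (norm_nonneg _))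
    _ ≤ 9 * (K * (volFactor L * hnorm L σ c) * hnorm L σ v * hnorm L σ c) := by
        rw [← Finset.mul_sum]
        gcongr
    _ = _ := by ring

/-! ### The energy inequality in integrated form -/

lemma intervalIntegrable_finsetSum {ι : Type*} (s : Finset ι) {f : ι → ℝ → ℝ} {a b : ℝ}
    (h : ∀ i ∈ s, IntervalIntegrable (f i) MeasureTheory.volume a b) :
    IntervalIntegrable (fun x => ∑ i ∈ s, f i x) MeasureTheory.volume a b :=
  (IntervalIntegrable.sum s h).congr fun x _ => by simp [Finset.sum_apply]

open MeasureTheory Set in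
/-- The squared norm along a curve given by an integral. -/
lemma norm_sq_eq_of_eq_integral {T : ℝ} {c p : ℝ → ℂ} (hp : ContinuousOn p (Icc 0 T))
    (hc : ∀ t ∈ Icc 0 T, c t = c 0 - ∫ τ in (0 : ℝ)..t, p τ) {t : ℝ} (ht : t ∈ Icc 0 T) :
    IntervalIntegrable (fun τ => 2 * (starRingEnd ℂ (c τ) * p τ).re) volume 0 t ∧
    ‖c t‖ ^ 2 = ‖c 0‖ ^ 2 - ∫ τ in (0 : ℝ)..t, 2 * (starRingEnd ℂ (c τ) * p τ).re := by
  have hT : 0 ≤ T := ht.1.trans ht.2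
  set q : ℝ → ℂ := IccExtend hT (domRestrict (Icc 0 T) p) with hq
  have hqc : Continuous q := (continuousOn_iff_continuous_domRestrict.1 hp).Icc_extend'
  have hqp : ∀ τ ∈ Icc 0 T, q τ = p τ := fun τ hτ => by
    rw [hq, IccExtend_of_mem hT _ hτ, domRestrict_apply]
  set C : ℝ → ℂ := fun τ => c 0 - ∫ r in (0 : ℝ)..τ, q r with hC
  have hCd : ∀ τ, HasDerivAt C (-q τ) τ := fun τ => by
    have := (hqc.integral_hasStrictDerivAt 0 τ).hasDerivAt.const_sub (c 0)
    exact this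
  have hCc : ∀ τ ∈ Icc 0 T, C τ = c τ := fun τ hτ => by
    rw [hc τ hτ, hC]
    simp only
    congr 1
    refine intervalIntegral.integral_congr fun r hr => ?_
    rw [uIcc_of_le hτ.1] at hr
    exact hqp r ⟨hr.1, hr.2.trans hτ.2⟩
  have hd : ∀ τ, HasDerivAt (fun τ => ‖C τ‖ ^ 2)
      (-(2 * (starRingEnd ℂ (C τ) * q τ).re)) τ := fun τ => by
    have := (hCd τ).norm_sq
    convert this using 1
    rw [Complex.inner]
    simp
    ring
  have hCcont : Continuous C := continuous_iff_continuousAt.2 fun τ => (hCd τ).continuousAt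
  have hcont : Continuous fun τ => -(2 * (starRingEnd ℂ (C τ) * q τ).re) := by
    have h1 : Continuous fun τ => starRingEnd ℂ (C τ) := Complex.continuous_conj.comp hCcont
    have h2 : Continuous fun τ => (starRingEnd ℂ (C τ) * q τ).re :=
      Complex.continuous_re.comp (h1.mul hqc)
    fun_prop
  have hint := intervalIntegral.integral_eq_sub_of_hasDerivAt (a := 0) (b := t)
    (fun τ _ => hd τ) (hcont.intervalIntegrable _ _)
  have hcongr : EqOn (fun τ => -(2 * (starRingEnd ℂ (C τ) * q τ).re))
      (fun τ => -(2 * (starRingEnd ℂ (c τ) * p τ).re)) (uIcc 0 t) := fun τ hτ => by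
    rw [uIcc_of_le ht.1] at hτ
    have hτ' : τ ∈ Icc 0 T := ⟨hτ.1, hτ.2.trans ht.2⟩
    simp only [hCc τ hτ', hqp τ hτ']
  refine ⟨?_, ?_⟩
  · have h1 : IntervalIntegrable (fun τ => -(2 * (starRingEnd ℂ (c τ) * p τ).re)) volume 0 t :=
      (hcont.intervalIntegrable 0 t).congr fun τ hτ => hcongr (uIoc_subset_uIcc hτ)
    exact h1.neg.congr fun τ _ => neg_neg _
  · rw [intervalIntegral.integral_congr hcongr, intervalIntegral.integral_neg,
      hCc t ht, hCc 0 ⟨le_rfl, hT⟩] at hint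
    linarith

/-- If `y² ≤ y₀² + A G` for every upper bound `A` of `y`, then `y ≤ y₀ + G`, by taking `A = sup y`.
With `G = ∫ g` this is how `y² ≤ y₀² + ∫ y g` yields `y ≤ y₀ + ∫ g` when `y` need not be
continuous. -/
lemma le_add_of_sq_le {T y₀ G : ℝ} {y : ℝ → ℝ} (hy0 : 0 ≤ y₀) (hG : 0 ≤ G)
    (hy : ∀ t ∈ Set.Icc 0 T, 0 ≤ y t) (hbdd : BddAbove (y '' Set.Icc 0 T))
    (h : ∀ A, (∀ t ∈ Set.Icc 0 T, y t ≤ A) → ∀ t ∈ Set.Icc 0 T, y t ^ 2 ≤ y₀ ^ 2 + A * G)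
    {t : ℝ} (ht : t ∈ Set.Icc 0 T) : y t ≤ y₀ + G := by
  set A := sSup (y '' Set.Icc 0 T) with hA
  have hle : ∀ t ∈ Set.Icc 0 T, y t ≤ A := fun t ht => le_csSup hbdd ⟨t, ht, rfl⟩
  have hA0 : 0 ≤ A := (hy t ht).trans (hle t ht)
  have hAle : A ≤ √(y₀ ^ 2 + A * G) := by
    refine csSup_le ⟨_, t, ht, rfl⟩ ?_
    rintro _ ⟨τ, hτ, rfl⟩
    exact Real.le_sqrt_of_sq_le (h A hle τ hτ)
  have hA2 : A ^ 2 ≤ y₀ ^ 2 + A * G := by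
    calc A ^ 2 ≤ √(y₀ ^ 2 + A * G) ^ 2 := by gcongr
      _ = _ := Real.sq_sqrt (by positivity)
  refine (hle t ht).trans ?_
  by_contra! hlt
  nlinarith

/-- The energy inequality for `∂ₜc + V · ∇c + F + ∇p = 0`, in Fourier variables. The hypothesis
on `F` says that its `H^σ` norm is at most a multiple of `Φ`. -/
lemma exists_energy_estimate {L σ : ℝ} (hL : 0 < L) (hσ : 5 / 2 < σ) :
    ∃ K : ℝ, 0 ≤ K ∧ ∀ (T M : ℝ) (c V F : ℝ → Coeffs) (Φ : ℝ → ℝ),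
      (∀ t ∈ Set.Icc 0 T, InSobolev L σ (c t)) →
      (∀ t ∈ Set.Icc 0 T, hnorm L σ (c t) ≤ M) →
      (∀ t ∈ Set.Icc 0 T, ∀ k, ∑ i, (k i : ℂ) * c t k i = 0) →
      (∀ t ∈ Set.Icc 0 T, InSobolev L σ (V t)) →
      (∀ t ∈ Set.Icc 0 T, ∀ k, ∑ i, (k i : ℂ) * V t k i = 0) →
      (∀ t ∈ Set.Icc 0 T, ∀ k i, V t (-k) i = starRingEnd ℂ (V t k i)) →
      (∀ t ∈ Set.Icc 0 T, 0 ≤ Φ t) →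
      (∀ t ∈ Set.Icc 0 T, ∀ (z : Freq → ℝ) (S : Finset Freq) (Z : ℝ), (∀ k, 0 ≤ z k) → 0 ≤ Z →
        ∑ k ∈ S, z k ^ 2 ≤ Z ^ 2 → ∑ k ∈ S, z k * (weight L k ^ σ * ‖F t k‖) ≤ Z * Φ t) →
      (∀ k j, ContinuousOn (fun τ => ∑ i, (leray k j i : ℂ) *
        (advCoeff L (V τ) (c τ) k i + F τ k i)) (Set.Icc 0 T)) →
      (∀ t ∈ Set.Icc 0 T, ∀ k j, c t k j = c 0 k j - ∫ τ in (0 : ℝ)..t,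
        ∑ i, (leray k j i : ℂ) * (advCoeff L (V τ) (c τ) k i + F τ k i)) →
      IntervalIntegrable (fun τ => hnorm L σ (V τ) * hnorm L σ (c τ) + Φ τ)
        MeasureTheory.volume 0 T →
      ∀ t ∈ Set.Icc 0 T, hnorm L σ (c t) ≤ hnorm L σ (c 0) +
        ∫ τ in (0 : ℝ)..t, K * (hnorm L σ (V τ) * hnorm L σ (c τ) + Φ τ) := by
  obtain ⟨K₀, hK₀, hflux⟩ := exists_abs_transport_flux_le hL hσ
  have hD := volFactor_nonneg L
  set K := (2 * L) ^ 3 * (2 * K₀ + 6 * volFactor L) with hK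
  have hKnn : 0 ≤ K := by positivity
  refine ⟨K, hKnn, ?_⟩
  intro T M c V F Φ hc hcM hcdiv hV hVdiv hVreal hΦ hF hcont heq hint t ht
  have hT : 0 ≤ T := ht.1.trans ht.2
  set g : ℝ → ℝ := fun τ => hnorm L σ (V τ) * hnorm L σ (c τ) + Φ τ with hg
  have hg0 : ∀ τ ∈ Set.Icc 0 T, 0 ≤ g τ := fun τ hτ =>
    add_nonneg (mul_nonneg (hnorm_nonneg _ _ _) (hnorm_nonneg _ _ _)) (hΦ τ hτ)
  have hsub : ∀ τ ∈ Set.Icc 0 t, τ ∈ Set.Icc 0 T := fun τ hτ => ⟨hτ.1, hτ.2.trans ht.2⟩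
  have hgint : ∀ τ ∈ Set.Icc 0 t, IntervalIntegrable (fun τ => K * g τ)
      MeasureTheory.volume 0 τ := fun τ hτ =>
    (hint.mono_set (by
      rw [Set.uIcc_of_le hT, Set.uIcc_of_le hτ.1]
      exact Set.Icc_subset_Icc_right (hτ.2.trans ht.2))).const_mul K
  refine le_add_of_sq_le (T := t) (hnorm_nonneg _ _ _) ?_ (fun τ _ => hnorm_nonneg _ _ _)
    ⟨M, by rintro _ ⟨τ, hτ, rfl⟩; exact hcM τ (hsub τ hτ)⟩ ?_ ⟨ht.1, le_rfl⟩
  · exact intervalIntegral.integral_nonneg ht.1 fun τ hτ => mul_nonneg hKnn (hg0 τ (hsub τ hτ))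
  intro A hA r hr
  have hA0 : 0 ≤ A := (hnorm_nonneg _ _ _).trans (hA r hr)
  have hrT := hsub r hr
  rw [hnorm_sq hL]
  refine (hc r hrT).tsum_le_of_sum_le fun S' => ?_
  -- a finite part of the norm at time `r` only sees frequencies where the cutoff is inactive
  obtain ⟨N, hN, hS'⟩ : ∃ N : ℝ, 0 < N ∧ ∀ k ∈ S', weight L k ≤ N := by
    refine ⟨1 + ∑ k ∈ S', weight L k, ?_, fun k hk => ?_⟩
    · have : 0 ≤ ∑ k ∈ S', weight L k := Finset.sum_nonneg fun k _ => weight_nonneg L k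
      linarith
    · have := Finset.single_le_sum (f := fun k => weight L k) (fun k _ => weight_nonneg L k) hk
      linarith
  set S := (finite_weight_le hL (2 * N)).toFinset with hS
  have hmemS : ∀ k, k ∈ S ↔ weight L k ≤ 2 * N := fun k => by rw [hS]; simp
  set m : Freq → ℝ := fun k => cutoff σ N (weight L k) with hm
  have hm0 : ∀ k, 0 ≤ m k := fun k => cutoff_nonneg hN (weight_pos L k)
  have hmle : ∀ k, m k ≤ weight L k ^ σ := fun k => cutoff_le _ _ _
  set p : Freq → Fin 3 → ℝ → ℂ := fun k j τ =>
    ∑ i, (leray k j i : ℂ) * (advCoeff L (V τ) (c τ) k i + F τ k i) with hp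
  have hmode := fun k j => norm_sq_eq_of_eq_integral (c := fun τ => c τ k j) (p := p k j)
    (hcont k j) (fun t ht => heq t ht k j) hrT
  -- the pressure does no work, so the flux of the truncated energy consists of the commutator in
  -- the transport term and of the work of `F`
  have hpoint : ∀ τ ∈ Set.Icc 0 r,
      -∑ k ∈ S, m k ^ 2 * ∑ j, 2 * (starRingEnd ℂ (c τ k j) * p k j τ).re ≤
        A * ((2 * K₀ + 6 * volFactor L) * g τ) := fun τ hτ => by
    have hτt : τ ∈ Set.Icc 0 t := ⟨hτ.1, hτ.2.trans hr.2⟩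
    have hτT := hsub τ hτt
    have hnc := hnorm_nonneg L σ (c τ)
    have hnV := hnorm_nonneg L σ (V τ)
    have hcA := hA τ hτt
    have hΦτ := hΦ τ hτT
    have e : ∀ k, ∑ j, 2 * (starRingEnd ℂ (c τ k j) * p k j τ).re =
        2 * (∑ i, starRingEnd ℂ (c τ k i) * advCoeff L (V τ) (c τ) k i).re +
        2 * (∑ i, starRingEnd ℂ (c τ k i) * F τ k i).re := fun k => by
      rw [← Finset.mul_sum, ← Complex.re_sum, ← mul_add, ← Complex.add_re,
        ← Finset.sum_add_distrib]
      simp only [hp]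
      rw [sum_conj_mul_leray (hcdiv τ hτT k)]
      simp only [mul_add]
    have h1 := hflux N (V τ) (c τ) S hN (hV τ hτT) (hc τ hτT) (hVdiv τ hτT) (hVreal τ hτT)
      fun k hk => (hmemS k).2 hk.le
    have hz : ∑ k ∈ S, (m k * ‖c τ k‖) ^ 2 ≤ (volFactor L * hnorm L σ (c τ)) ^ 2 := by
      refine le_trans (Finset.sum_le_sum fun k _ => ?_)
        ((((hc τ hτT).summable_sq hL).sum_le_tsum S fun _ _ => sq_nonneg _).trans
          ((hc τ hτT).tsum_sq_le hL))
      have := hm0 k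
      have := hmle k
      gcongr
    have h2 := hF τ hτT (fun k => m k * ‖c τ k‖) S (volFactor L * hnorm L σ (c τ))
      (fun k => mul_nonneg (hm0 k) (norm_nonneg _)) (by positivity) hz
    have h3 : -∑ k ∈ S, m k ^ 2 * (∑ i, starRingEnd ℂ (c τ k i) * F τ k i).re ≤
        3 * (volFactor L * hnorm L σ (c τ) * Φ τ) := by
      refine le_trans ?_ (mul_le_mul_of_nonneg_left h2 (by norm_num))
      rw [← Finset.sum_neg_distrib, Finset.mul_sum]
      refine Finset.sum_le_sum fun k _ => ?_
      have h4 : ‖∑ i, starRingEnd ℂ (c τ k i) * F τ k i‖ ≤ 3 * (‖c τ k‖ * ‖F τ k‖) :=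
        norm_sum_three_le fun i => by
          rw [norm_mul, RCLike.norm_conj]
          exact mul_le_mul (norm_le_pi_norm _ _) (norm_le_pi_norm _ _) (norm_nonneg _)
            (norm_nonneg _)
      have h5 := (neg_le_abs _).trans ((Complex.abs_re_le_norm _).trans h4)
      have hmk := hm0 k
      have hmk' := hmle k
      calc _ = m k ^ 2 * -(∑ i, starRingEnd ℂ (c τ k i) * F τ k i).re := by ring
        _ ≤ m k ^ 2 * (3 * (‖c τ k‖ * ‖F τ k‖)) := by gcongr
        _ = 3 * (m k * ‖c τ k‖ * (m k * ‖F τ k‖)) := by ring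
        _ ≤ 3 * (m k * ‖c τ k‖ * (weight L k ^ σ * ‖F τ k‖)) := by gcongr
    simp_rw [e, mul_add, Finset.sum_add_distrib]
    have h6 := (neg_le_abs _).trans h1
    have e1 : ∀ f : Freq → ℝ, ∑ k ∈ S, m k ^ 2 * (2 * f k) = 2 * ∑ k ∈ S, m k ^ 2 * f k :=
      fun f => by
        rw [Finset.mul_sum]
        exact Finset.sum_congr rfl fun k _ => by ring
    rw [e1, e1]
    calc _ ≤ 2 * (K₀ * hnorm L σ (V τ) * hnorm L σ (c τ) ^ 2) +
          2 * (3 * (volFactor L * hnorm L σ (c τ) * Φ τ)) := by linarith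
      _ = hnorm L σ (c τ) * (2 * K₀ * (hnorm L σ (V τ) * hnorm L σ (c τ)) +
          6 * volFactor L * Φ τ) := by ring
      _ ≤ A * (2 * K₀ * (hnorm L σ (V τ) * hnorm L σ (c τ)) + 6 * volFactor L * Φ τ) := by gcongr
      _ ≤ _ := by
          gcongr
          have : 0 ≤ 2 * K₀ * Φ τ + 6 * volFactor L * (hnorm L σ (V τ) * hnorm L σ (c τ)) := by
            positivity
          simp only [hg]
          linarith
  have henergy : ∑ k ∈ S, m k ^ 2 * ∑ j, ‖c r k j‖ ^ 2 ≤
      ∑ k ∈ S, m k ^ 2 * ∑ j, ‖c 0 k j‖ ^ 2 +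
        A * ∫ τ in (0 : ℝ)..r, (2 * K₀ + 6 * volFactor L) * g τ := by
    have hi1 : ∀ k, IntervalIntegrable
        (fun τ => m k ^ 2 * ∑ j, 2 * (starRingEnd ℂ (c τ k j) * p k j τ).re)
        MeasureTheory.volume 0 r := fun k =>
      (intervalIntegrable_finsetSum _ fun j _ => (hmode k j).1).const_mul _
    have e : ∑ k ∈ S, m k ^ 2 * ∑ j, ‖c r k j‖ ^ 2 = ∑ k ∈ S, m k ^ 2 * ∑ j, ‖c 0 k j‖ ^ 2 +
        ∫ τ in (0 : ℝ)..r,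
          -∑ k ∈ S, m k ^ 2 * ∑ j, 2 * (starRingEnd ℂ (c τ k j) * p k j τ).re := by
      rw [intervalIntegral.integral_neg, intervalIntegral.integral_finsetSum fun k _ => hi1 k,
        ← sub_eq_add_neg, ← Finset.sum_sub_distrib]
      refine Finset.sum_congr rfl fun k _ => ?_
      rw [intervalIntegral.integral_const_mul,
        intervalIntegral.integral_finsetSum fun j _ => (hmode k j).1, ← mul_sub,
        ← Finset.sum_sub_distrib]
      congr 1
      exact Finset.sum_congr rfl fun j _ => (hmode k j).2
    rw [e, ← intervalIntegral.integral_const_mul]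
    gcongr
    refine intervalIntegral.integral_mono_on hr.1 ?_ ?_ hpoint
    · exact ((intervalIntegrable_finsetSum S fun k _ => hi1 k).neg)
    · refine IntervalIntegrable.const_mul (IntervalIntegrable.const_mul (hint.mono_set ?_) _) _
      rw [Set.uIcc_of_le hT, Set.uIcc_of_le hr.1]
      exact Set.Icc_subset_Icc_right hrT.2
  have hS'S : S' ⊆ S := fun k hk => (hmemS k).2 (by linarith [hS' k hk])
  calc ∑ k ∈ S', hterm L σ (c r) k
      = (2 * L) ^ 3 * ∑ k ∈ S', m k ^ 2 * ∑ j, ‖c r k j‖ ^ 2 := by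
        rw [Finset.mul_sum]
        refine Finset.sum_congr rfl fun k hk => ?_
        rw [hterm_eq, hm]
        simp only
        rw [cutoff_eq (by linarith) hN (weight_pos L k) (hS' k hk)]
        ring
    _ ≤ (2 * L) ^ 3 * ∑ k ∈ S, m k ^ 2 * ∑ j, ‖c r k j‖ ^ 2 := by
        gcongr
    _ ≤ (2 * L) ^ 3 * (∑ k ∈ S, m k ^ 2 * ∑ j, ‖c 0 k j‖ ^ 2 +
        A * ∫ τ in (0 : ℝ)..r, (2 * K₀ + 6 * volFactor L) * g τ) := by gcongr
    _ = ∑ k ∈ S, (2 * L) ^ 3 * m k ^ 2 * ∑ j, ‖c 0 k j‖ ^ 2 +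
        A * ∫ τ in (0 : ℝ)..r, K * g τ := by
        rw [mul_add, Finset.mul_sum]
        congr 1
        · exact Finset.sum_congr rfl fun k _ => by ring
        · rw [intervalIntegral.integral_const_mul, intervalIntegral.integral_const_mul, hK]
          ring
    _ ≤ hnorm L σ (c 0) ^ 2 + A * ∫ τ in (0 : ℝ)..t, K * g τ := by
        rw [hnorm_sq hL]
        gcongr ?_ + A * ?_
        · refine le_trans (Finset.sum_le_sum fun k _ => ?_)
            ((hc 0 ⟨le_rfl, hT⟩).sum_le_tsum S fun _ _ => hterm_nonneg hL σ _ _)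
          rw [hterm_eq]
          have := hm0 k
          have := hmle k
          gcongr
        · refine intervalIntegral.integral_mono_interval le_rfl hr.1 hr.2 ?_
            (hgint t ⟨ht.1, le_rfl⟩)
          refine (MeasureTheory.ae_restrict_iff' measurableSet_Ioc).2
            (Filter.Eventually.of_forall fun τ hτ => ?_)
          exact mul_nonneg hKnn (hg0 τ (hsub τ ⟨hτ.1.le, hτ.2⟩))

open MeasureTheory
open scoped Pointwise

/-! ### Fourier series on the torus -/

/-- The phase `(π/L) k · x`. -/
def phase (L : ℝ) (k : Freq) (x : Vec) : ℝ := Real.pi / L * ∑ i, (k i : ℝ) * x i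

/-- The Fourier mode `exp(i (π/L) k · x)`. -/
def mode (L : ℝ) (k : Freq) (x : Vec) : ℂ := Complex.exp (Complex.I * (phase L k x : ℂ))

/-- The Fourier coefficient of a complex-valued function. -/
def ccoeff (L : ℝ) (f : Vec → ℂ) (k : Freq) : ℂ :=
  ((2 * L) ^ 3 : ℝ)⁻¹ * ∫ x in cube L, f x * mode L (-k) x

/-- The closed fundamental cell. -/
def box (L : ℝ) : Set Vec := Set.Icc (fun _ => -L) fun _ => L

lemma cube_ae_eq_box (L : ℝ) : cube L =ᵐ[volume] box L :=
  Measure.univ_pi_Ico_ae_eq_Icc (μ := fun _ : Fin 3 => (volume : Measure ℝ))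

lemma isCompact_box (L : ℝ) : IsCompact (box L) := isCompact_Icc

lemma cube_subset_box (L : ℝ) : cube L ⊆ box L := fun _ hx =>
  ⟨fun i => (hx i (Set.mem_univ i)).1, fun i => (hx i (Set.mem_univ i)).2.le⟩

lemma measurableSet_cube (L : ℝ) : MeasurableSet (cube L) :=
  MeasurableSet.univ_pi fun _ => measurableSet_Ico

lemma volume_cube {L : ℝ} (hL : 0 < L) : volume.real (cube L) = (2 * L) ^ 3 := by
  rw [cube, measureReal_def, volume_pi_pi]
  simp only [Real.volume_Ico, Finset.prod_const, Finset.card_univ, Fintype.card_fin,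
    ENNReal.toReal_pow]
  rw [ENNReal.toReal_ofReal (by linarith)]
  ring

lemma _root_.Continuous.integrableOn_cube {f : Vec → ℂ} (hf : Continuous f) (L : ℝ) :
    IntegrableOn f (cube L) :=
  (hf.continuousOn.integrableOn_compact (isCompact_box L)).mono_set (cube_subset_box L)

lemma phase_neg (L : ℝ) (k : Freq) (x : Vec) : phase L (-k) x = -phase L k x := by
  simp [phase]

lemma phase_add (L : ℝ) (k l : Freq) (x : Vec) :
    phase L (k + l) x = phase L k x + phase L l x := by
  simp only [phase, Pi.add_apply, Int.cast_add, add_mul, Finset.sum_add_distrib, mul_add]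

lemma continuous_phase (L : ℝ) (k : Freq) : Continuous (phase L k) := by
  unfold phase
  fun_prop

lemma continuous_mode (L : ℝ) (k : Freq) : Continuous (mode L k) := by
  have := continuous_phase L k
  unfold mode
  fun_prop

lemma norm_mode (L : ℝ) (k : Freq) (x : Vec) : ‖mode L k x‖ = 1 := by
  rw [mode, mul_comm, Complex.norm_exp_ofReal_mul_I]

lemma mode_add (L : ℝ) (k l : Freq) (x : Vec) : mode L (k + l) x = mode L k x * mode L l x := by
  rw [mode, mode, mode, ← Complex.exp_add, phase_add]
  push_cast
  ring_nf

lemma mode_zero (L : ℝ) (x : Vec) : mode L 0 x = 1 := by simp [mode, phase]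

lemma mode_neg (L : ℝ) (k : Freq) (x : Vec) : mode L (-k) x = starRingEnd ℂ (mode L k x) := by
  rw [mode, mode, ← Complex.exp_conj, phase_neg]
  simp

lemma coeff_eq_ccoeff (L : ℝ) (f : Vec → ℝ) (k : Freq) :
    coeff L f k = ccoeff L (fun x => (f x : ℂ)) k := by
  simp only [coeff, ccoeff, mode, phase_neg, Complex.ofReal_neg, mul_neg]
  rfl

lemma coeff_neg (L : ℝ) (f : Vec → ℝ) (k : Freq) :
    coeff L f (-k) = starRingEnd ℂ (coeff L f k) := by
  rw [coeff_eq_ccoeff, coeff_eq_ccoeff, ccoeff, ccoeff, map_mul, ← integral_conj]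
  congr 1
  · exact (Complex.conj_ofReal _).symm
  · congr 1
    funext x
    rw [map_mul, Complex.conj_ofReal, mode_neg L (-k)]

lemma coeff_sub {f g : Vec → ℝ} (hf : Continuous f) (hg : Continuous g) (L : ℝ) (k : Freq) :
    coeff L (fun x => f x - g x) k = coeff L f k - coeff L g k := by
  simp only [coeff_eq_ccoeff, ccoeff]
  rw [← mul_sub, ← integral_sub]
  · congr 2
    funext x
    push_cast
    ring
  · exact ((Complex.continuous_ofReal.comp hf).mul (continuous_mode L _)).integrableOn_cube L
  · exact ((Complex.continuous_ofReal.comp hg).mul (continuous_mode L _)).integrableOn_cube L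

lemma coeff_const_mul (L c : ℝ) (f : Vec → ℝ) (k : Freq) :
    coeff L (fun x => c * f x) k = c * coeff L f k := by
  simp only [coeff_eq_ccoeff, ccoeff]
  rw [mul_left_comm (c : ℂ), ← integral_const_mul (c : ℂ)]
  congr 2
  funext x
  push_cast
  ring

lemma IsPeriodic.add_intMul {α : Type*} {L : ℝ} {f : Vec → α} (hf : IsPeriodic L f) (x : Vec)
    (i : Fin 3) (n : ℤ) : f (x + Pi.single i (n * (2 * L))) = f x := by
  have hper : Function.Periodic (fun t : ℝ => f (x + Pi.single i t)) (2 * L) := fun t => by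
    simp only
    rw [Pi.single_add, ← add_assoc, hf]
  simpa using (hper.int_mul n) 0

lemma IsPeriodic.eq_of_forall_coe_eq {α : Type*} {L : ℝ} {f : Vec → α}
    (hf : IsPeriodic L f) {x y : Vec}
    (h : ∀ i, ((x i : ℝ) : UnitAddCircle) = ((y i : ℝ) : UnitAddCircle)) :
    f ((2 * L) • x) = f ((2 * L) • y) := by
  have h' : ∀ i, ∃ n : ℤ, x i = y i + n := fun i => by
    obtain ⟨n, hn⟩ := QuotientAddGroup.eq_iff_sub_mem.1 (h i)
    refine ⟨n, ?_⟩
    simp only [zsmul_eq_mul, mul_one] at hn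
    linarith
  choose n hn using h'
  have e : (2 * L) • x = (2 * L) • y + Pi.single 0 (n 0 * (2 * L)) + Pi.single 1 (n 1 * (2 * L))
      + Pi.single 2 (n 2 * (2 * L)) := by
    funext i
    fin_cases i <;> simp [hn] <;> ring
  rw [e, hf.add_intMul, hf.add_intMul, hf.add_intMul]

lemma mFourier_coe {L : ℝ} (hL : 0 < L) (k : Freq) (x : Vec) :
    UnitAddTorus.mFourier k (fun i => ((x i : ℝ) : UnitAddCircle)) = mode L k ((2 * L) • x) := by
  rw [UnitAddTorus.mFourier, ContinuousMap.coe_mk, mode, phase, Finset.mul_sum]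
  simp_rw [fourier_coe_apply]
  rw [← Complex.exp_sum]
  congr 1
  push_cast
  rw [Finset.mul_sum]
  refine Finset.sum_congr rfl fun i _ => ?_
  have : (L : ℂ) ≠ 0 := by exact_mod_cast hL.ne'
  simp only [Pi.smul_apply, smul_eq_mul]
  push_cast
  field_simp

lemma setIntegral_cube_eq {L : ℝ} (hL : 0 < L) (g : Vec → ℂ) :
    ((2 * L) ^ 3 : ℝ)⁻¹ * ∫ x in cube L, g x =
      ∫ x in {x : Vec | ∀ i, x i ∈ Set.Ioc (-(1 / 2) : ℝ) (-(1 / 2) + 1)}, g ((2 * L) • x) := by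
  have h2L : 0 < 2 * L := by linarith
  rw [Measure.setIntegral_comp_smul_of_pos volume g _ h2L]
  have hset : (2 * L) • {x : Vec | ∀ i, x i ∈ Set.Ioc (-(1 / 2) : ℝ) (-(1 / 2) + 1)} =
      Set.univ.pi fun _ : Fin 3 => Set.Ioc (-L) L := by
    ext x
    rw [Set.mem_smul_set_iff_inv_smul_mem₀ h2L.ne']
    simp only [Set.mem_ofPred_eq, Pi.smul_apply, smul_eq_mul, Set.mem_univ_pi, Set.mem_Ioc]
    refine forall_congr' fun i => and_congr ?_ ?_
    · rw [lt_inv_mul_iff₀ h2L]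
      constructor <;> intro h <;> linarith
    · rw [inv_mul_le_iff₀ h2L]
      constructor <;> intro h <;> linarith
  have hae : (Set.univ.pi fun _ : Fin 3 => Set.Ioc (-L) L) =ᵐ[volume] cube L :=
    (Measure.univ_pi_Ioc_ae_eq_Icc (μ := fun _ : Fin 3 => (volume : Measure ℝ))).trans
      (cube_ae_eq_box L).symm
  rw [hset, setIntegral_congr_set hae, Complex.real_smul]
  simp

/-- Fourier inversion for continuous functions with absolutely summable coefficients. -/
lemma hasSum_coeff_mul_mode {L : ℝ} (hL : 0 < L) {f : Vec → ℝ} (hf : Continuous f)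
    (hper : IsPeriodic L f) (hs : Summable (coeff L f)) (x : Vec) :
    HasSum (fun k => coeff L f k * mode L k x) (f x : ℂ) := by
  have h2L : 2 * L ≠ 0 := by positivity
  have hq0 : Topology.IsQuotientMap
      (Pi.map fun _ t => ((t : ℝ) : UnitAddCircle) : Vec → UnitAddTorus (Fin 3)) :=
    (IsOpenQuotientMap.piMap fun _ => QuotientAddGroup.isOpenQuotientMap_mk).isQuotientMap
  let q : C(Vec, UnitAddTorus (Fin 3)) := ⟨_, hq0.continuous⟩
  have hq : Topology.IsQuotientMap q := hq0
  let F : C(Vec, ℂ) := ⟨fun y => (f ((2 * L) • y) : ℂ), by fun_prop⟩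
  have hFq : Function.FactorsThrough F q := fun y z hyz => by
    simp only [F, ContinuousMap.coe_mk]
    rw [hper.eq_of_forall_coe_eq fun i => congrFun hyz i]
  let g : C(UnitAddTorus (Fin 3), ℂ) := hq.lift F hFq
  have hg : ∀ y, g (q y) = (f ((2 * L) • y) : ℂ) := fun y =>
    congrFun (congrArg DFunLike.coe (hq.lift_comp F hFq)) y
  have hcoeff : UnitAddTorus.mFourierCoeff g = coeff L f := by
    funext k
    rw [UnitAddTorus.mFourierCoeff_eq_integral g k fun _ => -(1 / 2), coeff_eq_ccoeff, ccoeff,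
      setIntegral_cube_eq hL]
    refine integral_congr_ae (Filter.Eventually.of_forall fun y => ?_)
    simp only
    rw [mFourier_coe hL, smul_eq_mul, mul_comm]
    congr 1
    exact hg y
  have h := UnitAddTorus.hasSum_mFourier_series_apply_of_summable (f := g)
    (by rw [hcoeff]; exact hs) (q ((2 * L)⁻¹ • x))
  rw [hg, smul_inv_smul₀ h2L, hcoeff] at h
  convert h using 2 with k
  rw [smul_eq_mul]
  congr 1
  have := mFourier_coe hL k ((2 * L)⁻¹ • x)
  rw [smul_inv_smul₀ h2L] at this
  exact this.symm

lemma ccoeff_one {L : ℝ} (hL : 0 < L) (k : Freq) :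
    ccoeff L (fun _ => 1) k = if k = 0 then 1 else 0 := by
  have h2L : ((2 * L) ^ 3 : ℝ) ≠ 0 := by positivity
  simp only [ccoeff, one_mul]
  split_ifs with hk
  · simp only [hk, neg_zero, mode_zero, setIntegral_const, volume_cube hL]
    rw [Complex.real_smul, mul_one, ← Complex.ofReal_mul,
      inv_mul_cancel₀ h2L, Complex.ofReal_one]
  · obtain ⟨i, hi⟩ := Function.ne_iff.1 hk
    have e : ∀ x : Vec, mode L (-k) x =
        ∏ j, Complex.exp ((-(Real.pi / L * (k j : ℝ)) : ℝ) * Complex.I * (x j : ℂ)) := fun x => by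
      rw [mode, phase, ← Complex.exp_sum, Finset.mul_sum]
      congr 1
      push_cast [Pi.neg_apply]
      rw [Finset.mul_sum]
      exact Finset.sum_congr rfl fun j _ => by ring
    have hr : (volume : Measure Vec).restrict (cube L) =
        Measure.pi fun _ : Fin 3 => (volume : Measure ℝ).restrict (Set.Ico (-L) L) := by
      rw [cube, volume_pi, Measure.restrict_pi_pi]
    simp_rw [e]
    rw [hr, integral_fintype_prod_eq_prod (fun (j : Fin 3) (t : ℝ) =>
      Complex.exp ((-(Real.pi / L * (k j : ℝ)) : ℝ) * Complex.I * (t : ℂ)))]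
    rw [Finset.prod_eq_zero (Finset.mem_univ i), mul_zero]
    have hki : (k i : ℝ) ≠ 0 := by exact_mod_cast hi
    have hc : ((-(Real.pi / L * (k i : ℝ)) : ℝ) : ℂ) * Complex.I ≠ 0 := by
      refine mul_ne_zero ?_ Complex.I_ne_zero
      rw [Complex.ofReal_ne_zero, neg_ne_zero]
      exact mul_ne_zero (by positivity) hki
    rw [integral_Ico_eq_integral_Ioc, ← intervalIntegral.integral_of_le (by linarith),
      integral_exp_mul_complex hc, div_eq_zero_iff]
    left
    rw [sub_eq_zero, Complex.exp_eq_exp_iff_exists_int]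
    refine ⟨-k i, ?_⟩
    have : (L : ℂ) ≠ 0 := by exact_mod_cast hL.ne'
    push_cast
    field_simp
    ring

/-- The coefficients of a product are the convolution of the coefficients, when one factor has an
absolutely convergent Fourier series. -/
lemma hasSum_ccoeff_mul {L : ℝ} {f g : Vec → ℂ} {c : Freq → ℂ}
    (hc : Summable fun k => ‖c k‖) (hf : ∀ x, HasSum (fun k => c k * mode L k x) (f x))
    (hg : Continuous g) (k : Freq) :
    HasSum (fun l => c l * ccoeff L g (k - l)) (ccoeff L (fun x => f x * g x) k) := by
  obtain ⟨M, hM⟩ := (isCompact_box L).exists_bound_of_continuousOn hg.continuousOn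
  set F : Freq → Vec → ℂ := fun l x => c l * mode L l x * (g x * mode L (-k) x) with hF
  have hint : ∀ l, Integrable (F l) (volume.restrict (cube L)) := fun l =>
    ((continuous_const.mul (continuous_mode L l)).mul
      (hg.mul (continuous_mode L (-k)))).integrableOn_cube L
  have hfin : IsFiniteMeasure ((volume : Measure Vec).restrict (cube L)) :=
    isFiniteMeasure_restrict.2 (ne_top_of_le_ne_top (isCompact_box L).measure_lt_top.ne
      (measure_mono (cube_subset_box L)))
  have hsum : Summable fun l => ∫ x in cube L, ‖F l x‖ := by
    refine Summable.of_nonneg_of_le (fun l => integral_nonneg fun x => norm_nonneg _)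
      (fun l => ?_) (hc.mul_right (M * volume.real (cube L)))
    have : ∫ x in cube L, ‖F l x‖ ≤ ∫ _x in cube L, ‖c l‖ * M := by
      refine integral_mono_ae (hint l).norm (integrable_const _) ?_
      refine (ae_restrict_iff' (measurableSet_cube L)).2 (Filter.Eventually.of_forall fun x hx => ?_)
      simp only [hF, norm_mul, norm_mode, mul_one]
      exact mul_le_mul_of_nonneg_left (hM x (cube_subset_box L hx)) (norm_nonneg _)
    refine this.trans (le_of_eq ?_)
    rw [setIntegral_const, smul_eq_mul]
    ring
  have h := (hasSum_integral_of_summable_integral_norm hint hsum).mul_left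
    ((((2 * L) ^ 3 : ℝ) : ℂ)⁻¹)
  have e1 : ∀ x, ∑' l, F l x = f x * g x * mode L (-k) x := fun x => by
    rw [mul_assoc]
    exact ((hf x).mul_right _).tsum_eq
  simp_rw [e1] at h
  have e2 : ∀ l, c l * ccoeff L g (k - l) =
      (((2 * L) ^ 3 : ℝ) : ℂ)⁻¹ * ∫ x in cube L, F l x := fun l => by
    rw [ccoeff, mul_left_comm, ← integral_const_mul, Complex.ofReal_inv]
    congr 2
    funext x
    simp only [hF]
    rw [neg_sub, sub_eq_add_neg, mode_add]
    ring
  rw [ccoeff, Complex.ofReal_inv]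
  simp_rw [e2]
  exact h

/-- A function with an absolutely convergent Fourier series determines the series. -/
lemma ccoeff_eq_of_hasSum {L : ℝ} (hL : 0 < L) {f : Vec → ℂ} {c : Freq → ℂ}
    (hc : Summable fun k => ‖c k‖) (hf : ∀ x, HasSum (fun k => c k * mode L k x) (f x))
    (k : Freq) : ccoeff L f k = c k := by
  have h := hasSum_ccoeff_mul hc hf (g := fun _ => 1) continuous_const k
  simp only [mul_one, ccoeff_one hL, sub_eq_zero] at h
  refine h.unique ?_
  convert hasSum_ite_eq k (c k) using 2 with l
  by_cases hl : l = k
  · simp [hl]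
  · simp [hl, Ne.symm hl]

/-! ### Classical derivatives and products in Fourier variables -/

/-- The Fourier coefficients of a vector field. -/
def fieldCoeff (L : ℝ) (f : Vec → Vec) : Coeffs := fun k j => coeff L (fun x => f x j) k

lemma sobolevNorm_eq_hnorm (L σ : ℝ) (f : Vec → Vec) :
    sobolevNorm L σ f = hnorm L σ (fieldCoeff L f) := rfl

lemma MemSobolev.inSobolev {L σ : ℝ} {f : Vec → Vec} (hf : MemSobolev L σ f) :
    InSobolev L σ (fieldCoeff L f) := hf.summable

lemma fieldCoeff_neg (L : ℝ) (f : Vec → Vec) (k : Freq) (i : Fin 3) :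
    fieldCoeff L f (-k) i = starRingEnd ℂ (fieldCoeff L f k i) := coeff_neg _ _ _

lemma fieldCoeff_sub {f g : Vec → Vec} (hf : Continuous f) (hg : Continuous g) (L : ℝ) :
    fieldCoeff L (f - g) = fieldCoeff L f - fieldCoeff L g := by
  funext k i
  exact coeff_sub (f := fun x => f x i) (g := fun x => g x i) (by fun_prop) (by fun_prop) L k

lemma fieldCoeff_smul (L ε : ℝ) (f : Vec → Vec) :
    fieldCoeff L (ε • f) = fun k j => (ε : ℂ) * fieldCoeff L f k j := by
  funext k i
  exact coeff_const_mul L ε (fun x => f x i) k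

/-- The phase as a linear form. -/
def phaseCLM (L : ℝ) (k : Freq) : Vec →L[ℝ] ℝ :=
  ∑ i, (Real.pi / L * (k i : ℝ)) • ContinuousLinearMap.proj (R := ℝ) (φ := fun _ : Fin 3 => ℝ) i

lemma phaseCLM_apply (L : ℝ) (k : Freq) (x : Vec) : phaseCLM L k x = phase L k x := by
  simp [phaseCLM, phase, Finset.mul_sum, mul_assoc]

lemma hasFDerivAt_phase (L : ℝ) (k : Freq) (x : Vec) :
    HasFDerivAt (phase L k) (phaseCLM L k) x := by
  have h : phase L k = phaseCLM L k := funext fun y => (phaseCLM_apply L k y).symm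
  rw [h]
  exact (phaseCLM L k).hasFDerivAt

lemma phase_single (L : ℝ) (k : Freq) (j : Fin 3) (t : ℝ) :
    phase L k (Pi.single j t) = Real.pi / L * (k j : ℝ) * t := by
  simp [phase, Pi.single_apply, mul_assoc]

lemma abs_phase_le (L : ℝ) (k : Freq) (x : Vec) : |phase L k x| ≤ 3 * weight L k * ‖x‖ := by
  rw [phase, Finset.mul_sum]
  refine (Finset.abs_sum_le_sum_abs _ _).trans ((Finset.sum_le_sum (g := fun _ =>
    weight L k * ‖x‖) fun i _ => ?_).trans (le_of_eq (by simp [mul_assoc])))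
  rw [← mul_assoc, abs_mul]
  exact mul_le_mul (abs_freq_le_weight L k i) (norm_le_pi_norm x i) (abs_nonneg _)
    (weight_nonneg L k)

/-- The derivative of a Fourier mode. -/
def modeDeriv (L : ℝ) (k : Freq) (x : Vec) : Vec →L[ℝ] ℂ :=
  (mode L k x * Complex.I) • Complex.ofRealCLM.comp (phaseCLM L k)

lemma hasFDerivAt_mode (L : ℝ) (k : Freq) (x : Vec) :
    HasFDerivAt (mode L k) (modeDeriv L k x) x := by
  have h1 : HasFDerivAt (fun y => (phase L k y : ℂ)) (Complex.ofRealCLM.comp (phaseCLM L k)) x :=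
    Complex.ofRealCLM.hasFDerivAt.comp x (hasFDerivAt_phase L k x)
  have h2 := (h1.const_mul Complex.I).cexp
  refine h2.congr_fderiv (ContinuousLinearMap.ext fun y => ?_)
  simp only [modeDeriv, mode, smul_apply, smul_eq_mul]
  ring

lemma modeDeriv_single (L : ℝ) (k : Freq) (x : Vec) (j : Fin 3) :
    modeDeriv L k x (Pi.single j 1) =
      Complex.I * ((Real.pi / L * (k j : ℝ) : ℝ) : ℂ) * mode L k x := by
  simp only [modeDeriv, smul_apply, ContinuousLinearMap.comp_apply,
    phaseCLM_apply, phase_single, mul_one, Complex.ofRealCLM_apply, smul_eq_mul]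
  ring

lemma norm_modeDeriv_le (L : ℝ) (k : Freq) (x : Vec) : ‖modeDeriv L k x‖ ≤ 3 * weight L k := by
  refine ContinuousLinearMap.opNorm_le_bound _ (mul_nonneg (by norm_num) (weight_nonneg L k))
    fun y => ?_
  simp only [modeDeriv, smul_apply, ContinuousLinearMap.comp_apply,
    phaseCLM_apply, Complex.ofRealCLM_apply, smul_eq_mul, norm_mul, norm_mode, Complex.norm_I,
    one_mul, Complex.norm_real, Real.norm_eq_abs]
  exact abs_phase_le L k y

section Field

variable {L σ : ℝ} {v w : Vec → Vec}

lemma summable_norm_fieldCoeff (hL : 0 < L) (hσ : 5 / 2 < σ) (hw : MemSobolev L σ w) (i : Fin 3) :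
    Summable fun k => ‖fieldCoeff L w k i‖ :=
  Summable.of_nonneg_of_le (fun _ => norm_nonneg _) (fun k => norm_le_pi_norm _ i)
    (by simpa using hw.inSobolev.summable_weight_mul (r := 0) hL (by linarith))

lemma summable_weight_fieldCoeff (hL : 0 < L) (hσ : 5 / 2 < σ) (hw : MemSobolev L σ w)
    (i : Fin 3) : Summable fun k => weight L k * ‖fieldCoeff L w k i‖ :=
  Summable.of_nonneg_of_le (fun k => mul_nonneg (weight_nonneg L k) (norm_nonneg _))
    (fun k => mul_le_mul_of_nonneg_left (norm_le_pi_norm _ i) (weight_nonneg L k))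
    (by simpa using hw.inSobolev.summable_weight_mul (r := 1) hL (by linarith))

lemma hasSum_fieldCoeff_mul_mode (hL : 0 < L) (hσ : 5 / 2 < σ) (hwc : Continuous w)
    (hw : MemSobolev L σ w) (i : Fin 3) (x : Vec) :
    HasSum (fun k => fieldCoeff L w k i * mode L k x) (w x i : ℂ) :=
  hasSum_coeff_mul_mode hL (f := fun x => w x i) (by fun_prop)
    (fun y j => congrFun (hw.periodic y j) i)
    (summable_norm_fieldCoeff hL hσ hw i).of_norm x

/-- The coefficients of `∂ⱼwᵢ`. -/
def derivCoeff (L : ℝ) (w : Vec → Vec) (j i : Fin 3) (k : Freq) : ℂ :=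
  Complex.I * ((Real.pi / L * (k j : ℝ) : ℝ) : ℂ) * fieldCoeff L w k i

lemma summable_norm_derivCoeff (hL : 0 < L) (hσ : 5 / 2 < σ) (hw : MemSobolev L σ w)
    (j i : Fin 3) : Summable fun k => ‖derivCoeff L w j i k‖ := by
  refine Summable.of_nonneg_of_le (fun _ => norm_nonneg _) (fun k => ?_)
    (summable_weight_fieldCoeff hL hσ hw i)
  rw [derivCoeff, norm_mul, norm_mul, Complex.norm_I, one_mul]
  exact mul_le_mul_of_nonneg_right (norm_freq_le_weight L k j) (norm_nonneg _)

/-- Term by term differentiation: above the exponent `5/2`, a continuous field in `H^σ` is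
classically differentiable. -/
lemma hasSum_pderiv (hL : 0 < L) (hσ : 5 / 2 < σ) (hwc : Continuous w) (hw : MemSobolev L σ w)
    (j i : Fin 3) (x : Vec) :
    HasSum (fun k => derivCoeff L w j i k * mode L k x) (pderiv j w i x : ℂ) := by
  have hbound : ∀ (i : Fin 3) (k : Freq) (y : Vec),
      ‖fieldCoeff L w k i • modeDeriv L k y‖ ≤ 3 * (weight L k * ‖fieldCoeff L w k i‖) :=
    fun i k y => by
      rw [norm_smul]
      calc _ ≤ ‖fieldCoeff L w k i‖ * (3 * weight L k) := by
            gcongr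
            exact norm_modeDeriv_le L k y
        _ = _ := by ring
  have hsum : ∀ i, Summable fun k => 3 * (weight L k * ‖fieldCoeff L w k i‖) := fun i =>
    (summable_weight_fieldCoeff hL hσ hw i).mul_left 3
  have hderiv : ∀ i, HasFDerivAt (fun y => (w y i : ℂ))
      (∑' k, fieldCoeff L w k i • modeDeriv L k x) x := fun i => by
    have h := hasFDerivAt_tsum (𝕜 := ℝ) (f := fun k y => fieldCoeff L w k i * mode L k y)
      (f' := fun k y => fieldCoeff L w k i • modeDeriv L k y) (x₀ := x) (hsum i)
      (fun k y => (hasFDerivAt_mode L k y).const_mul _) (hbound i)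
      (hasSum_fieldCoeff_mul_mode hL hσ hwc hw i x).summable x
    refine h.congr_of_eventuallyEq (Filter.Eventually.of_forall fun y => ?_)
    exact (hasSum_fieldCoeff_mul_mode hL hσ hwc hw i y).tsum_eq.symm
  have hreal : ∀ i, DifferentiableAt ℝ (fun y => w y i) x := fun i =>
    (Complex.reCLM.hasFDerivAt.comp x (hderiv i)).differentiableAt
  have hw' : DifferentiableAt ℝ w x := differentiableAt_pi.2 hreal
  have hpd : pderiv j w i x = fderiv ℝ (fun y => w y i) x (Pi.single j 1) := by
    have h1 := hasFDerivAt_pi'.1 hw'.hasFDerivAt i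
    rw [pderiv, h1.fderiv]
    rfl
  have huniq : ∑' k, fieldCoeff L w k i • modeDeriv L k x =
      Complex.ofRealCLM.comp (fderiv ℝ (fun y => w y i) x) :=
    (hderiv i).unique (Complex.ofRealCLM.hasFDerivAt.comp x (hreal i).hasFDerivAt)
  have hs : Summable fun k => fieldCoeff L w k i • modeDeriv L k x :=
    Summable.of_norm_bounded (hsum i) fun k => hbound i k x
  have h := hs.hasSum.mapL (ContinuousLinearMap.apply ℝ ℂ (Pi.single j 1 : Vec))
  rw [huniq] at h
  have e1 : ∀ k, (ContinuousLinearMap.apply ℝ ℂ (Pi.single j 1 : Vec))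
      (fieldCoeff L w k i • modeDeriv L k x) = derivCoeff L w j i k * mode L k x := fun k => by
    rw [ContinuousLinearMap.apply_apply, smul_apply, modeDeriv_single,
      derivCoeff, smul_eq_mul]
    ring
  simp_rw [e1] at h
  rw [hpd]
  exact h

lemma continuous_pderiv (hL : 0 < L) (hσ : 5 / 2 < σ) (hwc : Continuous w)
    (hw : MemSobolev L σ w) (j i : Fin 3) : Continuous (pderiv j w i) := by
  have h : Continuous fun x => ∑' k, derivCoeff L w j i k * mode L k x :=
    continuous_tsum (fun k => continuous_const.mul (continuous_mode L k))
      (summable_norm_derivCoeff hL hσ hw j i) fun k x => by rw [norm_mul, norm_mode, mul_one]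
  have e : pderiv j w i = fun x => (∑' k, derivCoeff L w j i k * mode L k x).re := by
    funext x
    rw [(hasSum_pderiv hL hσ hwc hw j i x).tsum_eq, Complex.ofReal_re]
  rw [e]
  exact Complex.continuous_re.comp h

lemma continuous_advect (hL : 0 < L) (hσ : 5 / 2 < σ) (hvc : Continuous v) (hwc : Continuous w)
    (hw : MemSobolev L σ w) : Continuous (advect v w) :=
  continuous_pi fun i => continuous_finsetSum _ fun j _ =>
    (by fun_prop : Continuous fun x => v x j).mul (continuous_pderiv hL hσ hwc hw j i)

lemma continuous_gradDot (hL : 0 < L) (hσ : 5 / 2 < σ) (hvc : Continuous v) (hwc : Continuous w)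
    (hw : MemSobolev L σ w) : Continuous (gradDot w v) :=
  continuous_pi fun i => continuous_finsetSum _ fun j _ =>
    (continuous_pderiv hL hσ hwc hw i j).mul (by fun_prop : Continuous fun x => v x j)

lemma ccoeff_sum {g : Fin 3 → Vec → ℂ} (hg : ∀ j, Continuous (g j)) (k : Freq) :
    ccoeff L (fun x => ∑ j, g j x) k = ∑ j, ccoeff L (g j) k := by
  simp only [ccoeff]
  rw [← Finset.mul_sum, ← integral_finsetSum]
  · simp_rw [Finset.sum_mul]
  · exact fun j _ => ((hg j).mul (continuous_mode L _)).integrableOn_cube L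

lemma hasSum_coeff_pderiv_mul (hL : 0 < L) (hσ : 5 / 2 < σ) (hvc : Continuous v)
    (hwc : Continuous w) (hw : MemSobolev L σ w) (a b c : Fin 3) (k : Freq) :
    HasSum (fun l => derivCoeff L w a b l * fieldCoeff L v (k - l) c)
      (ccoeff L (fun x => (pderiv a w b x : ℂ) * (v x c : ℂ)) k) := by
  have h := hasSum_ccoeff_mul (summable_norm_derivCoeff hL hσ hw a b)
    (hasSum_pderiv hL hσ hwc hw a b) (g := fun x => (v x c : ℂ)) (by fun_prop) k
  simp_rw [← coeff_eq_ccoeff] at h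
  exact h

lemma fieldCoeff_advect (hL : 0 < L) (hσ : 5 / 2 < σ) (hvc : Continuous v) (hwc : Continuous w)
    (hw : MemSobolev L σ w) :
    fieldCoeff L (advect v w) = advCoeff L (fieldCoeff L v) (fieldCoeff L w) := by
  funext k i
  have hc : ∀ j, Continuous fun x => (pderiv j w i x : ℂ) * (v x j : ℂ) := fun j =>
    (Complex.continuous_ofReal.comp (continuous_pderiv hL hσ hwc hw j i)).mul (by fun_prop)
  have e : fieldCoeff L (advect v w) k i =
      ∑ j, ccoeff L (fun x => (pderiv j w i x : ℂ) * (v x j : ℂ)) k := by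
    rw [← ccoeff_sum hc, fieldCoeff, coeff_eq_ccoeff]
    congr 1
    funext x
    simp only [advect]
    push_cast
    exact Finset.sum_congr rfl fun j _ => mul_comm _ _
  have h := hasSum_sum fun j (_ : j ∈ Finset.univ) =>
    hasSum_coeff_pderiv_mul hL hσ hvc hwc hw j i j k
  rw [e, ← h.tsum_eq, advCoeff]
  refine tsum_congr fun l => ?_
  rw [transportSymbol, mul_assoc, Finset.sum_mul, Finset.mul_sum]
  refine Finset.sum_congr rfl fun j _ => ?_
  rw [derivCoeff]
  ring

lemma fieldCoeff_gradDot (hL : 0 < L) (hσ : 5 / 2 < σ) (hvc : Continuous v) (hwc : Continuous w)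
    (hw : MemSobolev L σ w) :
    fieldCoeff L (gradDot w v) = gradDotCoeff L (fieldCoeff L w) (fieldCoeff L v) := by
  funext k i
  have hc : ∀ j, Continuous fun x => (pderiv i w j x : ℂ) * (v x j : ℂ) := fun j =>
    (Complex.continuous_ofReal.comp (continuous_pderiv hL hσ hwc hw i j)).mul (by fun_prop)
  have e : fieldCoeff L (gradDot w v) k i =
      ∑ j, ccoeff L (fun x => (pderiv i w j x : ℂ) * (v x j : ℂ)) k := by
    rw [← ccoeff_sum hc, fieldCoeff, coeff_eq_ccoeff]
    congr 1
    funext x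
    simp only [gradDot]
    push_cast
    rfl
  have h := hasSum_sum fun j (_ : j ∈ Finset.univ) =>
    hasSum_coeff_pderiv_mul hL hσ hvc hwc hw i j j k
  rw [e, ← h.tsum_eq, gradDotCoeff]
  refine tsum_congr fun l => ?_
  rw [Finset.mul_sum]
  refine Finset.sum_congr rfl fun j _ => ?_
  rw [derivCoeff]
  ring

lemma sum_freq_mul_fieldCoeff (hL : 0 < L) (hσ : 5 / 2 < σ) (hwc : Continuous w)
    (hw : MemSobolev L σ w) (hdiv : ∀ x, divergence w x = 0) (k : Freq) :
    ∑ i, (k i : ℂ) * fieldCoeff L w k i = 0 := by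
  have h : ∀ x, HasSum (fun k => (∑ i, derivCoeff L w i i k) * mode L k x) 0 := fun x => by
    have h1 := hasSum_sum fun i (_ : i ∈ Finset.univ) => hasSum_pderiv hL hσ hwc hw i i x
    have h2 : ∑ i, (pderiv i w i x : ℂ) = 0 := by exact_mod_cast hdiv x
    rw [h2] at h1
    simp_rw [Finset.sum_mul]
    exact h1
  have hs : Summable fun k => ‖∑ i, derivCoeff L w i i k‖ :=
    Summable.of_nonneg_of_le (fun _ => norm_nonneg _) (fun k => norm_sum_le _ _)
      (summable_sum fun i _ => summable_norm_derivCoeff hL hσ hw i i)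
  have h0 := ccoeff_eq_of_hasSum hL hs (f := fun _ => 0) h k
  have h1 : ∑ i, derivCoeff L w i i k =
      Complex.I * ((Real.pi / L : ℝ) : ℂ) * ∑ i, (k i : ℂ) * fieldCoeff L w k i := by
    rw [Finset.mul_sum]
    refine Finset.sum_congr rfl fun i _ => ?_
    rw [derivCoeff]
    push_cast
    ring
  rw [h1] at h0
  have h2 : ccoeff L (fun _ => 0) k = 0 := by simp [ccoeff]
  rw [h2] at h0
  refine (mul_eq_zero.1 h0.symm).resolve_left (mul_ne_zero Complex.I_ne_zero ?_)
  rw [Complex.ofReal_ne_zero]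
  positivity

end Field

/-! ### Plane waves as test fields -/

/-- The plane wave `x ↦ g((π/L) k · x) a`. -/
def planeWave (L : ℝ) (k : Freq) (a : Fin 3 → ℝ) (g : ℝ → ℝ) (x : Vec) : Vec := fun i =>
  a i * g (phase L k x)

lemma isTestField_planeWave {L : ℝ} (hL : 0 < L) {k : Freq} {a : Fin 3 → ℝ}
    (ha : ∑ i, (k i : ℝ) * a i = 0) {g : ℝ → ℝ} (hg : ContDiff ℝ (⊤ : ℕ∞) g)
    (hper : Function.Periodic g (2 * Real.pi)) : IsTestField L (planeWave L k a g) where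
  smooth := by
    have h : phase L k = phaseCLM L k := funext fun y => (phaseCLM_apply L k y).symm
    have h1 : ContDiff ℝ (⊤ : ℕ∞) (phase L k) := by
      rw [h]
      exact (phaseCLM L k).contDiff
    exact contDiff_pi.2 fun i => contDiff_const.mul (hg.comp h1)
  periodic := fun x i => by
    have h : phase L k (x + Pi.single i (2 * L)) = phase L k x + k i * (2 * Real.pi) := by
      rw [← phaseCLM_apply, map_add, phaseCLM_apply, phaseCLM_apply, phase_single]
      field_simp
    funext j
    simp only [planeWave]
    rw [h, (hper.int_mul (k i)) _]
  div_free := fun x => by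
    have hgd : HasDerivAt g (deriv g (phase L k x)) (phase L k x) :=
      (hg.differentiable (by simp)).differentiableAt.hasDerivAt
    have h : HasFDerivAt (planeWave L k a g) (ContinuousLinearMap.pi fun i =>
        a i • (deriv g (phase L k x) • phaseCLM L k)) x :=
      hasFDerivAt_pi.2 fun i => (hgd.comp_hasFDerivAt x (hasFDerivAt_phase L k x)).const_mul (a i)
    simp only [divergence, pderiv, h.fderiv, ContinuousLinearMap.pi_apply,
      smul_apply, phaseCLM_apply, phase_single, smul_eq_mul]
    calc _ = deriv g (phase L k x) * (Real.pi / L) * ∑ i, (k i : ℝ) * a i := by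
          rw [Finset.mul_sum]
          exact Finset.sum_congr rfl fun i _ => by ring
      _ = 0 := by rw [ha, mul_zero]

/-- The pairings with the two plane waves of frequency `k` are the real and imaginary parts of the
`k`-th Fourier coefficient. -/
lemma pairing_planeWave {L : ℝ} {f : Vec → Vec} (hf : Continuous f) (k : Freq)
    (a : Fin 3 → ℝ) :
    (∑ i, (a i : ℂ) * fieldCoeff L f k i).re =
      ((2 * L) ^ 3)⁻¹ * pairing L f (planeWave L k a Real.cos) ∧
    (∑ i, (a i : ℂ) * fieldCoeff L f k i).im =
      -(((2 * L) ^ 3)⁻¹ * pairing L f (planeWave L k a Real.sin)) := by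
  have hc : ∀ i, Continuous fun x => ((a i * f x i : ℝ) : ℂ) := fun i => by fun_prop
  have hc' : Continuous fun x => ∑ i, ((a i * f x i : ℝ) : ℂ) :=
    continuous_finsetSum _ fun i _ => hc i
  have e : ∑ i, (a i : ℂ) * fieldCoeff L f k i =
      ((((2 * L) ^ 3)⁻¹ : ℝ) : ℂ) *
        ∫ x in cube L, (∑ i, ((a i * f x i : ℝ) : ℂ)) * mode L (-k) x := by
    have h := ccoeff_sum (L := L) hc k
    simp_rw [← coeff_eq_ccoeff, coeff_const_mul] at h
    exact h.symm
  have hint : IntegrableOn (fun x => (∑ i, ((a i * f x i : ℝ) : ℂ)) * mode L (-k) x) (cube L) :=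
    (hc'.mul (continuous_mode L (-k))).integrableOn_cube L
  have hre : ∀ x, ((∑ i, ((a i * f x i : ℝ) : ℂ)) * mode L (-k) x).re =
      ∑ i, f x i * planeWave L k a Real.cos x i := fun x => by
    rw [← Complex.ofReal_sum, Complex.re_ofReal_mul, mode_neg, Complex.conj_re, mode, mul_comm
      Complex.I, Complex.exp_ofReal_mul_I_re, Finset.sum_mul]
    refine Finset.sum_congr rfl fun i _ => ?_
    simp only [planeWave]
    ring
  have him : ∀ x, ((∑ i, ((a i * f x i : ℝ) : ℂ)) * mode L (-k) x).im =
      -∑ i, f x i * planeWave L k a Real.sin x i := fun x => by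
    rw [← Complex.ofReal_sum, Complex.im_ofReal_mul, mode_neg, Complex.conj_im, mode, mul_comm
      Complex.I, Complex.exp_ofReal_mul_I_im, Finset.sum_mul, ← Finset.sum_neg_distrib]
    refine Finset.sum_congr rfl fun i _ => ?_
    simp only [planeWave]
    ring
  rw [e, Complex.re_ofReal_mul, Complex.im_ofReal_mul]
  constructor
  · rw [pairing]
    congr 1
    simp_rw [← hre]
    exact (Complex.reCLM.integral_comp_comm hint).symm
  · rw [pairing, ← mul_neg, ← integral_neg]
    congr 1
    simp_rw [← him]
    exact (Complex.imCLM.integral_comp_comm hint).symm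

/-! ### Solutions as curves of Fourier coefficients -/

/-- Bounded measurable functions of time on `[0, T]`. -/
def BddMeasOn (T : ℝ) (y : ℝ → ℝ) : Prop :=
  AEStronglyMeasurable y (volume.restrict (Set.Icc 0 T)) ∧ ∃ M, ∀ t ∈ Set.Icc 0 T, |y t| ≤ M

namespace BddMeasOn

variable {T : ℝ} {y z : ℝ → ℝ}

lemma add (hy : BddMeasOn T y) (hz : BddMeasOn T z) : BddMeasOn T fun t => y t + z t := by
  obtain ⟨hy, M, hM⟩ := hy
  obtain ⟨hz, N, hN⟩ := hz
  exact ⟨hy.add hz, M + N, fun t ht =>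
    (abs_add_le _ _).trans (add_le_add (hM t ht) (hN t ht))⟩

lemma mul (hy : BddMeasOn T y) (hz : BddMeasOn T z) : BddMeasOn T fun t => y t * z t := by
  obtain ⟨hy, M, hM⟩ := hy
  obtain ⟨hz, N, hN⟩ := hz
  refine ⟨hy.mul hz, M * N, fun t ht => ?_⟩
  rw [abs_mul]
  exact mul_le_mul (hM t ht) (hN t ht) (abs_nonneg _) ((abs_nonneg _).trans (hM t ht))

lemma const (T c : ℝ) : BddMeasOn T fun _ => c :=
  ⟨aestronglyMeasurable_const, |c|, fun _ _ => le_rfl⟩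

lemma const_mul (c : ℝ) (hy : BddMeasOn T y) : BddMeasOn T fun t => c * y t := (const T c).mul hy

lemma integrableOn (hy : BddMeasOn T y) : IntegrableOn y (Set.Icc 0 T) := by
  obtain ⟨hy, M, hM⟩ := hy
  exact Integrable.of_bound hy M
    ((ae_restrict_iff' measurableSet_Icc).2 (Filter.Eventually.of_forall hM))

lemma intervalIntegrable (hy : BddMeasOn T y) {a b : ℝ} (ha : a ∈ Set.Icc 0 T)
    (hb : b ∈ Set.Icc 0 T) : IntervalIntegrable y volume a b :=
  (hy.integrableOn.mono_set (Set.uIcc_subset_Icc ha hb)).intervalIntegrable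

end BddMeasOn

/-- A curve in `L^∞([0, T]; H^σ)` of coefficients of real divergence-free fields, each coefficient
being continuous in time. -/
structure IsCurve (L σ T : ℝ) (c : ℝ → Coeffs) : Prop where
  cont : ∀ k j, ContinuousOn (fun t => c t k j) (Set.Icc 0 T)
  mem : ∀ t ∈ Set.Icc 0 T, InSobolev L σ (c t)
  bdd : ∃ M, ∀ t ∈ Set.Icc 0 T, hnorm L σ (c t) ≤ M
  div_free : ∀ t ∈ Set.Icc 0 T, ∀ k, ∑ i, (k i : ℂ) * c t k i = 0
  real : ∀ t ∈ Set.Icc 0 T, ∀ k i, c t (-k) i = starRingEnd ℂ (c t k i)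

namespace IsCurve

variable {L σ σ' T T' : ℝ} {c v : ℝ → Coeffs}

lemma mono_time (hc : IsCurve L σ T' c) (h : T ≤ T') : IsCurve L σ T c := by
  have hsub : Set.Icc 0 T ⊆ Set.Icc 0 T' := Set.Icc_subset_Icc_right h
  obtain ⟨M, hM⟩ := hc.bdd
  exact ⟨fun k j => (hc.cont k j).mono hsub, fun t ht => hc.mem t (hsub ht),
    ⟨M, fun t ht => hM t (hsub ht)⟩, fun t ht => hc.div_free t (hsub ht),
    fun t ht => hc.real t (hsub ht)⟩

lemma mono (hL : 0 < L) (hc : IsCurve L σ' T c) (h : σ ≤ σ') : IsCurve L σ T c := by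
  obtain ⟨M, hM⟩ := hc.bdd
  exact ⟨hc.cont, fun t ht => (hc.mem t ht).mono hL h,
    ⟨M, fun t ht => ((hc.mem t ht).hnorm_mono hL h).trans (hM t ht)⟩, hc.div_free, hc.real⟩

lemma sub (hL : 0 < L) (hc : IsCurve L σ T c) (hv : IsCurve L σ T v) :
    IsCurve L σ T fun t => c t - v t := by
  obtain ⟨M, hM⟩ := hc.bdd
  obtain ⟨M', hM'⟩ := hv.bdd
  refine ⟨fun k j => (hc.cont k j).sub (hv.cont k j), fun t ht => (hc.mem t ht).sub hL (hv.mem t ht),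
    ⟨2 * (M + M'), fun t ht => ?_⟩, fun t ht k => ?_, fun t ht k i => ?_⟩
  · have := (hc.mem t ht).hnorm_sub_le hL (hv.mem t ht)
    linarith [hM t ht, hM' t ht]
  · simp only [Pi.sub_apply, mul_sub, Finset.sum_sub_distrib, hc.div_free t ht, hv.div_free t ht,
      sub_zero]
  · simp only [Pi.sub_apply, map_sub, hc.real t ht, hv.real t ht]

/-- The norm of a weakly continuous curve is measurable, being a series of continuous
functions. -/
lemma bddMeasOn_hnorm (hc : IsCurve L σ T c) : BddMeasOn T fun t => hnorm L σ (c t) := by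
  obtain ⟨M, hM⟩ := hc.bdd
  refine ⟨?_, M, fun t ht => by rw [abs_of_nonneg (hnorm_nonneg _ _ _)]; exact hM t ht⟩
  have hterm_cont : ∀ k, ContinuousOn (fun t => hterm L σ (c t) k) (Set.Icc 0 T) := fun k =>
    continuousOn_const.mul (continuousOn_finsetSum _ fun j _ => ((hc.cont k j).norm.pow 2))
  have hmeas : AEStronglyMeasurable (fun t => ∑' k, hterm L σ (c t) k)
      (volume.restrict (Set.Icc 0 T)) := by
    refine aestronglyMeasurable_of_tendsto_ae (Filter.atTop : Filter (Finset Freq))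
      (f := fun S t => ∑ k ∈ S, hterm L σ (c t) k) (fun S => ?_) ?_
    · exact (continuousOn_finsetSum _ fun k _ => hterm_cont k).aestronglyMeasurable
        measurableSet_Icc
    · exact (ae_restrict_iff' measurableSet_Icc).2 (Filter.Eventually.of_forall fun t ht =>
        (hc.mem t ht).hasSum)
  exact Real.continuous_sqrt.comp_aestronglyMeasurable hmeas

lemma exists_norm_le (hL : 0 < L) (hc : IsCurve L σ T c) :
    ∃ M, 0 ≤ M ∧ ∀ t ∈ Set.Icc 0 T, ∀ k, ‖c t k‖ ≤ M * weight L k ^ (-σ) := by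
  obtain ⟨M, hM⟩ := hc.bdd
  refine ⟨volFactor L * max M 0, mul_nonneg (volFactor_nonneg L) (le_max_right _ _),
    fun t ht k => ?_⟩
  rw [Real.rpow_neg (weight_nonneg L k), ← div_eq_mul_inv,
    le_div_iff₀ (Real.rpow_pos_of_pos (weight_pos L k) _), mul_comm]
  exact ((hc.mem t ht).weight_mul_norm_le hL k).trans
    (mul_le_mul_of_nonneg_left ((hM t ht).trans (le_max_left _ _)) (volFactor_nonneg L))

/-- The terms of the convolutions are dominated uniformly in time, so that the nonlinear terms are
continuous in time, mode by mode. -/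
lemma exists_summable_bound (hL : 0 < L) (hσ : 5 / 2 < σ) (hv : IsCurve L σ T v)
    (hc : IsCurve L σ T c) (k : Freq) :
    ∃ B : Freq → ℝ, Summable B ∧ ∀ l, ∀ t ∈ Set.Icc 0 T,
      3 * (‖v t (k - l)‖ * (weight L l * ‖c t l‖)) ≤ B l := by
  obtain ⟨M, hM0, hM⟩ := hv.exists_norm_le hL
  obtain ⟨M', hM'0, hM'⟩ := hc.exists_norm_le hL
  have h1 : Summable fun l => (weight L (k - l) ^ (-σ)) ^ 2 :=
    ((Equiv.subLeft k).summable_iff (f := fun l => (weight L l ^ (-σ)) ^ 2)).2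
      (summable_weight_rpow hL (by linarith))
  have h2 := summable_weight_rpow (σ := σ - 1) hL (by linarith)
  refine ⟨fun l => 3 * (M * M') * (weight L (k - l) ^ (-σ) * weight L l ^ (-(σ - 1))),
    (summable_mul_of_sq h1 h2).mul_left _, fun l t ht => ?_⟩
  have h3 : weight L l ^ (-(σ - 1)) = weight L l * weight L l ^ (-σ) := by
    rw [show -(σ - 1) = 1 + -σ by ring, Real.rpow_add (weight_pos L l), Real.rpow_one]
  have h4 := weight_nonneg L l
  have h5 := Real.rpow_nonneg (weight_nonneg L (k - l)) (-σ)
  calc 3 * (‖v t (k - l)‖ * (weight L l * ‖c t l‖))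
      ≤ 3 * ((M * weight L (k - l) ^ (-σ)) * (weight L l * (M' * weight L l ^ (-σ)))) := by
        gcongr
        · exact hM t ht _
        · exact hM' t ht _
    _ = _ := by simp only [h3]; ring

lemma continuousOn_advCoeff (hL : 0 < L) (hσ : 5 / 2 < σ) (hv : IsCurve L σ T v)
    (hc : IsCurve L σ T c) (k : Freq) (i : Fin 3) :
    ContinuousOn (fun t => advCoeff L (v t) (c t) k i) (Set.Icc 0 T) := by
  obtain ⟨B, hB, hle⟩ := exists_summable_bound hL hσ hv hc k
  refine continuousOn_tsum (fun l => ?_) hB fun l t ht =>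
    (norm_advCoeff_term_le L (v t) (c t) k l i).trans (hle l t ht)
  exact (continuousOn_const.mul (continuousOn_finsetSum _ fun j _ =>
    continuousOn_const.mul (hv.cont _ _))).mul (hc.cont _ _)

lemma continuousOn_gradDotCoeff (hL : 0 < L) (hσ : 5 / 2 < σ) (hc : IsCurve L σ T c)
    (hv : IsCurve L σ T v) (k : Freq) (i : Fin 3) :
    ContinuousOn (fun t => gradDotCoeff L (c t) (v t) k i) (Set.Icc 0 T) := by
  obtain ⟨B, hB, hle⟩ := exists_summable_bound hL hσ hv hc k
  refine continuousOn_tsum (fun l => ?_) hB fun l t ht =>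
    (norm_gradDotCoeff_term_le L (c t) (v t) k l i).trans (hle l t ht)
  exact continuousOn_const.mul (continuousOn_finsetSum _ fun j _ =>
    (hc.cont _ _).mul (hv.cont _ _))

end IsCurve

section Solution

variable {L σ T : ℝ} {N : ℝ → Vec → Vec} {a : Vec → Vec} {v : ℝ → Vec → Vec}

lemma IsSolution.continuous (hv : IsSolution L σ T N a v) {t : ℝ} (ht : t ∈ Set.Icc 0 T) :
    Continuous (v t) :=
  hv.continuousOn.comp_continuous (f := fun x => (t, x)) (by fun_prop) fun _ => ⟨ht, trivial⟩

lemma IsSolution.continuousOn_fieldCoeff (hT : 0 ≤ T) (hv : IsSolution L σ T N a v) (k : Freq)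
    (j : Fin 3) : ContinuousOn (fun t => fieldCoeff L (v t) k j) (Set.Icc 0 T) := by
  have hc : Continuous fun p : ℝ × Vec => v (Set.projIcc 0 T hT p.1) p.2 := by
    refine hv.continuousOn.comp_continuous
      (f := fun p : ℝ × Vec => ((Set.projIcc 0 T hT p.1 : ℝ), p.2)) ?_ fun p =>
        ⟨(Set.projIcc 0 T hT p.1).2, trivial⟩
    exact (continuous_subtype_val.comp (continuous_projIcc.comp continuous_fst)).prodMk
      continuous_snd
  have hF : Continuous (Function.uncurry fun (t : ℝ) (x : Vec) =>
      (v (Set.projIcc 0 T hT t) x j : ℂ) * mode L (-k) x) :=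
    (Complex.continuous_ofReal.comp ((continuous_apply j).comp hc)).mul
      ((continuous_mode L (-k)).comp continuous_snd)
  have h := (continuous_parametric_integral_of_continuous (μ := volume) hF
    (isCompact_box L)).const_mul ((((2 * L) ^ 3 : ℝ)⁻¹ : ℝ) : ℂ)
  refine h.continuousOn.congr fun t ht => ?_
  simp only [fieldCoeff, coeff_eq_ccoeff, ccoeff, Set.projIcc_of_mem hT ht]
  rw [setIntegral_congr_set (cube_ae_eq_box L)]

lemma IsSolution.isCurve (hL : 0 < L) (hσ : 5 / 2 < σ) (hT : 0 ≤ T)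
    (hv : IsSolution L σ T N a v) : IsCurve L σ T fun t => fieldCoeff L (v t) where
  cont := hv.continuousOn_fieldCoeff hT
  mem t ht := (hv.memSobolev t ht).inSobolev
  bdd := hv.bounded
  div_free t ht := sum_freq_mul_fieldCoeff hL hσ (hv.continuous ht) (hv.memSobolev t ht)
    (hv.div_free t ht)
  real t _ := fieldCoeff_neg L (v t)

/-- The equation mode by mode: the rows of the Leray projection give divergence-free plane waves,
and testing against these eliminates the pressure. -/
lemma IsSolution.fieldCoeff_eq (hL : 0 < L) (hσ : 5 / 2 < σ) (hv : IsSolution L σ T N a v)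
    {n : ℝ → Coeffs} (hN : ∀ t ∈ Set.Icc 0 T, Continuous (N t))
    (hn : ∀ t ∈ Set.Icc 0 T, fieldCoeff L (N t) = n t)
    (hnc : ∀ k i, ContinuousOn (fun t => n t k i) (Set.Icc 0 T)) {t : ℝ} (ht : t ∈ Set.Icc 0 T)
    (k : Freq) (j : Fin 3) :
    fieldCoeff L (v t) k j = fieldCoeff L (v 0) k j -
      ∫ τ in (0 : ℝ)..t, ∑ i, (leray k j i : ℂ) * n τ k i := by
  have hT : 0 ≤ T := ht.1.trans ht.2
  have h0 : (0 : ℝ) ∈ Set.Icc 0 T := ⟨le_rfl, hT⟩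
  have hleray := sum_freq_mul_leray k j
  have hproj : ∀ t ∈ Set.Icc 0 T, ∑ i, (leray k j i : ℂ) * fieldCoeff L (v t) k i =
      fieldCoeff L (v t) k j := fun t ht =>
    sum_leray_mul_of_div_free (sum_freq_mul_fieldCoeff hL hσ (hv.continuous ht)
      (hv.memSobolev t ht) (hv.div_free t ht) k) j
  have hsub : Set.uIcc 0 t ⊆ Set.Icc 0 T := Set.uIcc_subset_Icc h0 ht
  have hint : IntervalIntegrable (fun τ => ∑ i, (leray k j i : ℂ) * n τ k i) volume 0 t :=
    (ContinuousOn.mono (continuousOn_finsetSum _ fun i _ =>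
      continuousOn_const.mul (hnc k i)) hsub).intervalIntegrable
  have hv0 : v 0 = a := hv.initial
  have hac : Continuous a := hv0 ▸ hv.continuous h0
  have hcos := hv.equation _ (isTestField_planeWave hL hleray Real.contDiff_cos
    Real.cos_periodic) t ht
  have hsin := hv.equation _ (isTestField_planeWave hL hleray Real.contDiff_sin
    Real.sin_periodic) t ht
  have hre := (Complex.reCLM.intervalIntegral_comp_comm hint)
  have him := (Complex.imCLM.intervalIntegral_comp_comm hint)
  have e1 : ∀ τ ∈ Set.uIcc 0 t, Complex.reCLM (∑ i, (leray k j i : ℂ) * n τ k i) =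
      ((2 * L) ^ 3)⁻¹ * pairing L (N τ) (planeWave L k (leray k j) Real.cos) := fun τ hτ => by
    rw [← hn τ (hsub hτ), Complex.reCLM_apply]
    exact (pairing_planeWave (hN τ (hsub hτ)) k _).1
  have e2 : ∀ τ ∈ Set.uIcc 0 t, Complex.imCLM (∑ i, (leray k j i : ℂ) * n τ k i) =
      -((2 * L) ^ 3)⁻¹ * pairing L (N τ) (planeWave L k (leray k j) Real.sin) := fun τ hτ => by
    rw [← hn τ (hsub hτ), Complex.imCLM_apply, neg_mul]
    exact (pairing_planeWave (hN τ (hsub hτ)) k _).2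
  rw [intervalIntegral.integral_congr e1, intervalIntegral.integral_const_mul,
    Complex.reCLM_apply] at hre
  rw [intervalIntegral.integral_congr e2, intervalIntegral.integral_const_mul,
    Complex.imCLM_apply] at him
  rw [← hproj t ht, ← hproj 0 h0, hv0]
  apply Complex.ext
  · rw [Complex.sub_re, ← hre, (pairing_planeWave (hv.continuous ht) k _).1,
      (pairing_planeWave hac k _).1, hcos]
    ring
  · rw [Complex.sub_im, ← him, (pairing_planeWave (hv.continuous ht) k _).2,
      (pairing_planeWave hac k _).2, hsin]
    ring

/-- The Euler equations in Fourier variables. -/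
lemma IsEulerSolution.fieldCoeff_eq (hL : 0 < L) (hσ : 5 / 2 < σ) (hv : IsEulerSolution L σ T a v)
    {t : ℝ} (ht : t ∈ Set.Icc 0 T) (k : Freq) (j : Fin 3) :
    fieldCoeff L (v t) k j = fieldCoeff L (v 0) k j - ∫ τ in (0 : ℝ)..t, ∑ i, (leray k j i : ℂ) *
      advCoeff L (fieldCoeff L (v τ)) (fieldCoeff L (v τ)) k i := by
  have hc := IsSolution.isCurve hL hσ (ht.1.trans ht.2) hv
  exact IsSolution.fieldCoeff_eq hL hσ hv
    (n := fun t => advCoeff L (fieldCoeff L (v t)) (fieldCoeff L (v t)))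
    (fun t ht => continuous_advect hL hσ (IsSolution.continuous hv ht) (IsSolution.continuous hv ht)
      (hv.memSobolev t ht))
    (fun t ht => fieldCoeff_advect hL hσ (IsSolution.continuous hv ht)
      (IsSolution.continuous hv ht) (hv.memSobolev t ht))
    (hc.continuousOn_advCoeff hL hσ hc) ht k j

/-- The modified equation in Fourier variables. -/
lemma IsModifiedSolution.fieldCoeff_eq (hL : 0 < L) (hσ : 5 / 2 < σ) {u : ℝ → Vec → Vec}
    (hv : IsModifiedSolution L σ T u a v) (huc : ∀ t ∈ Set.Icc 0 T, Continuous (u t))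
    (hu : IsCurve L σ T fun t => fieldCoeff L (u t)) {t : ℝ} (ht : t ∈ Set.Icc 0 T) (k : Freq)
    (j : Fin 3) :
    fieldCoeff L (v t) k j = fieldCoeff L (v 0) k j - ∫ τ in (0 : ℝ)..t, ∑ i, (leray k j i : ℂ) *
      (advCoeff L (fieldCoeff L (u τ)) (fieldCoeff L (v τ)) k i -
        gradDotCoeff L (fieldCoeff L (v τ)) (fieldCoeff L (u τ) - fieldCoeff L (v τ)) k i) := by
  have hc := IsSolution.isCurve hL hσ (ht.1.trans ht.2) hv
  have hvc := fun t ht => IsSolution.continuous hv (t := t) ht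
  have hadv := fun t ht => continuous_advect hL hσ (huc t ht) (hvc t ht) (hv.memSobolev t ht)
  have hgrad := fun t ht => continuous_gradDot hL hσ ((huc t ht).sub (hvc t ht)) (hvc t ht)
    (hv.memSobolev t ht)
  exact IsSolution.fieldCoeff_eq hL hσ hv
    (n := fun t => advCoeff L (fieldCoeff L (u t)) (fieldCoeff L (v t)) -
      gradDotCoeff L (fieldCoeff L (v t)) (fieldCoeff L (u t) - fieldCoeff L (v t)))
    (fun t ht => (hadv t ht).sub (hgrad t ht))
    (fun t ht => by
      rw [fieldCoeff_sub (hadv t ht) (hgrad t ht),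
        fieldCoeff_advect hL hσ (huc t ht) (hvc t ht) (hv.memSobolev t ht),
        fieldCoeff_gradDot hL hσ ((huc t ht).sub (hvc t ht)) (hvc t ht) (hv.memSobolev t ht),
        fieldCoeff_sub (huc t ht) (hvc t ht)])
    (fun k i => (hu.continuousOn_advCoeff hL hσ hc k i).sub
      (hc.continuousOn_gradDotCoeff hL hσ (hu.sub hL hc) k i)) ht k j

end Solution

/-! ### Grönwall's inequality and the bootstrap -/

namespace BddMeasOn

variable {T : ℝ} {y : ℝ → ℝ}

lemma continuousOn_integral (hT : 0 ≤ T) (hy : BddMeasOn T y) :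
    ContinuousOn (fun t => ∫ τ in (0 : ℝ)..t, y τ) (Set.Icc 0 T) := by
  have h := intervalIntegral.continuousOn_primitive_interval (a := 0) (b := T) (f := y)
    (μ := volume) (by rw [Set.uIcc_of_le hT]; exact hy.integrableOn)
  rwa [Set.uIcc_of_le hT] at h

lemma integral_le_integral (hy : BddMeasOn T y) (h0 : ∀ t ∈ Set.Icc 0 T, 0 ≤ y t) {a b : ℝ}
    (ha : 0 ≤ a) (hab : a ≤ b) (hb : b ≤ T) :
    ∫ τ in (0 : ℝ)..a, y τ ≤ ∫ τ in (0 : ℝ)..b, y τ := by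
  refine intervalIntegral.integral_mono_interval le_rfl ha hab ?_
    (hy.intervalIntegrable ⟨le_rfl, ha.trans (hab.trans hb)⟩ ⟨ha.trans hab, hb⟩)
  exact (ae_restrict_iff' measurableSet_Ioc).2
    (Filter.Eventually.of_forall fun τ hτ => h0 τ ⟨hτ.1.le, hτ.2.trans hb⟩)

end BddMeasOn

/-- Grönwall's inequality for bounded measurable functions. The factor `2` in the exponent leaves
the room that makes a continuous induction work without differentiating the integral. -/
lemma le_mul_exp_of_le_add_integral {T A : ℝ} {h y : ℝ → ℝ} (hA : 0 ≤ A)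
    (hh : BddMeasOn T h) (hy : BddMeasOn T y) (hh0 : ∀ t ∈ Set.Icc 0 T, 0 ≤ h t)
    (hy0 : ∀ t ∈ Set.Icc 0 T, 0 ≤ y t)
    (hle : ∀ t ∈ Set.Icc 0 T, y t ≤ A + ∫ τ in (0 : ℝ)..t, h τ * y τ) {t : ℝ}
    (ht : t ∈ Set.Icc 0 T) : y t ≤ A * Real.exp (2 * ∫ τ in (0 : ℝ)..t, h τ) := by
  have hT : 0 ≤ T := ht.1.trans ht.2
  have hhy := hh.mul hy
  have hhy0 : ∀ t ∈ Set.Icc 0 T, 0 ≤ h t * y t := fun t ht => mul_nonneg (hh0 t ht) (hy0 t ht)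
  set W : ℝ → ℝ := fun t => A + ∫ τ in (0 : ℝ)..t, h τ * y τ with hW
  set H : ℝ → ℝ := fun t => ∫ τ in (0 : ℝ)..t, h τ with hH
  have hWc : ContinuousOn W (Set.Icc 0 T) :=
    continuousOn_const.add (hhy.continuousOn_integral hT)
  have hHc : ContinuousOn H (Set.Icc 0 T) := hh.continuousOn_integral hT
  have hEc : ContinuousOn (fun t => A * Real.exp (2 * H t)) (Set.Icc 0 T) :=
    continuousOn_const.mul (Real.continuous_exp.comp_continuousOn (continuousOn_const.mul hHc))
  suffices Set.Icc 0 T ⊆ {t | W t ≤ A * Real.exp (2 * H t)} from (hle t ht).trans (this ht)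
  refine IsClosed.Icc_subset_of_forall_mem_nhdsWithin ?_ ?_ ?_
  · rw [Set.inter_comm]
    exact isClosed_Icc.isClosed_le hWc hEc
  · simp [hW, hH]
  rintro x ⟨hx, hx0, hxT⟩
  have hxI : x ∈ Set.Icc 0 T := ⟨hx0, hxT.le⟩
  have hnear : ∀ᶠ r in nhdsWithin x (Set.Ioi x), H r < H x + 1 / 2 := by
    have h1 : Filter.Tendsto H (nhdsWithin x (Set.Ioc x T)) (nhds (H x)) :=
      (hHc x hxI).mono fun r hr => ⟨hx0.trans hr.1.le, hr.2⟩
    rw [nhdsWithin_Ioc_eq_nhdsGT hxT] at h1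
    exact h1.eventually_lt_const (by linarith)
  have hIoc : ∀ᶠ r in nhdsWithin x (Set.Ioi x), r ∈ Set.Ioc x T := by
    rw [← nhdsWithin_Ioc_eq_nhdsGT hxT]
    exact self_mem_nhdsWithin
  filter_upwards [hnear, hIoc] with r hr hrI
  have hrT : r ∈ Set.Icc 0 T := ⟨hx0.trans hrI.1.le, hrI.2⟩
  have hΔ0 : 0 ≤ H r - H x := sub_nonneg.2 (hh.integral_le_integral hh0 hx0 hrI.1.le hrI.2)
  have h0I : (0 : ℝ) ∈ Set.Icc 0 T := ⟨le_rfl, hT⟩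
  have hWr0 : 0 ≤ W r := by
    have := intervalIntegral.integral_nonneg (μ := volume) (f := fun τ => h τ * y τ) hrT.1
      fun τ hτ => hhy0 τ ⟨hτ.1, hτ.2.trans hrT.2⟩
    simp only [hW]
    linarith
  have hstep : W r - W x ≤ W r * (H r - H x) := by
    have e1 : W r - W x = ∫ τ in x..r, h τ * y τ := by
      simp only [hW]
      rw [add_sub_add_left_eq_sub, intervalIntegral.integral_interval_sub_left
        (hhy.intervalIntegrable h0I hrT) (hhy.intervalIntegrable h0I hxI)]
    have e2 : H r - H x = ∫ τ in x..r, h τ :=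
      intervalIntegral.integral_interval_sub_left
        (hh.intervalIntegrable h0I hrT) (hh.intervalIntegrable h0I hxI)
    rw [e1, e2, ← intervalIntegral.integral_const_mul]
    refine intervalIntegral.integral_mono_on hrI.1.le (hhy.intervalIntegrable hxI hrT)
      ((hh.intervalIntegrable hxI hrT).const_mul _) fun τ hτ => ?_
    have hτI : τ ∈ Set.Icc 0 T := ⟨hx0.trans hτ.1, hτ.2.trans hrT.2⟩
    have hyW : y τ ≤ W r := (hle τ hτI).trans
      (add_le_add le_rfl (hhy.integral_le_integral hhy0 hτI.1 hτ.2 hrT.2))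
    rw [mul_comm (W r)]
    exact mul_le_mul_of_nonneg_left hyW (hh0 τ hτI)
  -- for `0 ≤ x ≤ 1/2`, `1 ≤ (1 - x) (1 + 2x) ≤ (1 - x) e^{2x}`
  have hexp : 1 ≤ (1 - (H r - H x)) * Real.exp (2 * (H r - H x)) := by
    have h1 := Real.add_one_le_exp (2 * (H r - H x))
    have h2 : 0 ≤ 1 - (H r - H x) := by linarith
    nlinarith
  have hx' : W x ≤ A * Real.exp (2 * H x) := hx
  calc W r ≤ W r * ((1 - (H r - H x)) * Real.exp (2 * (H r - H x))) :=
        le_mul_of_one_le_right hWr0 hexp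
    _ = (W r * (1 - (H r - H x))) * Real.exp (2 * (H r - H x)) := by ring
    _ ≤ A * Real.exp (2 * H x) * Real.exp (2 * (H r - H x)) :=
        mul_le_mul_of_nonneg_right (by linarith) (Real.exp_nonneg _)
    _ = A * Real.exp (2 * H r) := by
        rw [mul_assoc, ← Real.exp_add]
        ring_nf

lemma exp_half_le_two : Real.exp (1 / 2) ≤ 2 := by
  have h := Real.exp_bound_div_one_sub_of_interval (x := 1 / 2) (by norm_num) (by norm_num)
  norm_num at h ⊢
  exact h

/-- The bootstrap for the quadratic inequality `y ≤ y₀ + κ ∫ (y + β) y`: for small data the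
exponent `2κ ∫ y` never exceeds `1/2`. -/
lemma integral_le_half_of_quadratic {T κ y₀ B : ℝ} {y β : ℝ → ℝ} (hκ : 0 ≤ κ) (hy₀ : 0 ≤ y₀)
    (hy : BddMeasOn T y) (hβ : BddMeasOn T β) (hy0 : ∀ t ∈ Set.Icc 0 T, 0 ≤ y t)
    (hβ0 : ∀ t ∈ Set.Icc 0 T, 0 ≤ β t)
    (hβB : ∀ t ∈ Set.Icc 0 T, ∫ τ in (0 : ℝ)..t, β τ ≤ B)
    (hle : ∀ t ∈ Set.Icc 0 T, y t ≤ y₀ + ∫ τ in (0 : ℝ)..t, κ * (y τ + β τ) * y τ)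
    (hsmall : 16 * κ * (y₀ * Real.exp (2 * κ * B)) * T ≤ 1) {t : ℝ} (ht : t ∈ Set.Icc 0 T) :
    2 * κ * ∫ τ in (0 : ℝ)..t, y τ ≤ 1 / 2 ∧ y t ≤ 2 * (y₀ * Real.exp (2 * κ * B)) := by
  have hT : 0 ≤ T := ht.1.trans ht.2
  set P := y₀ * Real.exp (2 * κ * B) with hP
  have hP0 : 0 ≤ P := by positivity
  set J : ℝ → ℝ := fun t => 2 * κ * ∫ τ in (0 : ℝ)..t, y τ with hJ
  have hJc : ContinuousOn J (Set.Icc 0 T) := continuousOn_const.mul (hy.continuousOn_integral hT)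
  have h0I : (0 : ℝ) ∈ Set.Icc 0 T := ⟨le_rfl, hT⟩
  have hJmono : ∀ r x, 0 ≤ r → r ≤ x → x ≤ T → J r ≤ J x := fun r x hr hrx hx =>
    mul_le_mul_of_nonneg_left (hy.integral_le_integral hy0 hr hrx hx) (by positivity)
  have hyJ : ∀ t ∈ Set.Icc 0 T, y t ≤ P * Real.exp (J t) := fun t ht => by
    have hyβ := (hy.add hβ).const_mul κ
    have h := le_mul_exp_of_le_add_integral hy₀ hyβ hy
      (fun t ht => mul_nonneg hκ (add_nonneg (hy0 t ht) (hβ0 t ht))) hy0 hle ht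
    refine h.trans ?_
    rw [hP, mul_assoc, ← Real.exp_add]
    gcongr
    rw [intervalIntegral.integral_const_mul, intervalIntegral.integral_add
      (hy.intervalIntegrable h0I ht) (hβ.intervalIntegrable h0I ht)]
    simp only [hJ]
    have := mul_le_mul_of_nonneg_left (hβB t ht) (by positivity : 0 ≤ 2 * κ)
    linarith
  have hy2 : ∀ x ∈ Set.Icc 0 T, J x ≤ 1 / 2 → y x ≤ 2 * P := fun x hx hJx => by
    refine (hyJ x hx).trans ?_
    rw [mul_comm 2 P]
    gcongr
    exact (Real.exp_le_exp.2 hJx).trans exp_half_le_two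
  -- the bound `1/2` improves itself to `1/4`, so it cannot be reached
  have himprove : ∀ x ∈ Set.Icc 0 T, J x ≤ 1 / 2 → J x ≤ 1 / 4 := fun x hx hJx => by
    have h1 : ∫ τ in (0 : ℝ)..x, y τ ≤ ∫ _τ in (0 : ℝ)..x, 2 * P :=
      intervalIntegral.integral_mono_on hx.1 (hy.intervalIntegrable h0I hx)
        intervalIntegrable_const fun τ hτ => hy2 τ ⟨hτ.1, hτ.2.trans hx.2⟩
          ((hJmono τ x hτ.1 hτ.2 hx.2).trans hJx)
    rw [intervalIntegral.integral_const, sub_zero, smul_eq_mul] at h1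
    calc J x ≤ 2 * κ * (x * (2 * P)) := mul_le_mul_of_nonneg_left h1 (by positivity)
      _ ≤ 2 * κ * (T * (2 * P)) := by
          gcongr
          exact hx.2
      _ ≤ 1 / 4 := by linarith
  have hall : Set.Icc 0 T ⊆ {t | J t ≤ 1 / 2} := by
    refine IsClosed.Icc_subset_of_forall_mem_nhdsWithin ?_ ?_ ?_
    · rw [Set.inter_comm]
      exact isClosed_Icc.isClosed_le hJc continuousOn_const
    · simp [hJ]
    rintro x ⟨hx, hx0, hxT⟩
    have hxI : x ∈ Set.Icc 0 T := ⟨hx0, hxT.le⟩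
    have h1 : Filter.Tendsto J (nhdsWithin x (Set.Ioc x T)) (nhds (J x)) :=
      (hJc x hxI).mono fun r hr => ⟨hx0.trans hr.1.le, hr.2⟩
    rw [nhdsWithin_Ioc_eq_nhdsGT hxT] at h1
    have h2 := himprove x hxI hx
    filter_upwards [h1.eventually_lt_const (by linarith : J x < 1 / 2)] with r hr using hr.le
  exact ⟨hall ht, hy2 t ht (hall ht)⟩

/-- The two integral inequalities satisfied by `y = ‖u - ū‖`, `Y = ‖ū* - ū‖`, and the bound that
they imply. -/
lemma le_of_integral_inequalities {T κ y₀ B S : ℝ} {y Y β : ℝ → ℝ} (hκ : 0 ≤ κ)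
    (hy₀ : 0 ≤ y₀) (hS : 0 ≤ S) (hy : BddMeasOn T y) (hY : BddMeasOn T Y) (hβ : BddMeasOn T β)
    (hy0 : ∀ t ∈ Set.Icc 0 T, 0 ≤ y t) (hY0 : ∀ t ∈ Set.Icc 0 T, 0 ≤ Y t)
    (hβ0 : ∀ t ∈ Set.Icc 0 T, 0 ≤ β t)
    (hβB : ∀ t ∈ Set.Icc 0 T, ∫ τ in (0 : ℝ)..t, β τ ≤ B)
    (hle : ∀ t ∈ Set.Icc 0 T, y t ≤ y₀ + ∫ τ in (0 : ℝ)..t, κ * (y τ + β τ) * y τ)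
    (hle' : ∀ t ∈ Set.Icc 0 T, Y t ≤
      ∫ τ in (0 : ℝ)..t, (κ * (y τ + β τ) * Y τ + κ * S * y τ))
    (hsmall : 16 * κ * (y₀ * Real.exp (2 * κ * B)) * T ≤ 1) {t : ℝ} (ht : t ∈ Set.Icc 0 T) :
    Y t ≤ 4 * κ * S * T * y₀ * Real.exp (4 * κ * B) := by
  have hT : 0 ≤ T := ht.1.trans ht.2
  have h0I : (0 : ℝ) ∈ Set.Icc 0 T := ⟨le_rfl, hT⟩
  have hTI : T ∈ Set.Icc 0 T := ⟨hT, le_rfl⟩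
  have hboot := fun t ht =>
    integral_le_half_of_quadratic hκ hy₀ hy hβ hy0 hβ0 hβB hle hsmall (t := t) ht
  set P := y₀ * Real.exp (2 * κ * B) with hP
  have hP0 : 0 ≤ P := by positivity
  have hyβ := (hy.add hβ).const_mul κ
  have hyβ0 : ∀ t ∈ Set.Icc 0 T, 0 ≤ κ * (y t + β t) := fun t ht =>
    mul_nonneg hκ (add_nonneg (hy0 t ht) (hβ0 t ht))
  have hsrc : ∀ t ∈ Set.Icc 0 T, ∫ τ in (0 : ℝ)..t, κ * S * y τ ≤ 2 * κ * S * T * P :=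
    fun t ht => by
      have h1 : ∫ τ in (0 : ℝ)..t, y τ ≤ ∫ _τ in (0 : ℝ)..t, 2 * P :=
        intervalIntegral.integral_mono_on ht.1 (hy.intervalIntegrable h0I ht)
          intervalIntegrable_const fun τ hτ => (hboot τ ⟨hτ.1, hτ.2.trans ht.2⟩).2
      rw [intervalIntegral.integral_const, sub_zero, smul_eq_mul] at h1
      rw [intervalIntegral.integral_const_mul]
      calc κ * S * ∫ τ in (0 : ℝ)..t, y τ ≤ κ * S * (T * (2 * P)) := by
            have := ht.2
            gcongr
            exact h1.trans (by gcongr)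
        _ = _ := by ring
  have hgr : ∀ t ∈ Set.Icc 0 T,
      Y t ≤ 2 * κ * S * T * P + ∫ τ in (0 : ℝ)..t, κ * (y τ + β τ) * Y τ := fun t ht => by
    have h1 := hle' t ht
    rw [intervalIntegral.integral_add ((hyβ.mul hY).intervalIntegrable h0I ht)
      ((hy.const_mul _).intervalIntegrable h0I ht)] at h1
    linarith [hsrc t ht]
  have h := le_mul_exp_of_le_add_integral (by positivity) hyβ hY hyβ0 hY0 hgr ht
  have hexp : Real.exp (2 * ∫ τ in (0 : ℝ)..t, κ * (y τ + β τ)) ≤ 2 * Real.exp (2 * κ * B) := by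
    rw [intervalIntegral.integral_const_mul, intervalIntegral.integral_add
      (hy.intervalIntegrable h0I ht) (hβ.intervalIntegrable h0I ht)]
    have h1 := (hboot t ht).1
    have h2 := mul_le_mul_of_nonneg_left (hβB t ht) (by positivity : 0 ≤ 2 * κ)
    calc _ ≤ Real.exp (1 / 2 + 2 * κ * B) := Real.exp_le_exp.2 (by linarith)
      _ ≤ _ := by
          rw [Real.exp_add]
          gcongr
          exact exp_half_le_two
  calc Y t ≤ 2 * κ * S * T * P * (2 * Real.exp (2 * κ * B)) :=
        h.trans (mul_le_mul_of_nonneg_left hexp (by positivity))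
    _ = _ := by
        rw [hP, show 4 * κ * B = 2 * κ * B + 2 * κ * B by ring, Real.exp_add]
        ring

/-! ### Stability estimates for the two systems -/

/-- `c` solves `∂ₜc + n + ∇p = 0` mode by mode, in integrated form. -/
def SolvesModes (T : ℝ) (c n : ℝ → Coeffs) : Prop :=
  ∀ t ∈ Set.Icc 0 T, ∀ k j, c t k j = c 0 k j -
    ∫ τ in (0 : ℝ)..t, ∑ i, (leray k j i : ℂ) * n τ k i

lemma SolvesModes.mono_time {T T' : ℝ} {c n : ℝ → Coeffs} (h : SolvesModes T' c n) (hT : T ≤ T') :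
    SolvesModes T c n := fun t ht => h t ⟨ht.1, ht.2.trans hT⟩

/-- The difference of two solutions; the nonlinear term matters only up to gradients. -/
lemma SolvesModes.sub {T : ℝ} {c₁ c₂ n₁ n₂ n : ℝ → Coeffs} (h₁ : SolvesModes T c₁ n₁)
    (h₂ : SolvesModes T c₂ n₂) (hn₁ : ∀ k i, ContinuousOn (fun t => n₁ t k i) (Set.Icc 0 T))
    (hn₂ : ∀ k i, ContinuousOn (fun t => n₂ t k i) (Set.Icc 0 T))
    (hn : ∀ t ∈ Set.Icc 0 T, ∀ k, ∃ q : ℂ, ∀ i, n₁ t k i - n₂ t k i = n t k i + (k i : ℂ) * q) :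
    SolvesModes T (fun t => c₁ t - c₂ t) n := by
  intro t ht k j
  have hsub : Set.uIcc 0 t ⊆ Set.Icc 0 T :=
    Set.uIcc_subset_Icc ⟨le_rfl, ht.1.trans ht.2⟩ ht
  have hint : ∀ m : ℝ → Coeffs, (∀ k i, ContinuousOn (fun t => m t k i) (Set.Icc 0 T)) →
      IntervalIntegrable (fun τ => ∑ i, (leray k j i : ℂ) * m τ k i) volume 0 t := fun m hm =>
    (ContinuousOn.mono (continuousOn_finsetSum _ fun i _ =>
      continuousOn_const.mul (hm k i)) hsub).intervalIntegrable
  have e : ∫ τ in (0 : ℝ)..t, ∑ i, (leray k j i : ℂ) * n τ k i =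
      (∫ τ in (0 : ℝ)..t, ∑ i, (leray k j i : ℂ) * n₁ τ k i) -
        ∫ τ in (0 : ℝ)..t, ∑ i, (leray k j i : ℂ) * n₂ τ k i := by
    rw [← intervalIntegral.integral_sub (hint n₁ hn₁) (hint n₂ hn₂)]
    refine intervalIntegral.integral_congr fun τ hτ => ?_
    obtain ⟨q, hq⟩ := hn τ (hsub hτ) k
    rw [← Finset.sum_sub_distrib, ← add_zero (∑ i, (leray k j i : ℂ) * n τ k i),
      ← sum_leray_mul_freq k q j, ← Finset.sum_add_distrib]
    refine Finset.sum_congr rfl fun i _ => ?_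
    rw [← mul_sub, hq, mul_add]
  simp only [Pi.sub_apply]
  rw [e, h₁ t ht, h₂ t ht]
  ring

lemma continuousOn_leray_sum {T : ℝ} {n : ℝ → Coeffs}
    (hn : ∀ k i, ContinuousOn (fun t => n t k i) (Set.Icc 0 T)) (k : Freq) (j : Fin 3) :
    ContinuousOn (fun τ => ∑ i, (leray k j i : ℂ) * n τ k i) (Set.Icc 0 T) :=
  continuousOn_finsetSum _ fun i _ => continuousOn_const.mul (hn k i)

lemma hterm_neg (L σ : ℝ) (a : Coeffs) : hterm L σ (-a) = hterm L σ a := by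
  funext k
  simp [hterm]

/-- The triangle inequality `‖a‖ ≲ ‖a - b‖ + ‖b‖`. -/
lemma InSobolev.hnorm_le_of_sub {L σ : ℝ} (hL : 0 < L) {a b : Coeffs} (ha : InSobolev L σ a)
    (hb : InSobolev L σ b) : hnorm L σ a ≤ 2 * (hnorm L σ (a - b) + hnorm L σ b) := by
  have hb' : InSobolev L σ (-b) := by rw [InSobolev, hterm_neg]; exact hb
  have h := (ha.sub hL hb).hnorm_sub_le hL hb'
  rwa [sub_neg_eq_add, sub_add_cancel, show hnorm L σ (-b) = hnorm L σ b by
    rw [hnorm, hnorm, hterm_neg]] at h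

lemma norm_le_of_forall_norm_le {z : Fin 3 → ℂ} {B : ℝ} (h : ∀ i, ‖z i‖ ≤ B) : ‖z‖ ≤ B :=
  (pi_norm_le_iff_of_nonneg ((norm_nonneg _).trans (h 0))).2 h

/-- The difference `e = u - b` of two Euler solutions satisfies
`∂ₜe + u · ∇e + e · ∇b + ∇p = 0`, which loses one derivative of `b` and none of `e`. -/
lemma exists_euler_stability {L σ : ℝ} (hL : 0 < L) (hσ : 5 / 2 < σ) :
    ∃ K : ℝ, 0 ≤ K ∧ ∀ (T : ℝ) (u b : ℝ → Coeffs), IsCurve L σ T u → IsCurve L (σ + 1) T b →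
      SolvesModes T u (fun t => advCoeff L (u t) (u t)) →
      SolvesModes T b (fun t => advCoeff L (b t) (b t)) →
      ∀ t ∈ Set.Icc 0 T, hnorm L σ (u t - b t) ≤ hnorm L σ (u 0 - b 0) +
        ∫ τ in (0 : ℝ)..t, K * (hnorm L σ (u τ - b τ) + hnorm L (σ + 1) (b τ)) *
          hnorm L σ (u τ - b τ) := by
  obtain ⟨K₁, hK₁, henergy⟩ := exists_energy_estimate hL hσ
  obtain ⟨K₂, hK₂, hprod⟩ := exists_sum_mul_gradConv_le (σ := σ) hL (by linarith)
  refine ⟨K₁ * (2 + 3 * K₂), by positivity, ?_⟩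
  intro T u b hu hb hsu hsb t ht
  have hT : 0 ≤ T := ht.1.trans ht.2
  have h0I : (0 : ℝ) ∈ Set.Icc 0 T := ⟨le_rfl, hT⟩
  have hb' := hb.mono hL (by linarith : σ ≤ σ + 1)
  have he := hu.sub hL hb'
  obtain ⟨M, hM⟩ := he.bdd
  have hse : SolvesModes T (fun t => u t - b t)
      (fun t => advCoeff L (u t) (u t - b t) + advCoeff L (u t - b t) (b t)) := by
    refine hsu.sub hsb (hu.continuousOn_advCoeff hL hσ hu) (hb'.continuousOn_advCoeff hL hσ hb')
      fun τ hτ k => ⟨0, fun i => ?_⟩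
    rw [advCoeff_sub_right hL hσ (hu.mem τ hτ) (hu.mem τ hτ) (hb'.mem τ hτ),
      advCoeff_sub_left hL hσ (hu.mem τ hτ) (hb'.mem τ hτ) (hb'.mem τ hτ)]
    simp
  set Φ : ℝ → ℝ := fun τ => 3 * K₂ * (hnorm L σ (u τ - b τ) * hnorm L (σ + 1) (b τ)) with hΦ
  have hmΦ : BddMeasOn T Φ := (he.bddMeasOn_hnorm.mul hb.bddMeasOn_hnorm).const_mul _
  have hmg : BddMeasOn T fun τ => hnorm L σ (u τ) * hnorm L σ (u τ - b τ) + Φ τ :=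
    (hu.bddMeasOn_hnorm.mul he.bddMeasOn_hnorm).add hmΦ
  have hn : ∀ a τ, 0 ≤ hnorm L a (u τ - b τ) := fun a τ => hnorm_nonneg _ _ _
  have hnb : ∀ a τ, 0 ≤ hnorm L a (b τ) := fun a τ => hnorm_nonneg _ _ _
  have h := henergy T M (fun τ => u τ - b τ) u (fun τ => advCoeff L (u τ - b τ) (b τ)) Φ he.mem hM
    he.div_free hu.mem hu.div_free hu.real
    (fun τ _ => by have := hn σ τ; have := hnb (σ + 1) τ; positivity)
    (fun τ hτ z S Z hz hZ hzZ => by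
      refine le_trans (Finset.sum_le_sum (g := fun k =>
        3 * (z k * (weight L k ^ σ * gradConv L (u τ - b τ) (b τ) k))) fun k _ => ?_) ?_
      · have h1 : ‖advCoeff L (u τ - b τ) (b τ) k‖ ≤ 3 * gradConv L (u τ - b τ) (b τ) k :=
          norm_le_of_forall_norm_le fun i =>
            norm_advCoeff_le hL hσ (he.mem τ hτ) (hb'.mem τ hτ) k i
        have h2 := Real.rpow_nonneg (weight_nonneg L k) σ
        have h3 := hz k
        calc _ ≤ z k * (weight L k ^ σ * (3 * gradConv L (u τ - b τ) (b τ) k)) := by gcongr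
          _ = _ := by ring
      · rw [← Finset.mul_sum]
        have h1 := hprod (u τ - b τ) (b τ) z S Z (he.mem τ hτ) (hb.mem τ hτ) hz hZ hzZ
        calc _ ≤ 3 * (K₂ * Z * hnorm L σ (u τ - b τ) * hnorm L (σ + 1) (b τ)) := by gcongr
          _ = _ := by simp only [hΦ]; ring)
    (continuousOn_leray_sum fun k i => (hu.continuousOn_advCoeff hL hσ he k i).add
      (he.continuousOn_advCoeff hL hσ hb' k i))
    hse (hmg.intervalIntegrable h0I ⟨hT, le_rfl⟩) t ht
  refine h.trans (add_le_add le_rfl ?_)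
  refine intervalIntegral.integral_mono_on ht.1 ((hmg.const_mul K₁).intervalIntegrable h0I ht)
    ((((he.bddMeasOn_hnorm.add hb.bddMeasOn_hnorm).const_mul _).mul
      he.bddMeasOn_hnorm).intervalIntegrable h0I ht) fun τ hτ => ?_
  have hτT : τ ∈ Set.Icc 0 T := ⟨hτ.1, hτ.2.trans ht.2⟩
  have h1 := (hu.mem τ hτT).hnorm_le_of_sub hL (hb'.mem τ hτT)
  have h2 := (hb.mem τ hτT).hnorm_mono hL (by linarith : σ ≤ σ + 1)
  have h3 := hn σ τ
  have h4 := hnb (σ + 1) τ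
  have h5 : 0 ≤ K₂ * hnorm L σ (u τ - b τ) * hnorm L σ (u τ - b τ) := by positivity
  calc K₁ * (hnorm L σ (u τ) * hnorm L σ (u τ - b τ) + Φ τ)
      ≤ K₁ * (2 * (hnorm L σ (u τ - b τ) + hnorm L (σ + 1) (b τ)) * hnorm L σ (u τ - b τ) +
        (Φ τ + 3 * (K₂ * hnorm L σ (u τ - b τ) * hnorm L σ (u τ - b τ)))) := by
        gcongr
        · linarith
        · linarith
    _ = _ := by simp only [hΦ]; ring

/-- With `e = u - b`, the difference `d = w - b` satisfies
`∂ₜd + u · ∇d + e · ∇b - ∇b · e + ∇b · d + ∇e · d + ∇p = 0`: the terms `∇d · e` and `∇d · d`, which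
would lose a derivative of `d`, are gradients up to `-∇e · d`. -/
lemma exists_modified_stability {L σ : ℝ} (hL : 0 < L) (hσ : 5 / 2 < σ) :
    ∃ K : ℝ, 0 ≤ K ∧ ∀ (T : ℝ) (u b w : ℝ → Coeffs), IsCurve L (σ + 1) T u →
      IsCurve L (σ + 1) T b → IsCurve L σ T w →
      SolvesModes T w (fun t => advCoeff L (u t) (w t) - gradDotCoeff L (w t) (u t - w t)) →
      SolvesModes T b (fun t => advCoeff L (b t) (b t)) →
      ∀ t ∈ Set.Icc 0 T, hnorm L σ (w t - b t) ≤ hnorm L σ (w 0 - b 0) +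
        ∫ τ in (0 : ℝ)..t, (K * (hnorm L (σ + 1) (u τ - b τ) + hnorm L (σ + 1) (b τ)) *
          hnorm L σ (w τ - b τ) + K * hnorm L (σ + 1) (b τ) * hnorm L (σ + 1) (u τ - b τ)) := by
  obtain ⟨K₁, hK₁, henergy⟩ := exists_energy_estimate hL hσ
  obtain ⟨K₂, hK₂, hprod⟩ := exists_sum_mul_gradConv_le (σ := σ) hL (by linarith)
  refine ⟨K₁ * (2 + 6 * K₂), by positivity, ?_⟩
  intro T u b w hu hb hw hsw hsb t ht
  have hT : 0 ≤ T := ht.1.trans ht.2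
  have h0I : (0 : ℝ) ∈ Set.Icc 0 T := ⟨le_rfl, hT⟩
  have hσ1 : σ ≤ σ + 1 := by linarith
  have hu' := hu.mono hL hσ1
  have hb' := hb.mono hL hσ1
  have he := hu.sub hL hb
  have he' := he.mono hL hσ1
  have hd := hw.sub hL hb'
  obtain ⟨M, hM⟩ := hd.bdd
  set F : ℝ → Coeffs := fun t => advCoeff L (u t - b t) (b t) -
    gradDotCoeff L (b t) (u t - b t) + gradDotCoeff L (b t) (w t - b t) +
    gradDotCoeff L (u t - b t) (w t - b t) with hF
  have hsd : SolvesModes T (fun t => w t - b t)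
      (fun t => advCoeff L (u t) (w t - b t) + F t) := by
    refine hsw.sub hsb (fun k i => (hu'.continuousOn_advCoeff hL hσ hw k i).sub
      (hw.continuousOn_gradDotCoeff hL hσ (hu'.sub hL hw) k i))
      (hb'.continuousOn_advCoeff hL hσ hb') fun τ hτ k => ?_
    have mu := hu'.mem τ hτ
    have mb := hb'.mem τ hτ
    have mw := hw.mem τ hτ
    have me := he'.mem τ hτ
    have md := hd.mem τ hτ
    obtain ⟨q₁, hq₁⟩ := exists_gradDotCoeff_add hL hσ me md k
    obtain ⟨q₂, hq₂⟩ := exists_gradDotCoeff_add hL hσ md md k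
    refine ⟨q₂ / 2 - q₁, fun i => ?_⟩
    have e1 := congrFun (congrFun (advCoeff_sub_right hL hσ mu mw mb) k) i
    have e2 := congrFun (congrFun (advCoeff_sub_left hL hσ mu mb mb) k) i
    -- `∇w · (u - w) = ∇w · e - ∇w · d` and `w = b + d`; the gradients are `∇(d · e)` and `∇|d|² / 2`
    have e3 : u τ - w τ = (u τ - b τ) - (w τ - b τ) := by abel
    have e4 := congrFun (congrFun (gradDotCoeff_sub_right hL hσ mw me md) k) i
    have e5 := congrFun (congrFun (gradDotCoeff_sub_left hL hσ mw mb me) k) i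
    have e6 := congrFun (congrFun (gradDotCoeff_sub_left hL hσ mw mb md) k) i
    have e7 := hq₁ i
    have e8 := hq₂ i
    simp only [Pi.sub_apply, Pi.add_apply, hF] at e1 e2 e4 e5 e6 e7 e8 ⊢
    rw [e3, e4]
    linear_combination -e1 - e2 + e5 - e6 - e7 + e8 / 2
  set Φ : ℝ → ℝ := fun τ => 3 * K₂ *
    (2 * (hnorm L σ (u τ - b τ) * hnorm L (σ + 1) (b τ)) +
      hnorm L σ (w τ - b τ) * (hnorm L (σ + 1) (b τ) + hnorm L (σ + 1) (u τ - b τ))) with hΦ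
  have hmΦ : BddMeasOn T Φ := (((he'.bddMeasOn_hnorm.mul hb.bddMeasOn_hnorm).const_mul 2).add
    (hd.bddMeasOn_hnorm.mul (hb.bddMeasOn_hnorm.add he.bddMeasOn_hnorm))).const_mul _
  have hmg : BddMeasOn T fun τ => hnorm L σ (u τ) * hnorm L σ (w τ - b τ) + Φ τ :=
    (hu'.bddMeasOn_hnorm.mul hd.bddMeasOn_hnorm).add hmΦ
  have hne : ∀ a τ, 0 ≤ hnorm L a (u τ - b τ) := fun a τ => hnorm_nonneg _ _ _
  have hnd : ∀ a τ, 0 ≤ hnorm L a (w τ - b τ) := fun a τ => hnorm_nonneg _ _ _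
  have hnb : ∀ a τ, 0 ≤ hnorm L a (b τ) := fun a τ => hnorm_nonneg _ _ _
  have hnF : ∀ τ ∈ Set.Icc 0 T, ∀ k, ‖F τ k‖ ≤
      3 * (2 * gradConv L (u τ - b τ) (b τ) k + gradConv L (w τ - b τ) (b τ) k +
        gradConv L (w τ - b τ) (u τ - b τ) k) := fun τ hτ k =>
    norm_le_of_forall_norm_le fun i => by
      have mb := hb'.mem τ hτ
      have me := he'.mem τ hτ
      have md := hd.mem τ hτ
      have h1 := norm_advCoeff_le hL hσ me mb k i
      have h2 := norm_gradDotCoeff_le hL hσ mb me k i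
      have h3 := norm_gradDotCoeff_le hL hσ mb md k i
      have h4 := norm_gradDotCoeff_le hL hσ me md k i
      simp only [hF, Pi.add_apply, Pi.sub_apply]
      refine (norm_add_le _ _).trans ?_
      refine (add_le_add_left (norm_add_le _ _) _).trans ?_
      have h5 := norm_sub_le (advCoeff L (u τ - b τ) (b τ) k i)
        (gradDotCoeff L (b τ) (u τ - b τ) k i)
      linarith
  have h := henergy T M (fun τ => w τ - b τ) u F Φ hd.mem hM
    hd.div_free hu'.mem hu.div_free hu.real
    (fun τ _ => by
      have := hne σ τ; have := hnb (σ + 1) τ; have := hnd σ τ; have := hne (σ + 1) τ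
      positivity)
    (fun τ hτ z S Z hz hZ hzZ => by
      have h1 := hprod (u τ - b τ) (b τ) z S Z (he'.mem τ hτ) (hb.mem τ hτ) hz hZ hzZ
      have h2 := hprod (w τ - b τ) (b τ) z S Z (hd.mem τ hτ) (hb.mem τ hτ) hz hZ hzZ
      have h3 := hprod (w τ - b τ) (u τ - b τ) z S Z (hd.mem τ hτ) (he.mem τ hτ) hz hZ hzZ
      calc ∑ k ∈ S, z k * (weight L k ^ σ * ‖F τ k‖)
          ≤ ∑ k ∈ S, z k * (weight L k ^ σ * (3 * (2 * gradConv L (u τ - b τ) (b τ) k +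
              gradConv L (w τ - b τ) (b τ) k + gradConv L (w τ - b τ) (u τ - b τ) k))) := by
            refine Finset.sum_le_sum fun k _ => ?_
            have h4 := Real.rpow_nonneg (weight_nonneg L k) σ
            have h5 := hz k
            have h6 := hnF τ hτ k
            gcongr
        _ = 3 * (2 * ∑ k ∈ S, z k * (weight L k ^ σ * gradConv L (u τ - b τ) (b τ) k) +
              ∑ k ∈ S, z k * (weight L k ^ σ * gradConv L (w τ - b τ) (b τ) k) +
              ∑ k ∈ S, z k * (weight L k ^ σ * gradConv L (w τ - b τ) (u τ - b τ) k)) := by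
            rw [Finset.mul_sum, ← Finset.sum_add_distrib, ← Finset.sum_add_distrib,
              Finset.mul_sum]
            exact Finset.sum_congr rfl fun k _ => by ring
        _ ≤ 3 * (2 * (K₂ * Z * hnorm L σ (u τ - b τ) * hnorm L (σ + 1) (b τ)) +
              K₂ * Z * hnorm L σ (w τ - b τ) * hnorm L (σ + 1) (b τ) +
              K₂ * Z * hnorm L σ (w τ - b τ) * hnorm L (σ + 1) (u τ - b τ)) := by gcongr
        _ = Z * Φ τ := by simp only [hΦ]; ring)
    (continuousOn_leray_sum fun k i => (hu'.continuousOn_advCoeff hL hσ hd k i).add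
      ((((he'.continuousOn_advCoeff hL hσ hb' k i).sub
        (hb'.continuousOn_gradDotCoeff hL hσ he' k i)).add
        (hb'.continuousOn_gradDotCoeff hL hσ hd k i)).add
        (he'.continuousOn_gradDotCoeff hL hσ hd k i)))
    hsd (hmg.intervalIntegrable h0I ⟨hT, le_rfl⟩) t ht
  refine h.trans (add_le_add le_rfl ?_)
  refine intervalIntegral.integral_mono_on ht.1 ((hmg.const_mul K₁).intervalIntegrable h0I ht)
    (((((he.bddMeasOn_hnorm.add hb.bddMeasOn_hnorm).const_mul _).mul hd.bddMeasOn_hnorm).add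
      ((hb.bddMeasOn_hnorm.const_mul _).mul he.bddMeasOn_hnorm)).intervalIntegrable h0I ht)
    fun τ hτ => ?_
  have hτT : τ ∈ Set.Icc 0 T := ⟨hτ.1, hτ.2.trans ht.2⟩
  have h1 := (hu.mem τ hτT).hnorm_le_of_sub hL (hb.mem τ hτT)
  have h2 := (hu.mem τ hτT).hnorm_mono hL hσ1
  have h3 := (he.mem τ hτT).hnorm_mono hL hσ1
  have h4 := hne σ τ
  have h5 := hne (σ + 1) τ
  have h6 := hnb (σ + 1) τ
  have h7 := hnd σ τ
  calc K₁ * (hnorm L σ (u τ) * hnorm L σ (w τ - b τ) + Φ τ)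
      ≤ K₁ * (2 * (hnorm L (σ + 1) (u τ - b τ) + hnorm L (σ + 1) (b τ)) * hnorm L σ (w τ - b τ) +
        3 * K₂ * (2 * (hnorm L (σ + 1) (u τ - b τ) * hnorm L (σ + 1) (b τ)) +
          hnorm L σ (w τ - b τ) * (hnorm L (σ + 1) (b τ) + hnorm L (σ + 1) (u τ - b τ)))) := by
        have h8 : hnorm L σ (u τ) ≤ 2 * (hnorm L (σ + 1) (u τ - b τ) + hnorm L (σ + 1) (b τ)) :=
          h2.trans h1
        have h9 : Φ τ ≤ 3 * K₂ * (2 * (hnorm L (σ + 1) (u τ - b τ) * hnorm L (σ + 1) (b τ)) +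
          hnorm L σ (w τ - b τ) * (hnorm L (σ + 1) (b τ) + hnorm L (σ + 1) (u τ - b τ))) := by
          simp only [hΦ]
          gcongr
        gcongr
    _ ≤ _ := by
        have h8 : 0 ≤ K₁ * K₂ * (hnorm L σ (w τ - b τ) *
          (hnorm L (σ + 1) (b τ) + hnorm L (σ + 1) (u τ - b τ))) := by positivity
        have h9 : 0 ≤ K₁ * (hnorm L (σ + 1) (u τ - b τ) * hnorm L (σ + 1) (b τ)) := by positivity
        linarith

end

end EulerTorus

theorem proposition2p2 (L s : ℝ) (hL : 0 < L) (hs : 5 / 2 < s) :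
    ∃ C : ℝ, 0 < C ∧
      ∀ (Tbar T ε : ℝ) (ubar₀ utilde₀ : Vec → Vec) (ubar u ustar : ℝ → Vec → Vec),
        0 < T → T ≤ Tbar → 0 < ε →
        MemSobolev L (s + 2) ubar₀ →
        MemSobolev L (s + 1) utilde₀ →
        IsEulerSolution L (s + 2) Tbar ubar₀ ubar →
        IsEulerSolution L (s + 1) T (ubar₀ + ε • utilde₀) u →
        IsModifiedSolution L s T u ubar₀ ustar →
        -- the smallness condition on `ε`, with its denominator cleared
        ε * (C * sobolevNorm L (s + 1) utilde₀ * Tbar) ≤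
          Real.exp (-(C * ∫ τ in (0 : ℝ)..Tbar, sobolevNorm L (s + 2) (ubar τ))) →
        ∀ t ∈ Set.Icc 0 T,
          sobolevNorm L s (ustar t - ubar t) ≤
            ε * sobolevNorm L (s + 1) utilde₀ * C * Tbar *
              (⨆ τ : Set.Icc (0 : ℝ) Tbar, sobolevNorm L (s + 1) (ubar τ)) *
              Real.exp (C * ∫ τ in (0 : ℝ)..Tbar, (1 + sobolevNorm L (s + 2) (ubar τ))) := by
  obtain ⟨K₁, hK₁, hA⟩ := exists_euler_stability (σ := s + 1) hL (by linarith)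
  obtain ⟨K₂, hK₂, hB⟩ := exists_modified_stability hL hs
  set κ := K₁ + K₂ with hκ
  have hκ0 : 0 ≤ κ := by positivity
  -- the smallness condition has to dominate `16 κ y₀ e^{2κB} T ≤ 1` of the bootstrap
  refine ⟨16 * κ + 1, by positivity, ?_⟩
  intro Tbar T ε ubar₀ utilde₀ ubar u ustar hT hTT hε _ _ hbar hu hstar hsmall t ht
  set C := 16 * κ + 1 with hC
  have hs12 : s + 1 + 1 = s + 2 := by ring
  rw [hs12] at hA
  have hTb : 0 ≤ Tbar := hT.le.trans hTT
  have h0I : (0 : ℝ) ∈ Set.Icc 0 T := ⟨le_rfl, hT.le⟩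
  have hsubI : ∀ τ ∈ Set.Icc 0 T, τ ∈ Set.Icc 0 Tbar := fun τ hτ => ⟨hτ.1, hτ.2.trans hTT⟩
  set b : ℝ → Coeffs := fun t => fieldCoeff L (ubar t) with hb
  set v : ℝ → Coeffs := fun t => fieldCoeff L (u t) with hv
  set w : ℝ → Coeffs := fun t => fieldCoeff L (ustar t) with hw
  have cbar : IsCurve L (s + 2) Tbar b := IsSolution.isCurve hL (by linarith) hTb hbar
  have cb : IsCurve L (s + 2) T b := cbar.mono_time hTT
  have cb1 : IsCurve L (s + 1) T b := cb.mono hL (by linarith)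
  have cv : IsCurve L (s + 1) T v := IsSolution.isCurve hL (by linarith) hT.le hu
  have cw : IsCurve L s T w := IsSolution.isCurve hL hs hT.le hstar
  have sb : SolvesModes T b fun t => advCoeff L (b t) (b t) :=
    SolvesModes.mono_time (fun t ht k j => hbar.fieldCoeff_eq hL (by linarith) ht k j) hTT
  have sv : SolvesModes T v fun t => advCoeff L (v t) (v t) :=
    fun t ht k j => hu.fieldCoeff_eq hL (by linarith) ht k j
  have sw : SolvesModes T w fun t => advCoeff L (v t) (w t) - gradDotCoeff L (w t) (v t - w t) :=
    fun t ht k j => hstar.fieldCoeff_eq hL hs (fun t ht => IsSolution.continuous hu ht)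
      (cv.mono hL (by linarith)) ht k j
  -- the initial data of the two differences
  have hinit : hnorm L (s + 1) (v 0 - b 0) = ε * sobolevNorm L (s + 1) utilde₀ := by
    have hub0 : ubar 0 = ubar₀ := hbar.initial
    have hu0 : u 0 = ubar₀ + ε • utilde₀ := hu.initial
    have e : u 0 - ubar 0 = ε • utilde₀ := by rw [hub0, hu0, add_sub_cancel_left]
    simp only [hv, hb]
    rw [← fieldCoeff_sub (IsSolution.continuous hu h0I)
      (IsSolution.continuous hbar (hsubI 0 h0I)), e, fieldCoeff_smul, hnorm_smul _ hε.le,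
      sobolevNorm_eq_hnorm]
  have hinit' : hnorm L s (w 0 - b 0) = 0 := by
    have hub0 : ubar 0 = ubar₀ := hbar.initial
    have hw0 : ustar 0 = ubar₀ := hstar.initial
    simp only [hw, hb]
    rw [hub0, hw0, sub_self]
    simp [hnorm, hterm]
  set y₀ := ε * sobolevNorm L (s + 1) utilde₀ with hy₀
  have hy₀0 : 0 ≤ y₀ := mul_nonneg hε.le (Real.sqrt_nonneg _)
  set S := ⨆ τ : Set.Icc (0 : ℝ) Tbar, sobolevNorm L (s + 1) (ubar τ) with hS
  set B := ∫ τ in (0 : ℝ)..Tbar, sobolevNorm L (s + 2) (ubar τ) with hBdef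
  have mbar : BddMeasOn Tbar fun τ => hnorm L (s + 2) (b τ) := cbar.bddMeasOn_hnorm
  have hB0 : 0 ≤ B := intervalIntegral.integral_nonneg hTb fun τ _ => Real.sqrt_nonneg _
  have hbS : ∀ τ ∈ Set.Icc 0 T, hnorm L (s + 1) (b τ) ≤ S := fun τ hτ => by
    have hbdd : BddAbove (Set.range fun τ : Set.Icc (0 : ℝ) Tbar =>
        sobolevNorm L (s + 1) (ubar τ)) := by
      obtain ⟨M, hM⟩ := (cbar.mono hL (by linarith : s + 1 ≤ s + 2)).bdd
      refine ⟨M, ?_⟩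
      rintro _ ⟨r, rfl⟩
      exact hM r r.2
    exact le_ciSup hbdd ⟨τ, hsubI τ hτ⟩
  have hS0 : 0 ≤ S := (hnorm_nonneg _ _ _).trans (hbS 0 h0I)
  have me := (cv.sub hL cb1).bddMeasOn_hnorm
  have md := (cw.sub hL (cb1.mono hL (by linarith : s ≤ s + 1))).bddMeasOn_hnorm
  have mb1 := cb1.bddMeasOn_hnorm
  have mb2 := cb.bddMeasOn_hnorm
  have hmono : ∀ τ ∈ Set.Icc 0 T, hnorm L (s + 1) (b τ) ≤ hnorm L (s + 2) (b τ) := fun τ hτ =>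
    (cb.mem τ hτ).hnorm_mono hL (by linarith)
  have hexp : y₀ * Tbar * C * Real.exp (C * B) ≤ 1 := by
    have h1 : y₀ * Tbar * C ≤ Real.exp (-(C * B)) := by
      refine le_trans (le_of_eq ?_) hsmall
      rw [hy₀]
      ring
    calc y₀ * Tbar * C * Real.exp (C * B) ≤ Real.exp (-(C * B)) * Real.exp (C * B) := by gcongr
      _ = 1 := by rw [← Real.exp_add, neg_add_cancel, Real.exp_zero]
  have hfinal : hnorm L s (w t - b t) ≤ 4 * κ * S * T * y₀ * Real.exp (4 * κ * B) := by
    refine le_of_integral_inequalities (T := T) (κ := κ) (y₀ := y₀) (B := B) (S := S)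
      (y := fun τ => hnorm L (s + 1) (v τ - b τ)) (Y := fun τ => hnorm L s (w τ - b τ))
      (β := fun τ => hnorm L (s + 2) (b τ)) hκ0 hy₀0 hS0 me md mb2
      (fun _ _ => hnorm_nonneg _ _ _) (fun _ _ => hnorm_nonneg _ _ _)
      (fun _ _ => hnorm_nonneg _ _ _) (fun r hr => ?_) (fun r hr => ?_) (fun r hr => ?_) ?_ ht
    · exact mbar.integral_le_integral (fun _ _ => hnorm_nonneg _ _ _) hr.1 (hsubI r hr).2 le_rfl
    · refine (hA T v b cv cb sv sb r hr).trans ?_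
      rw [hinit]
      refine add_le_add le_rfl (intervalIntegral.integral_mono_on hr.1
        ((((me.add mb2).const_mul _).mul me).intervalIntegrable h0I hr)
        ((((me.add mb2).const_mul _).mul me).intervalIntegrable h0I hr) fun τ _ => ?_)
      have h1 := hnorm_nonneg L (s + 1) (v τ - b τ)
      have h2 := hnorm_nonneg L (s + 2) (b τ)
      gcongr
      linarith
    · refine (hB T v b w cv cb1 cw sw sb r hr).trans ?_
      rw [hinit', zero_add]
      refine intervalIntegral.integral_mono_on hr.1
        (((((me.add mb1).const_mul _).mul md).add ((mb1.const_mul _).mul me)).intervalIntegrable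
          h0I hr)
        (((((me.add mb2).const_mul _).mul md).add (me.const_mul _)).intervalIntegrable h0I hr)
        fun τ hτ => ?_
      have hτT : τ ∈ Set.Icc 0 T := ⟨hτ.1, hτ.2.trans hr.2⟩
      have h1 := hnorm_nonneg L (s + 1) (v τ - b τ)
      have h2 := hnorm_nonneg L (s + 1) (b τ)
      have h3 := hnorm_nonneg L s (w τ - b τ)
      have h4 := hmono τ hτT
      have h5 := hbS τ hτT
      have h6 : K₂ ≤ κ := by linarith
      gcongr
    · calc 16 * κ * (y₀ * Real.exp (2 * κ * B)) * T
          ≤ C * (y₀ * Real.exp (C * B)) * Tbar := by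
            gcongr <;> linarith
        _ = y₀ * Tbar * C * Real.exp (C * B) := by ring
        _ ≤ 1 := hexp
  have hBint : B ≤ ∫ τ in (0 : ℝ)..Tbar, (1 + sobolevNorm L (s + 2) (ubar τ)) := by
    have hi := mbar.intervalIntegrable (a := 0) (b := Tbar) ⟨le_rfl, hTb⟩ ⟨hTb, le_rfl⟩
    exact intervalIntegral.integral_mono_on hTb hi (intervalIntegrable_const.add hi)
      fun τ _ => le_add_of_nonneg_left zero_le_one
  rw [sobolevNorm_eq_hnorm, fieldCoeff_sub (IsSolution.continuous hstar ht)
    (IsSolution.continuous hbar (hsubI t ht))]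
  refine hfinal.trans ?_
  have h4C : 4 * κ ≤ C := by linarith
  calc 4 * κ * S * T * y₀ * Real.exp (4 * κ * B)
      ≤ C * S * Tbar * y₀ *
        Real.exp (C * ∫ τ in (0 : ℝ)..Tbar, (1 + sobolevNorm L (s + 2) (ubar τ))) := by
        gcongr
    _ = _ := by ring
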